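/- **Setting.** Let $-\infty\le l<0<r\le\infty$ and $I=[l,r]\subset\overline{\mathbb R}$. Let $\mathbf s:(l,r)\to\mathbb R$ be increasing and non-constant with $\mathbf s(0-)=\mathbf s(0)=\mathbf s(0+)=0$; put $\mathbf s(l)=\lim_{x\downarrow l}\mathbf s(x)$ and $\mathbf s(r)=\lim_{x\uparrow r}\mathbf s(x)$ in $\overline{\mathbb R}$. Let $\mathfrak m$ be a positive Borel measure on $I$ with $\mathfrak m([a,b])<\infty$ for all $[a,b]\subset(l,r)$ and $\mathfrak m(\{0\})=0$ (the values $\mathfrak m(\{l\}),\mathfrak m(\{r\})$ may be infinite). Assume that $\operatorname{supp}\mathfrak m=I$ and that $\mathfrak m(\{x\})>0$ at every $x\in(l,r)$ at which $\mathbf s$ is neither left nor right continuous. **State space.** The endpoint $l$ is *approachable* if $\mathbf s(l)>-\infty$, and *reflecting* if moreover $\mathfrak m((l,c))<\infty$ for some $c\in(l,r)$ and $\mathfrak m(\{l\})<\infty$; similarly for $r$. Let $I_0$ be $[l,r]$ without its non-reflecting endpoints, with the topology of $\overline{\mathbb R}$ and the restriction of $\mathfrak m$. **The form.** Put $\mu_d^+=\sum_{x\in(l,r)}(\mathbf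 s(x+)-\mathbf s(x))\delta_x$ and $\mu_d^-=\sum_{x\in(l,r)}(\mathbf s(x)-\mathbf s(x-))\delta_x$. Let $\mathbf s_d^+(x)=\mu_d^+((0,x))$ and $\mathbf s_d^-(x)=\mu_d^-((0,x])$ for $x\ge0$, $\mathbf s_d^+(x)=-\mu_d^+([x,0))$ and $\mathbf s_d^-(x)=-\mu_d^-((x,0))$ for $x<0$. Let $\mu_c$ be the Lebesgue–Stieltjes measure of the continuous increasing function $\mathbf s_c=\mathbf s-\mathbf s_d^+-\mathbf s_d^-$ on $(l,r)$. Let $\mathscr S$ be the set of functions $f$ on $(l,r)$ of the form $$f(x)=c_0+\int_{(0,x)}g^c\,d\mu_c+\int_{(0,x)}g^+\,d\mu_d^++\int_{(0,x]}g^-\,d\mu_d^-,\qquad x\in(l,r),$$ with $c_0\in\mathbb R$, $g^c\in L^2(\mu_c)$, $g^\pm\in L^2(\mu_d^\pm)$, where $\int_{(0,x)}:=-\int_{[x,0)}$ and $\int_{(0,x]}:=-\int_{(x,0)}$ for $x<0$. Then $c_0,g^c,g^\pm$ are uniquely determined by $f$ (the densities almost everywhere); write $g^c_f,g^\pm_f$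 for them. At an approachable endpoint $j$ the limit $f(j):=\lim_{x\to j}f(x)$ exists in $\mathbb R$. Define $$\mathscr F=\{f\in\mathscr S\cap L^2(I_0,\mathfrak m): f(j)=0\text{ for each approachable endpoint } j\in\{l,r\}\text{ with } j\notin I_0\},$$ $$\mathscr E(f,g)=\tfrac12\Big(\int g^c_fg^c_g\,d\mu_c+\int g^+_fg^+_g\,d\mu_d^++\int g^-_fg^-_g\,d\mu_d^-\Big),\qquad f,g\in\mathscr F .$$ A *Dirichlet form* on $L^2(I_0,\mathfrak m)$ is a non-negative symmetric closed form with dense domain and the Markovian property. It is *regular* if $\mathscr F\cap C_c(I_0)$ is dense in $\mathscr F$ for the norm $(\mathscr E(f,f)+\|f\|_{L^2(I_0,\mathfrak m)}^2)^{1/2}$ and dense in $C_c(I_0)$ for the uniform norm. **Lemma.** Assume that $\mathbf s$ is strictly increasing. 1. $(\mathscr E,\mathscr F)$ is (a well-defined form on $L^2(I_0,\mathfrak m)$ and) a Dirichlet form on $L^2(I_0,\mathfrak m)$. 2. $(\mathscr E,\mathscr F)$ is regular on $L^2(I_0,\mathfrak m)$ if and only if $\mathbf s$ is continuous. -/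

import Mathlib

open Set Filter Topology MeasureTheory
open scoped ENNReal

noncomputable section

/-! ## Symmetric forms on an `L²`-space -/

/-- A bilinear form `form` defined on a linear subspace `domain` of `L²(X, μ)`. -/
structure L2Form {X : Type*} [MeasurableSpace X] (μ : Measure X) where
  domain : Submodule ℝ (Lp ℝ 2 μ)
  form : domain →ₗ[ℝ] domain →ₗ[ℝ] ℝ

namespace L2Form

variable {X : Type*} [MeasurableSpace X] {μ : Measure X}

/-- The squared norm `E₁(u, u) = E(u, u) + (u, u)` on the domain. -/
def energyOne (A : L2Form μ) (u : A.domain) : ℝ :=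
  A.form u u + ‖(u : Lp ℝ 2 μ)‖ ^ 2

/-- A Dirichlet form in the wide sense: a non-negative symmetric closed form with the
Markovian property (the domain need not be dense). -/
structure IsWideDirichletForm (A : L2Form μ) : Prop where
  symm : ∀ u v : A.domain, A.form u v = A.form v u
  nonneg : ∀ u : A.domain, 0 ≤ A.form u u
  /-- The domain is complete for the norm induced by `E₁`. -/
  closed : ∀ u : ℕ → A.domain,
    (∀ ε > 0, ∃ N, ∀ m ≥ N, ∀ n ≥ N, A.energyOne (u m - u n) < ε) →
      ∃ v : A.domain, Tendsto (fun n => A.energyOne (u n - v)) atTop (𝓝 0)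
  /-- The unit contraction `(0 ∨ u) ∧ 1` operates on the form. -/
  markov : ∀ u : A.domain, ∃ v : A.domain,
    ((v : Lp ℝ 2 μ) : X → ℝ) =ᵐ[μ] (fun x => min (max 0 ((u : Lp ℝ 2 μ) x)) 1) ∧
      A.form v v ≤ A.form u u

/-- A Dirichlet form on `L²(X, μ)`: one in the wide sense whose domain is dense in `L²(X, μ)`. -/
structure IsDirichletForm (A : L2Form μ) : Prop extends A.IsWideDirichletForm where
  dense : Dense (A.domain : Set (Lp ℝ 2 μ))

/-- Regularity: `domain ∩ C_c(X)` is `E₁`-dense in the domain and uniformly dense in `C_c(X)`. -/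
structure IsRegular [TopologicalSpace X] (A : L2Form μ) : Prop where
  dense_domain : ∀ u : A.domain, ∀ ε > 0, ∃ v : A.domain, ∃ φ : X → ℝ,
    Continuous φ ∧ HasCompactSupport φ ∧ ((v : Lp ℝ 2 μ) : X → ℝ) =ᵐ[μ] φ ∧
      A.energyOne (u - v) < ε
  dense_cc : ∀ ψ : X → ℝ, Continuous ψ → HasCompactSupport ψ → ∀ ε > 0,
    ∃ v : A.domain, ∃ φ : X → ℝ,
      Continuous φ ∧ HasCompactSupport φ ∧ ((v : Lp ℝ 2 μ) : X → ℝ) =ᵐ[μ] φ ∧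
        ∀ x, |ψ x - φ x| < ε

end L2Form

/-! ## Intervals with a (possibly discontinuous) scale and a speed measure -/

/-- A triple `(I, s, m)`: a closed interval `I = [l, r]` of the extended line with `l < 0 < r`,
an increasing (not necessarily strictly, not necessarily continuous) non-constant real function
`s` on `(l, r)` with `s(0-) = s(0) = s(0+) = 0`, and a positive Borel measure `m` on `I` which
is Radon on `(l, r)` and does not charge `0`. The measure `m` is carried by a Borel measure on the
extended line, of which only the restriction to `I` matters. -/
structure ScaleTriple where
  l : EReal
  r : EReal
  l_neg : l < 0
  r_pos : 0 < r
  s : Ioo l r → ℝ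
  mono : Monotone s
  nonconst : ∃ x y, s x ≠ s y
  s_zero : s ⟨0, l_neg, r_pos⟩ = 0
  s_cont_zero : ContinuousAt s ⟨0, l_neg, r_pos⟩
  m : Measure EReal
  m_radon : ∀ a ∈ Ioo l r, ∀ b ∈ Ioo l r, m (Icc a b) < ∞
  m_zero : m {0} = 0

namespace ScaleTriple

variable (T : ScaleTriple)

/-- The open interval `(l, r)`. In its order, `atBot` and `atTop` are the filters `x ↓ l` and
`x ↑ r`. -/
abbrev Interior : Type := Ioo T.l T.r

/-- The point `0` of `(l, r)`. -/
def zero : T.Interior := ⟨0, T.l_neg, T.r_pos⟩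

instance : CompactIccSpace T.Interior where
  isCompact_Icc {a b} := by
    rw [Subtype.isCompact_iff]
    have h : (Subtype.val '' Icc a b : Set EReal) = Icc (a : EReal) b := by
      ext x
      constructor
      · rintro ⟨y, hy, rfl⟩
        exact hy
      · intro hx
        exact ⟨⟨x, a.2.1.trans_le hx.1, hx.2.trans_lt b.2.2⟩, hx, rfl⟩
    rw [h]
    exact isCompact_Icc

/-- The set `D⁺` of points where `s` is not right continuous. -/
def rightJumps : Set T.Interior := {x | T.s x ≠ Function.rightLim T.s x}

/-- The set `D⁻` of points where `s` is not left continuous. -/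
def leftJumps : Set T.Interior := {x | T.s x ≠ Function.leftLim T.s x}

/-! ### Classification of the endpoints and the state space -/

/-- `s(l) = lim_{x ↓ l} s(x)` is finite. -/
def ApproachableLeft : Prop := ∃ a : ℝ, Tendsto T.s atBot (𝓝 a)

/-- `s(r) = lim_{x ↑ r} s(x)` is finite. -/
def ApproachableRight : Prop := ∃ a : ℝ, Tendsto T.s atTop (𝓝 a)

/-- `l` is approachable, `m` is finite near `l` in `(l, r)` (that is, `l` is regular), and
`m({l}) < ∞`. -/
def ReflectingLeft : Prop :=
  T.ApproachableLeft ∧ (∃ c ∈ Ioo T.l T.r, T.m (Ioo T.l c) < ∞) ∧ T.m {T.l} < ∞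

/-- `r` is approachable, `m` is finite near `r` in `(l, r)` (that is, `r` is regular), and
`m({r}) < ∞`. -/
def ReflectingRight : Prop :=
  T.ApproachableRight ∧ (∃ c ∈ Ioo T.l T.r, T.m (Ioo c T.r) < ∞) ∧ T.m {T.r} < ∞

/-- The interval `I₀`: the interval `[l, r]` without its non-reflecting endpoints. -/
def space : Set EReal :=
  {x | x ∈ Ioo T.l T.r ∨ (x = T.l ∧ T.ReflectingLeft) ∨ (x = T.r ∧ T.ReflectingRight)}

/-- The restriction of `m` to `I₀`. -/
def speed : Measure T.space := T.m.comap Subtype.val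

/-- The restriction to `(l, r)` of a function on `I₀`. -/
def restr (f : T.space → ℝ) : T.Interior → ℝ := fun x => f ⟨x, Or.inl x.2⟩

/-! ### The three measures induced by the scale -/

/-- `μ_d⁺ = ∑ₓ (s(x+) - s(x)) δₓ`. -/
def muPlus : Measure T.Interior :=
  Measure.sum fun x => ENNReal.ofReal (Function.rightLim T.s x - T.s x) • Measure.dirac x

/-- `μ_d⁻ = ∑ₓ (s(x) - s(x-)) δₓ`. -/
def muMinus : Measure T.Interior :=
  Measure.sum fun x => ENNReal.ofReal (T.s x - Function.leftLim T.s x) • Measure.dirac x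

open Classical in
/-- `s_d⁺(x) = μ_d⁺((0, x))` for `x ≥ 0` and `-μ_d⁺([x, 0))` for `x < 0`. -/
def sPlus (x : T.Interior) : ℝ :=
  if T.zero ≤ x then (T.muPlus (Ioo T.zero x)).toReal else -(T.muPlus (Ico x T.zero)).toReal

open Classical in
/-- `s_d⁻(x) = μ_d⁻((0, x])` for `x ≥ 0` and `-μ_d⁻((x, 0))` for `x < 0`. -/
def sMinus (x : T.Interior) : ℝ :=
  if T.zero ≤ x then (T.muMinus (Ioc T.zero x)).toReal else -(T.muMinus (Ioo x T.zero)).toReal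

/-- The continuous part `s_c = s - s_d⁺ - s_d⁻` of the scale. -/
def sCont (x : T.Interior) : ℝ := T.s x - T.sPlus x - T.sMinus x

lemma muPlus_apply {A : Set T.Interior} (hA : MeasurableSet A) :
    T.muPlus A = ∑' x, A.indicator (fun x => ENNReal.ofReal (Function.rightLim T.s x - T.s x)) x := by
  classical
  rw [muPlus, Measure.sum_apply _ hA]
  refine tsum_congr fun x => ?_
  simp [Measure.dirac_apply' x hA, indicator]

lemma muMinus_apply {A : Set T.Interior} (hA : MeasurableSet A) :
    T.muMinus A = ∑' x, A.indicator (fun x => ENNReal.ofReal (T.s x - Function.leftLim T.s x)) x := by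
  classical
  rw [muMinus, Measure.sum_apply _ hA]
  refine tsum_congr fun x => ?_
  simp [Measure.dirac_apply' x hA, indicator]

/-- The jumps of `s` between `x` and `y` add up to at most `s(y) - s(x)`. -/
lemma jumps_le {x y : T.Interior} :
    T.muPlus (Ico x y) + T.muMinus (Ioc x y) ≤ ENNReal.ofReal (T.s y - T.s x) := by
  classical
  let A : T.Interior ⊕ T.Interior → Set ℝ := fun z => match z with
    | .inl z => if z ∈ Ico x y then Ioo (T.s z) (Function.rightLim T.s z) else ∅
    | .inr z => if z ∈ Ioc x y then Ioo (Function.leftLim T.s z) (T.s z) else ∅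
  have hmeas : ∀ z, MeasurableSet (A z) := by
    rintro (z | z) <;> simp only [A] <;> split_ifs <;> simp
  have hlt : ∀ {z w : T.Interior}, z < w →
      Function.rightLim T.s z ≤ Function.leftLim T.s w := fun h => T.mono.rightLim_le_leftLim h
  have h1 : ∀ z, Function.leftLim T.s z ≤ T.s z := fun z => T.mono.leftLim_le le_rfl
  have h2 : ∀ z, T.s z ≤ Function.rightLim T.s z := fun z => T.mono.le_rightLim le_rfl
  have hA : ∀ z t, t ∈ A z →
      (∃ w, z = .inl w ∧ w ∈ Ico x y ∧ T.s w < t ∧ t < Function.rightLim T.s w) ∨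
      (∃ w, z = .inr w ∧ w ∈ Ioc x y ∧ Function.leftLim T.s w < t ∧ t < T.s w) := by
    rintro (z | z) t ht <;> simp only [A] at ht <;> split_ifs at ht with h
    · exact Or.inl ⟨z, rfl, h, ht.1, ht.2⟩
    · exact ht.elim
    · exact Or.inr ⟨z, rfl, h, ht.1, ht.2⟩
    · exact ht.elim
  have hdisj : Pairwise (Function.onFun Disjoint A) := by
    intro a b hab
    rw [Function.onFun, Set.disjoint_left]
    intro t ha hb
    rcases hA a t ha with ⟨z, rfl, -, h3, h4⟩ | ⟨z, rfl, -, h3, h4⟩ <;>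
    rcases hA b t hb with ⟨w, rfl, -, h5, h6⟩ | ⟨w, rfl, -, h5, h6⟩ <;>
    rcases lt_trichotomy z w with h | h | h
    all_goals first
      | exact (hab (congrArg Sum.inl h)).elim
      | exact (hab (congrArg Sum.inr h)).elim
      | (have := hlt h; have := h1 z; have := h1 w; have := h2 z; have := h2 w; linarith)
      | (subst h; linarith)
  have hsub : (⋃ z, A z) ⊆ Icc (T.s x) (T.s y) := by
    intro t ht
    obtain ⟨z, hz⟩ := mem_iUnion.1 ht
    rcases hA z t hz with ⟨w, -, hw, h3, h4⟩ | ⟨w, -, hw, h3, h4⟩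
    · exact ⟨(T.mono hw.1).trans h3.le, h4.le.trans (T.mono.rightLim_le hw.2)⟩
    · exact ⟨(T.mono.le_leftLim hw.1).trans h3.le, h4.le.trans (T.mono hw.2)⟩
  have hsum := (tsum_meas_le_meas_iUnion_of_disjoint volume hmeas hdisj).trans (measure_mono hsub)
  rw [Real.volume_Icc] at hsum
  refine le_trans (le_of_eq ?_) hsum
  rw [ENNReal.summable.tsum_sum ENNReal.summable, T.muPlus_apply measurableSet_Ico,
    T.muMinus_apply measurableSet_Ioc]
  congr 1
  · refine tsum_congr fun z => ?_
    simp only [indicator, A]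
    split_ifs <;> simp
  · refine tsum_congr fun z => ?_
    simp only [indicator, A]
    split_ifs <;> simp

lemma muPlus_Ico_ne_top (x y : T.Interior) : T.muPlus (Ico x y) ≠ ∞ :=
  ne_top_of_le_ne_top ENNReal.ofReal_ne_top (le_self_add.trans (T.jumps_le (x := x) (y := y)))

lemma muMinus_Ioc_ne_top (x y : T.Interior) : T.muMinus (Ioc x y) ≠ ∞ :=
  ne_top_of_le_ne_top ENNReal.ofReal_ne_top (le_add_self.trans (T.jumps_le (x := x) (y := y)))

lemma sPlus_sub_le {x y : T.Interior} (h : x ≤ y) :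
    T.sPlus y - T.sPlus x ≤ (T.muPlus (Ico x y)).toReal := by
  have fin : ∀ a b : T.Interior, T.muPlus (Ioo a b) ≠ ∞ := fun a b =>
    ne_top_of_le_ne_top (T.muPlus_Ico_ne_top a b) (measure_mono Ioo_subset_Ico_self)
  have fin' := T.muPlus_Ico_ne_top
  unfold sPlus
  by_cases hx : T.zero ≤ x
  · rw [if_pos hx, if_pos (hx.trans h), sub_le_iff_le_add, ← ENNReal.toReal_add (fin' _ _) (fin _ _)]
    refine ENNReal.toReal_mono (ENNReal.add_ne_top.2 ⟨fin' _ _, fin _ _⟩) ?_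
    refine (measure_mono fun z hz => ?_).trans (measure_union_le _ _)
    rcases le_or_gt x z with h' | h'
    · exact Or.inl ⟨h', hz.2⟩
    · exact Or.inr ⟨hz.1, h'⟩
  · rw [if_neg hx]
    have hx := not_le.1 hx
    by_cases hy : T.zero ≤ y
    · rw [if_pos hy, sub_neg_eq_add, ← ENNReal.toReal_add (fin _ _) (fin' _ _)]
      refine ENNReal.toReal_mono (fin' _ _) ?_
      rw [← measure_union _ measurableSet_Ico]
      · refine measure_mono ?_
        rintro z (hz | hz)
        · exact ⟨(hx.trans hz.1).le, hz.2⟩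
        · exact ⟨hz.1, hz.2.trans_le hy⟩
      · rw [Set.disjoint_left]
        intro z hz hz'
        exact lt_asymm hz.1 hz'.2
    · rw [if_neg hy, sub_neg_eq_add, neg_add_le_iff_le_add, add_comm,
        ← ENNReal.toReal_add (fin' _ _) (fin' _ _)]
      refine ENNReal.toReal_mono (ENNReal.add_ne_top.2 ⟨fin' _ _, fin' _ _⟩) ?_
      refine (measure_mono fun z hz => ?_).trans (measure_union_le _ _)
      rcases lt_or_ge z y with h' | h'
      · exact Or.inl ⟨hz.1, h'⟩
      · exact Or.inr ⟨h', hz.2⟩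

lemma sMinus_sub_le {x y : T.Interior} (h : x ≤ y) :
    T.sMinus y - T.sMinus x ≤ (T.muMinus (Ioc x y)).toReal := by
  have fin : ∀ a b : T.Interior, T.muMinus (Ioo a b) ≠ ∞ := fun a b =>
    ne_top_of_le_ne_top (T.muMinus_Ioc_ne_top a b) (measure_mono Ioo_subset_Ioc_self)
  have fin' := T.muMinus_Ioc_ne_top
  unfold sMinus
  by_cases hx : T.zero ≤ x
  · rw [if_pos hx, if_pos (hx.trans h), sub_le_iff_le_add, ← ENNReal.toReal_add (fin' _ _) (fin' _ _)]
    refine ENNReal.toReal_mono (ENNReal.add_ne_top.2 ⟨fin' _ _, fin' _ _⟩) ?_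
    refine (measure_mono fun z hz => ?_).trans (measure_union_le _ _)
    rcases lt_or_ge x z with h' | h'
    · exact Or.inl ⟨h', hz.2⟩
    · exact Or.inr ⟨hz.1, h'⟩
  · rw [if_neg hx]
    have hx := not_le.1 hx
    by_cases hy : T.zero ≤ y
    · rw [if_pos hy, sub_neg_eq_add, ← ENNReal.toReal_add (fin' _ _) (fin _ _)]
      refine ENNReal.toReal_mono (fin' _ _) ?_
      rw [← measure_union _ measurableSet_Ioo]
      · refine measure_mono ?_
        rintro z (hz | hz)
        · exact ⟨hx.trans hz.1, hz.2⟩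
        · exact ⟨hz.1, (hz.2.trans_le hy).le⟩
      · rw [Set.disjoint_left]
        intro z hz hz'
        exact lt_asymm hz.1 hz'.2
    · rw [if_neg hy, sub_neg_eq_add, neg_add_le_iff_le_add, add_comm,
        ← ENNReal.toReal_add (fin' _ _) (fin _ _)]
      refine ENNReal.toReal_mono (ENNReal.add_ne_top.2 ⟨fin' _ _, fin _ _⟩) ?_
      refine (measure_mono fun z hz => ?_).trans (measure_union_le _ _)
      rcases le_or_gt z y with h' | h'
      · exact Or.inl ⟨hz.1, h'⟩
      · exact Or.inr ⟨h', hz.2⟩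

lemma sCont_mono : Monotone T.sCont := by
  intro x y h
  have h1 := T.sPlus_sub_le h
  have h2 := T.sMinus_sub_le h
  have h3 := ENNReal.toReal_mono ENNReal.ofReal_ne_top (T.jumps_le (x := x) (y := y))
  rw [ENNReal.toReal_add (T.muPlus_Ico_ne_top x y) (T.muMinus_Ioc_ne_top x y),
    ENNReal.toReal_ofReal (sub_nonneg.2 (T.mono h))] at h3
  unfold sCont
  linarith

/-- The Lebesgue-Stieltjes measure `μ_c` of the increasing continuous function `s_c`. -/
def muCont : Measure T.Interior := T.sCont_mono.stieltjesFunction.measure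

/-! ### Absolute continuity with respect to the scale, and the quadratic form -/

open Classical in
/-- `∫_{(0,x)} g dμ`, understood as `-∫_{[x,0)} g dμ` for `x < 0`. -/
def intIoo (μ : Measure T.Interior) (g : T.Interior → ℝ) (x : T.Interior) : ℝ :=
  if T.zero ≤ x then ∫ y in Ioo T.zero x, g y ∂μ else -∫ y in Ico x T.zero, g y ∂μ

open Classical in
/-- `∫_{(0,x]} g dμ`, understood as `-∫_{(x,0)} g dμ` for `x < 0`. -/
def intIoc (μ : Measure T.Interior) (g : T.Interior → ℝ) (x : T.Interior) : ℝ :=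
  if T.zero ≤ x then ∫ y in Ioc T.zero x, g y ∂μ else -∫ y in Ioo x T.zero, g y ∂μ

/-- `f = f^c + f⁺ + f⁻` belongs to `𝒮 = 𝒮_c + 𝒮_d⁺ + 𝒮_d⁻`, with square integrable densities
`df^c/dμ_c = gc`, `df⁺/dμ_d⁺ = gp` and `df⁻/dμ_d⁻ = gm`. -/
structure HasScaleDeriv (f gc gp gm : T.Interior → ℝ) : Prop where
  memLp_cont : MemLp gc 2 T.muCont
  memLp_plus : MemLp gp 2 T.muPlus
  memLp_minus : MemLp gm 2 T.muMinus
  eq_integral : ∃ c₀ : ℝ, ∀ x,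
    f x = (c₀ + T.intIoo T.muCont gc x) + T.intIoo T.muPlus gp x + T.intIoc T.muMinus gm x

/-- The class `ℱ` of functions on `I₀`: square integrable, of class `𝒮` on `(l, r)`, with the value
`lim_{x → j} f(x)` at a reflecting endpoint `j`, and with `lim_{x → j} f(x) = 0` at an approachable
endpoint `j` that does not belong to `I₀`. -/
structure MemF (f : T.space → ℝ) : Prop where
  scale : ∃ gc gp gm, T.HasScaleDeriv (T.restr f) gc gp gm
  memLp : MemLp f 2 T.speed
  left_mem : ∀ h : T.l ∈ T.space, Tendsto (T.restr f) atBot (𝓝 (f ⟨T.l, h⟩))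
  right_mem : ∀ h : T.r ∈ T.space, Tendsto (T.restr f) atTop (𝓝 (f ⟨T.r, h⟩))
  left_notMem : T.l ∉ T.space → T.ApproachableLeft → Tendsto (T.restr f) atBot (𝓝 0)
  right_notMem : T.r ∉ T.space → T.ApproachableRight → Tendsto (T.restr f) atTop (𝓝 0)

/-- `A` is the quadratic form `(ℰ, ℱ)` on `L²(I₀, m)` associated with `(I, s, m)`: its domain consists
of the classes of the functions in `ℱ`, and on these
`ℰ(f, g) = ½ ∫ (df/ds) (dg/ds) ds`, the integral being the sum of the three integrals of products
of densities with respect to `μ_c`, `μ_d⁺` and `μ_d⁻`. These two conditions determine `A`. -/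
structure IsAssociatedForm (A : L2Form T.speed) : Prop where
  mem_domain : ∀ u : Lp ℝ 2 T.speed, u ∈ A.domain ↔ ∃ f, T.MemF f ∧ u =ᵐ[T.speed] f
  form_eq : ∀ (u v : A.domain) (f g : T.space → ℝ), T.MemF f → T.MemF g →
    (u : Lp ℝ 2 T.speed) =ᵐ[T.speed] f → (v : Lp ℝ 2 T.speed) =ᵐ[T.speed] g →
    ∀ fc fp fm gc gp gm, T.HasScaleDeriv (T.restr f) fc fp fm →
      T.HasScaleDeriv (T.restr g) gc gp gm →
      A.form u v = 1 / 2 * ((∫ x, fc x * gc x ∂T.muCont) + (∫ x, fp x * gp x ∂T.muPlus)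
        + ∫ x, fm x * gm x ∂T.muMinus)

end ScaleTriple

end

/-! The three densities of a function in `𝒮` become one density on the disjoint union of three
copies of `(l, r)`, carrying `μ_c`, `μ_d⁺`, `μ_d⁻`. In it, `gap x y` is `[x, y)`, `[x, y)`, `(x, y]`
in the three copies, and its measure is `s(y) - s(x)` (`scaleMeasure_gap`). So `f ∈ 𝒮` means `f(y) -
f(x) = ∫_{gap x y} g` with `g ∈ L²` (`HasDens`), and the form is half the inner product of
densities. Cauchy-Schwarz gives `(f(y) - f(x))² ≤ (s(y) - s(x)) ∫_{gap x y} g²`, an estimate that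
also controls limits at approachable endpoints.

The converse is a Riesz criterion, `exists_hasDens`: if `(v(y) - v(x))² ≤ (s(y) - s(x))(H(y) -
H(x))` with `H` increasing of oscillation at most `M`, then `v` has a density of squared norm at
most `M`. It yields the Markov property, products, and Lipschitz functions of the scale.

Dirichlet form. The density of an element of `L²(I₀, m)` is well defined: a function with a density
that vanishes a.e. vanishes everywhere (`HasDens.eq_zero_of_ae`; full support handles one-sided
continuity points of `s`, the atoms handle the others), and a density is determined by its
primitive. The graph of this map is closed (`Rel.of_tendsto`). The domain is dense because
trapezoidal functions of a strictly increasing scale converge to indicators of compact intervals.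

Regularity. If `s` jumps at `x₀`, some function of the scale in `ℱ` jumps at `x₀`. Since an
increment is controlled by the energy, a continuous function cannot be close to it in energy. If `s`
is continuous, every function in `ℱ` is continuous. Cutoffs in value and in scale then give
compactly supported functions of bounded energy converging pointwise, hence weakly, and for a linear
space the weak and the norm closure agree (`mem_closure_compactGraph`). Uniform density in `C_c(I₀)`
follows by approximation with Lipschitz functions of the scale (`exists_memF_near`). -/

noncomputable section

/-! ### Weak compactness, Cauchy-Schwarz, and measures on disjoint unions -/

/-- Bounded families in a Hilbert space converge weakly along ultrafilters. -/
lemma exists_weak_limit {ι H : Type*} [NormedAddCommGroup H] [InnerProductSpace ℝ H]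
    [CompleteSpace H] (U : Ultrafilter ι) (g : ι → H) (M : ℝ) (hg : ∀ i, ‖g i‖ ≤ M) :
    ∃ g' : H, ‖g'‖ ≤ M ∧ ∀ w, Tendsto (fun i => inner ℝ (g i) w) U (𝓝 (inner ℝ g' w)) := by
  let Φ : ι → WeakDual ℝ H := fun i => StrongDual.toWeakDual (InnerProductSpace.toDual ℝ H (g i))
  -- Banach-Alaoglu, after identifying the Hilbert space with its dual.
  have hK := WeakDual.isCompact_closedBall (𝕜 := ℝ) (E := H) 0 M
  obtain ⟨φ, hφ, hlim⟩ := hK.ultrafilter_le_nhds (U.map Φ) (by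
    rw [Filter.le_principal_iff, Ultrafilter.mem_coe, Ultrafilter.mem_map]
    refine Filter.univ_mem' fun i => ?_
    simpa [Φ] using hg i)
  refine ⟨(InnerProductSpace.toDual ℝ H).symm (WeakDual.toStrongDual φ), ?_, fun w => ?_⟩
  · simpa using hφ
  · have h1 : Tendsto Φ U (𝓝 φ) := hlim
    have h2 := ((WeakDual.eval_continuous (𝕜 := ℝ) w).tendsto φ).comp h1
    simpa [Φ, Function.comp_def] using h2

/-- The Cauchy-Schwarz inequality for the integral over a set. -/
lemma sq_setIntegral_le {X : Type*} [MeasurableSpace X] {μ : Measure X} {g : X → ℝ}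
    (hg : MemLp g 2 μ) {A : Set X} (hA : μ A ≠ ∞) :
    (∫ x in A, g x ∂μ) ^ 2 ≤ (μ A).toReal * ∫ x in A, g x ^ 2 ∂μ := by
  have hfin : IsFiniteMeasure (μ.restrict A) := ⟨by simpa using hA.lt_top⟩
  have hg' : MemLp g 2 (μ.restrict A) := hg.restrict A
  have hi : Integrable g (μ.restrict A) := hg'.integrable one_le_two
  have hi2 : Integrable (fun x => g x ^ 2) (μ.restrict A) := hg'.integrable_sq
  set c := ∫ x in A, g x ∂μ with hc
  set m := (μ A).toReal with hm
  have hm' : (μ.restrict A).real univ = m := by simp [hm, Measure.real]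
  -- Expanding this square gives `m (m ∫ g² - c²) ≥ 0`; one factor `m` is then cancelled, the case
  -- `m = 0` being treated apart.
  have key : 0 ≤ ∫ x in A, (m * g x - c) ^ 2 ∂μ := integral_nonneg fun x => sq_nonneg _
  have e : ∫ x in A, (m * g x - c) ^ 2 ∂μ
      = m ^ 2 * (∫ x in A, g x ^ 2 ∂μ) - 2 * m * c * c + c ^ 2 * m := by
    have : ∀ x, (m * g x - c) ^ 2 = m ^ 2 * g x ^ 2 - 2 * m * c * g x + c ^ 2 := fun x => by ring
    simp_rw [this]
    rw [integral_add (by exact (hi2.const_mul _).sub (hi.const_mul _)) (integrable_const _),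
      integral_sub (hi2.const_mul _) (hi.const_mul _), integral_const_mul, integral_const_mul,
      integral_const, hm', ← hc, smul_eq_mul]
    ring
  rw [e] at key
  have hm0 : 0 ≤ m := ENNReal.toReal_nonneg
  rcases hm0.eq_or_lt with h0 | h0
  · have hA0 : μ A = 0 := by
      rcases (ENNReal.toReal_eq_zero_iff _).1 h0.symm with h | h
      · exact h
      · exact absurd h hA
    have : c = 0 := by rw [hc, Measure.restrict_eq_zero.2 hA0, integral_zero_measure]
    rw [this, ← h0]; simp
  · nlinarith

/-- An integrable function whose integrals over all lower intervals vanish is null. -/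
lemma ae_eq_zero_of_forall_integral_Iic {X : Type*} [LinearOrder X] [TopologicalSpace X]
    [OrderTopology X] [SecondCountableTopology X] [MeasurableSpace X] [BorelSpace X]
    {μ : Measure X} {f : X → ℝ} (hf : Integrable f μ)
    (h : ∀ c, ∫ x in Iic c, f x ∂μ = 0) : f =ᵐ[μ] 0 := by
  -- The positive and negative parts of `f` define two finite measures. They agree on the lower
  -- intervals, which determine a finite measure, so every integral of `f` over a measurable set
  -- vanishes.
  have key : ∀ A, MeasurableSet A → ((∫ x in A, f x ∂μ = 0) ↔
      μ.withDensity (fun x => ENNReal.ofReal (f x)) A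
        = μ.withDensity (fun x => ENNReal.ofReal (-f x)) A) := by
    intro A hA
    rw [withDensity_apply _ hA, withDensity_apply _ hA,
      integral_eq_lintegral_pos_part_sub_lintegral_neg_part hf.integrableOn, sub_eq_zero,
      ENNReal.toReal_eq_toReal_iff']
    · exact hf.integrableOn.lintegral_lt_top.ne
    · exact hf.neg.integrableOn.lintegral_lt_top.ne
  have f1 : IsFiniteMeasure (μ.withDensity fun x => ENNReal.ofReal (f x)) :=
    isFiniteMeasure_withDensity_ofReal hf.2
  have f2 : IsFiniteMeasure (μ.withDensity fun x => ENNReal.ofReal (-f x)) :=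
    isFiniteMeasure_withDensity_ofReal hf.neg.2
  have heq := Measure.ext_of_Iic _ _ fun c => (key _ measurableSet_Iic).1 (h c)
  exact hf.ae_eq_zero_of_forall_setIntegral_eq_zero
    fun A hA _ => (key A hA).2 (by rw [heq])

/-- The sum of two measures on the disjoint union. -/
def sumMeasure {X Z : Type*} [MeasurableSpace X] [MeasurableSpace Z] (μ : Measure X)
    (ν : Measure Z) : Measure (X ⊕ Z) := μ.map Sum.inl + ν.map Sum.inr

section SumMeasure
variable {X Z : Type*} [MeasurableSpace X] [MeasurableSpace Z] {μ : Measure X} {ν : Measure Z}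

lemma measurableEmbedding_inl : MeasurableEmbedding (Sum.inl : X → X ⊕ Z) :=
  ⟨Sum.inl_injective, measurable_inl, fun _ => measurableSet_inl_image.2⟩

lemma measurableEmbedding_inr : MeasurableEmbedding (Sum.inr : Z → X ⊕ Z) :=
  ⟨Sum.inr_injective, measurable_inr, fun _ => measurableSet_inr_image.2⟩

instance [MeasurableSingletonClass X] [MeasurableSingletonClass Z] :
    MeasurableSingletonClass (X ⊕ Z) where
  measurableSet_singleton := by
    rintro (x | z)
    · rw [← image_singleton]
      exact measurableSet_inl_image.2 (measurableSet_singleton x)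
    · rw [← image_singleton]
      exact measurableSet_inr_image.2 (measurableSet_singleton z)

lemma sumMeasure_apply (A : Set (X ⊕ Z)) :
    sumMeasure μ ν A = μ (Sum.inl ⁻¹' A) + ν (Sum.inr ⁻¹' A) := by
  rw [sumMeasure, Measure.add_apply, measurableEmbedding_inl.map_apply,
    measurableEmbedding_inr.map_apply]

lemma integrable_sumMeasure {g : X ⊕ Z → ℝ} : Integrable g (sumMeasure μ ν) ↔
    Integrable (g ∘ Sum.inl) μ ∧ Integrable (g ∘ Sum.inr) ν := by
  rw [sumMeasure, integrable_add_measure, measurableEmbedding_inl.integrable_map_iff,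
    measurableEmbedding_inr.integrable_map_iff]

lemma integral_sumMeasure {g : X ⊕ Z → ℝ} (hg : Integrable g (sumMeasure μ ν)) :
    ∫ y, g y ∂(sumMeasure μ ν) = (∫ x, g (Sum.inl x) ∂μ) + ∫ z, g (Sum.inr z) ∂ν := by
  have h := hg
  rw [sumMeasure, integrable_add_measure] at h
  rw [sumMeasure, integral_add_measure h.1 h.2, measurableEmbedding_inl.integral_map,
    measurableEmbedding_inr.integral_map]

lemma memLp_sumMeasure {g : X ⊕ Z → ℝ} : MemLp g 2 (sumMeasure μ ν) ↔
    MemLp (g ∘ Sum.inl) 2 μ ∧ MemLp (g ∘ Sum.inr) 2 ν := by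
  rw [← measurableEmbedding_inl.memLp_map_measure_iff (μ := μ),
    ← measurableEmbedding_inr.memLp_map_measure_iff (μ := ν)]
  constructor
  · exact fun h => ⟨h.mono_measure (Measure.le_add_right le_rfl),
      h.mono_measure (Measure.le_add_left le_rfl)⟩
  · rintro ⟨h1, h2⟩
    have m : AEStronglyMeasurable g (sumMeasure μ ν) := by
      rw [sumMeasure, aestronglyMeasurable_add_measure_iff]; exact ⟨h1.1, h2.1⟩
    rw [memLp_two_iff_integrable_sq m, sumMeasure, integrable_add_measure]
    exact ⟨h1.integrable_sq, h2.integrable_sq⟩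

lemma restrict_sumMeasure {A : Set (X ⊕ Z)} :
    (sumMeasure μ ν).restrict A =
      sumMeasure (μ.restrict (Sum.inl ⁻¹' A)) (ν.restrict (Sum.inr ⁻¹' A)) := by
  rw [sumMeasure, sumMeasure, Measure.restrict_add, measurableEmbedding_inl.restrict_map,
    measurableEmbedding_inr.restrict_map]

lemma ae_sumMeasure {p : X ⊕ Z → Prop} : (∀ᵐ y ∂(sumMeasure μ ν), p y) ↔
    (∀ᵐ x ∂μ, p (Sum.inl x)) ∧ ∀ᵐ z ∂ν, p (Sum.inr z) := by
  rw [sumMeasure, ae_add_measure_iff, measurableEmbedding_inl.ae_map_iff,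
    measurableEmbedding_inr.ae_map_iff]

end SumMeasure

/-! ### The jump measures and the continuity of `s_c` -/

namespace ScaleTriple
variable (T : ScaleTriple)

lemma muPlus_singleton (x : T.Interior) :
    T.muPlus {x} = ENNReal.ofReal (Function.rightLim T.s x - T.s x) := by
  rw [T.muPlus_apply (measurableSet_singleton x), tsum_eq_single x]
  · simp
  · intro y hy; simp [hy]

lemma muMinus_singleton (x : T.Interior) :
    T.muMinus {x} = ENNReal.ofReal (T.s x - Function.leftLim T.s x) := by
  rw [T.muMinus_apply (measurableSet_singleton x), tsum_eq_single x]
  · simp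
  · intro y hy; simp [hy]

instance : Nonempty T.Interior := ⟨T.zero⟩

lemma exists_lt_interior (x : T.Interior) : ∃ y : T.Interior, y < x := by
  obtain ⟨y, h1, h2⟩ := exists_between x.2.1
  exact ⟨⟨y, h1, h2.trans x.2.2⟩, h2⟩

lemma exists_gt_interior (x : T.Interior) : ∃ y : T.Interior, x < y := by
  obtain ⟨y, h1, h2⟩ := exists_between x.2.2
  exact ⟨⟨y, x.2.1.trans h1, h2⟩, h1⟩

instance : NoMinOrder T.Interior := ⟨T.exists_lt_interior⟩
instance : NoMaxOrder T.Interior := ⟨T.exists_gt_interior⟩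

lemma muPlus_zero : T.muPlus {T.zero} = 0 := by
  have h : Function.rightLim T.s T.zero = T.s T.zero :=
    T.s_cont_zero.continuousWithinAt.rightLim_eq
  simp [muPlus_singleton, h]

lemma muMinus_zero : T.muMinus {T.zero} = 0 := by
  have h : Function.leftLim T.s T.zero = T.s T.zero :=
    T.s_cont_zero.continuousWithinAt.leftLim_eq
  simp [muMinus_singleton, h]

/-- The definition uses `(0, x)` on the right of `0` and `[x, 0)` on the left. Because `0` is a null
point, both fit the single convention of half-open intervals `[x, y)`, for which increments add up.
-/
lemma intIoo_sub {μ : Measure T.Interior} (h0 : μ {T.zero} = 0) {g : T.Interior → ℝ}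
    (hg : ∀ x y, IntegrableOn g (Ico x y) μ) {x y : T.Interior} (h : x ≤ y) :
    T.intIoo μ g y - T.intIoo μ g x = ∫ z in Ico x y, g z ∂μ := by
  have e : ∀ a, ∫ z in Ioo T.zero a, g z ∂μ = ∫ z in Ico T.zero a, g z ∂μ := fun a => by
    refine setIntegral_congr_set ?_
    have := sdiff_null_ae_eq_self (s := Ico T.zero a) h0
    rwa [Ico_sdiff_left] at this
  have add : ∀ {a b c}, a ≤ b → b ≤ c → (∫ z in Ico a b, g z ∂μ) + ∫ z in Ico b c, g z ∂μ
      = ∫ z in Ico a c, g z ∂μ := fun {a b c} hab hbc => by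
    rw [← Ico_union_Ico_eq_Ico hab hbc, setIntegral_union _ measurableSet_Ico (hg _ _) (hg _ _)]
    rw [Set.disjoint_left]; intro z hz hz'; exact absurd hz.2 (not_lt.2 hz'.1)
  unfold intIoo
  by_cases hx : T.zero ≤ x
  · rw [if_pos hx, if_pos (hx.trans h), e, e, ← add hx h]; ring
  · have hx' := (not_le.1 hx).le
    by_cases hy : T.zero ≤ y
    · rw [if_neg hx, if_pos hy, e, ← add hx' hy]; ring
    · rw [if_neg hx, if_neg hy, ← add h (not_le.1 hy).le]; ring

lemma intIoc_sub {μ : Measure T.Interior} (h0 : μ {T.zero} = 0) {g : T.Interior → ℝ}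
    (hg : ∀ x y, IntegrableOn g (Ioc x y) μ) {x y : T.Interior} (h : x ≤ y) :
    T.intIoc μ g y - T.intIoc μ g x = ∫ z in Ioc x y, g z ∂μ := by
  have e : ∀ a, ∫ z in Ioo a T.zero, g z ∂μ = ∫ z in Ioc a T.zero, g z ∂μ := fun a => by
    refine setIntegral_congr_set ?_
    have := sdiff_null_ae_eq_self (s := Ioc a T.zero) h0
    rwa [Ioc_sdiff_right] at this
  have add : ∀ {a b c}, a ≤ b → b ≤ c → (∫ z in Ioc a b, g z ∂μ) + ∫ z in Ioc b c, g z ∂μ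
      = ∫ z in Ioc a c, g z ∂μ := fun {a b c} hab hbc => by
    rw [← Ioc_union_Ioc_eq_Ioc hab hbc, setIntegral_union _ measurableSet_Ioc (hg _ _) (hg _ _)]
    rw [Set.disjoint_left]; intro z hz hz'; exact absurd hz'.1 (not_lt.2 hz.2)
  unfold intIoc
  by_cases hx : T.zero ≤ x
  · rw [if_pos hx, if_pos (hx.trans h), ← add hx h]; ring
  · have hx' := (not_le.1 hx).le
    by_cases hy : T.zero ≤ y
    · rw [if_neg hx, if_pos hy, e, ← add hx' hy]; ring
    · rw [if_neg hx, if_neg hy, e, e, ← add h (not_le.1 hy).le]; ring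

/-- The jump function `s_d⁺` is the primitive of the constant density `1`, so the earlier bound is
an equality. -/
lemma sPlus_sub {x y : T.Interior} (h : x ≤ y) :
    T.sPlus y - T.sPlus x = (T.muPlus (Ico x y)).toReal := by
  have : ∀ z, T.sPlus z = T.intIoo T.muPlus (fun _ => 1) z := fun z => by
    simp [sPlus, intIoo, Measure.real]
  rw [this, this, T.intIoo_sub T.muPlus_zero (fun x y => ?_) h]
  · simp [Measure.real]
  · exact integrableOn_const (T.muPlus_Ico_ne_top x y)

lemma sMinus_sub {x y : T.Interior} (h : x ≤ y) :
    T.sMinus y - T.sMinus x = (T.muMinus (Ioc x y)).toReal := by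
  have : ∀ z, T.sMinus z = T.intIoc T.muMinus (fun _ => 1) z := fun z => by
    simp [sMinus, intIoc, Measure.real]
  rw [this, this, T.intIoc_sub T.muMinus_zero (fun x y => ?_) h]
  · simp [Measure.real]
  · exact integrableOn_const (T.muMinus_Ioc_ne_top x y)

/-- Only the right jump at `x` is subtracted from `s(y) - s(x)`. The bound tends to `0` as `y ↓ x`,
which is the right continuity of `s_c`. -/
lemma sCont_sub_le_right {x y : T.Interior} (h : x < y) :
    T.sCont y - T.sCont x ≤ T.s y - Function.rightLim T.s x := by
  have h1 := T.sPlus_sub h.le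
  have h2 := T.sMinus_sub h.le
  have h3 : Function.rightLim T.s x - T.s x ≤ (T.muPlus (Ico x y)).toReal := by
    rw [← ENNReal.ofReal_le_iff_le_toReal (T.muPlus_Ico_ne_top x y), ← muPlus_singleton]
    exact measure_mono (by simpa using h)
  have h4 : (0 : ℝ) ≤ (T.muMinus (Ioc x y)).toReal := ENNReal.toReal_nonneg
  unfold sCont
  linarith

lemma sCont_sub_le_left {x y : T.Interior} (h : x < y) :
    T.sCont y - T.sCont x ≤ Function.leftLim T.s y - T.s x := by
  have h1 := T.sPlus_sub h.le
  have h2 := T.sMinus_sub h.le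
  have h3 : T.s y - Function.leftLim T.s y ≤ (T.muMinus (Ioc x y)).toReal := by
    rw [← ENNReal.ofReal_le_iff_le_toReal (T.muMinus_Ioc_ne_top x y), ← muMinus_singleton]
    exact measure_mono (by simpa using h)
  have h4 : (0 : ℝ) ≤ (T.muPlus (Ico x y)).toReal := ENNReal.toReal_nonneg
  unfold sCont
  linarith

lemma sCont_continuous : Continuous T.sCont := by
  rw [continuous_iff_continuousAt]
  intro x
  rw [continuousAt_iff_continuous_left'_right']
  constructor
  · have h1 := T.mono.tendsto_leftLim x
    refine tendsto_of_tendsto_of_tendsto_of_le_of_le'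
      (g := fun y => T.sCont x - (Function.leftLim T.s x - T.s y)) (h := fun _ => T.sCont x)
      ?_ tendsto_const_nhds ?_ ?_
    · have := (tendsto_const_nhds (x := T.sCont x)).sub
        ((tendsto_const_nhds (x := Function.leftLim T.s x)).sub h1)
      simpa using this
    · filter_upwards [self_mem_nhdsWithin] with y hy
      have := T.sCont_sub_le_left hy
      linarith
    · filter_upwards [self_mem_nhdsWithin] with y hy
      exact T.sCont_mono (le_of_lt hy)
  · have h1 := T.mono.tendsto_rightLim x
    refine tendsto_of_tendsto_of_tendsto_of_le_of_le' (g := fun _ => T.sCont x)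
      (h := fun y => T.sCont x + (T.s y - Function.rightLim T.s x))
      tendsto_const_nhds ?_ ?_ ?_
    · have := (tendsto_const_nhds (x := T.sCont x)).add
        (h1.sub (tendsto_const_nhds (x := Function.rightLim T.s x)))
      simpa using this
    · filter_upwards [self_mem_nhdsWithin] with y hy
      exact T.sCont_mono (le_of_lt hy)
    · filter_upwards [self_mem_nhdsWithin] with y hy
      have := T.sCont_sub_le_right hy
      linarith

lemma stieltjes_sCont (x : T.Interior) : T.sCont_mono.stieltjesFunction x = T.sCont x := by
  rw [Monotone.stieltjesFunction_eq]
  exact T.sCont_continuous.continuousWithinAt.rightLim_eq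

lemma leftLim_stieltjes_sCont (x : T.Interior) :
    Function.leftLim T.sCont_mono.stieltjesFunction x = T.sCont x := by
  have : (T.sCont_mono.stieltjesFunction : T.Interior → ℝ) = T.sCont :=
    funext T.stieltjes_sCont
  rw [this]
  exact T.sCont_continuous.continuousWithinAt.leftLim_eq

lemma muCont_Ico (x y : T.Interior) :
    T.muCont (Ico x y) = ENNReal.ofReal (T.sCont y - T.sCont x) := by
  rw [muCont, StieltjesFunction.measure_Ico, leftLim_stieltjes_sCont, leftLim_stieltjes_sCont]

lemma muCont_singleton (x : T.Interior) : T.muCont {x} = 0 := by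
  rw [muCont, StieltjesFunction.measure_singleton, leftLim_stieltjes_sCont, stieltjes_sCont]
  simp

/-! ### The scale measure -/

/-- The disjoint union of three copies of `(l, r)`, carrying the continuous part, the right jumps
and the left jumps of the scale. -/
abbrev ScaleSpace : Type := T.Interior ⊕ T.Interior ⊕ T.Interior

/-- The disjoint union of `μ_c`, `μ_d⁺` and `μ_d⁻`. -/
def scaleMeasure : Measure T.ScaleSpace := sumMeasure T.muCont (sumMeasure T.muPlus T.muMinus)

/-- The part of the scale space that lies below the point `x`. -/
def below (x : EReal) : Set T.ScaleSpace :=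
  {y | Sum.elim (fun z : T.Interior => (z : EReal) < x)
    (Sum.elim (fun z : T.Interior => (z : EReal) < x) (fun z : T.Interior => (z : EReal) ≤ x)) y}

/-- The part of the scale space that lies between `x` and `y`. -/
def gap (x y : EReal) : Set T.ScaleSpace := T.below y \ T.below x

lemma below_mono {x y : EReal} (h : x ≤ y) : T.below x ⊆ T.below y := by
  rintro (z | z | z) hz
  · exact lt_of_lt_of_le (a := (z : EReal)) hz h
  · exact lt_of_lt_of_le (a := (z : EReal)) hz h
  · exact le_trans (a := (z : EReal)) hz h

lemma measurableSet_below (x : EReal) : MeasurableSet (T.below x) := by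
  refine measurableSet_sum_iff.2 ⟨?_, measurableSet_sum_iff.2 ⟨?_, ?_⟩⟩
  · exact measurable_subtype_coe measurableSet_Iio
  · exact measurable_subtype_coe measurableSet_Iio
  · exact measurable_subtype_coe measurableSet_Iic

lemma measurableSet_gap (x y : EReal) : MeasurableSet (T.gap x y) :=
  (T.measurableSet_below y).diff (T.measurableSet_below x)

lemma inl_preimage_gap (x y : T.Interior) : Sum.inl ⁻¹' T.gap x y = Ico x y := by
  ext z
  simp only [gap, below, mem_preimage, Set.mem_sdiff, mem_ofPred_eq, Sum.elim_inl, Subtype.coe_lt_coe,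
    not_lt, mem_Ico]
  exact and_comm

lemma inr_inl_preimage_gap (x y : T.Interior) :
    Sum.inl ⁻¹' (Sum.inr ⁻¹' T.gap x y) = Ico x y := by
  ext z
  simp only [gap, below, mem_preimage, Set.mem_sdiff, mem_ofPred_eq, Sum.elim_inl, Sum.elim_inr,
    Subtype.coe_lt_coe, not_lt, mem_Ico]
  exact and_comm

lemma inr_inr_preimage_gap (x y : T.Interior) :
    Sum.inr ⁻¹' (Sum.inr ⁻¹' T.gap x y) = Ioc x y := by
  ext z
  simp only [gap, below, mem_preimage, Set.mem_sdiff, mem_ofPred_eq, Sum.elim_inr,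
    Subtype.coe_le_coe, not_le, mem_Ioc]
  exact and_comm

/-- The increments of `s_c`, `s_d⁺` and `s_d⁻` over the three pieces of the gap add up to that of
`s`. This makes a single measure out of the discontinuous scale. -/
lemma scaleMeasure_gap {x y : T.Interior} (h : x ≤ y) :
    T.scaleMeasure (T.gap x y) = ENNReal.ofReal (T.s y - T.s x) := by
  rw [scaleMeasure, sumMeasure_apply, sumMeasure_apply, inl_preimage_gap, inr_inl_preimage_gap,
    inr_inr_preimage_gap, muCont_Ico, ← ENNReal.ofReal_toReal (T.muPlus_Ico_ne_top x y),
    ← ENNReal.ofReal_toReal (T.muMinus_Ioc_ne_top x y), ← T.sPlus_sub h, ← T.sMinus_sub h,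
    ← ENNReal.ofReal_add, ← ENNReal.ofReal_add]
  · congr 1; unfold sCont; ring
  · exact sub_nonneg.2 (T.sCont_mono h)
  · rw [T.sPlus_sub h, T.sMinus_sub h]; positivity
  · rw [T.sPlus_sub h]; positivity
  · rw [T.sMinus_sub h]; positivity

lemma gap_union {x y z : EReal} (hxy : x ≤ y) (hyz : y ≤ z) :
    T.gap x y ∪ T.gap y z = T.gap x z := by
  ext w
  have h1 : w ∈ T.below x → w ∈ T.below y := fun h => T.below_mono hxy h
  have h2 : w ∈ T.below y → w ∈ T.below z := fun h => T.below_mono hyz h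
  simp only [gap, mem_union, Set.mem_sdiff]
  tauto

lemma disjoint_gap {x y z : EReal} : Disjoint (T.gap x y) (T.gap y z) := by
  rw [Set.disjoint_left]
  rintro w h1 h2
  exact h2.2 h1.1

end ScaleTriple

/-! ### The state space and the extension of the scale to it -/

namespace ScaleTriple
variable (T : ScaleTriple)

lemma gap_eq_empty {x y : EReal} (h : y ≤ x) : T.gap x y = ∅ :=
  sdiff_eq_empty.2 (T.below_mono h)

lemma gap_subset_gap {x y x' y' : EReal} (h : x' ≤ x) (h' : y ≤ y') : T.gap x y ⊆ T.gap x' y' :=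
  sdiff_subset_sdiff (T.below_mono h') (T.below_mono h)

lemma space_subset_Icc : T.space ⊆ Icc T.l T.r := by
  rintro x (h | ⟨h, -⟩ | ⟨h, -⟩)
  · exact ⟨h.1.le, h.2.le⟩
  · rw [h]; exact ⟨le_rfl, (T.l_neg.trans T.r_pos).le⟩
  · rw [h]; exact ⟨(T.l_neg.trans T.r_pos).le, le_rfl⟩

lemma Ioo_subset_space : Ioo T.l T.r ⊆ T.space := fun _ h => Or.inl h

lemma mem_space_of_left {x : EReal} (h : x ∈ T.space) (hx : x ≠ T.l) (hx' : x ≠ T.r) :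
    x ∈ Ioo T.l T.r :=
  ⟨lt_of_le_of_ne (T.space_subset_Icc h).1 (Ne.symm hx), lt_of_le_of_ne (T.space_subset_Icc h).2 hx'⟩

instance ordConnected_space : OrdConnected T.space := by
  refine ⟨fun x hx y hy z hz => ?_⟩
  by_cases h1 : z = T.l
  · have : x = z := le_antisymm hz.1 (h1 ▸ (T.space_subset_Icc hx).1)
    exact this ▸ hx
  by_cases h2 : z = T.r
  · have : y = z := le_antisymm (h2 ▸ (T.space_subset_Icc hy).2) hz.2
    exact this ▸ hy
  exact T.Ioo_subset_space ⟨lt_of_le_of_ne ((T.space_subset_Icc hx).1.trans hz.1) (Ne.symm h1),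
    lt_of_le_of_ne (hz.2.trans (T.space_subset_Icc hy).2) h2⟩

lemma measurableSet_space : MeasurableSet T.space := T.ordConnected_space.measurableSet

instance : CompactIccSpace T.space where
  isCompact_Icc {a b} := by
    rw [Subtype.isCompact_iff]
    have h : (Subtype.val '' Icc a b : Set EReal) = Icc (a : EReal) b := by
      ext x
      constructor
      · rintro ⟨y, hy, rfl⟩
        exact hy
      · intro hx
        exact ⟨⟨x, T.ordConnected_space.out a.2 b.2 hx⟩, hx, rfl⟩
    rw [h]
    exact isCompact_Icc

/-- The inclusion of the open interval in the state space. -/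
def incl (x : T.Interior) : T.space := ⟨x, Or.inl x.2⟩

@[simp] lemma coe_incl (x : T.Interior) : (T.incl x : EReal) = x := rfl

instance : Nonempty T.space := ⟨T.incl T.zero⟩

lemma exists_interior_between {x y : T.space} (h : x < y) :
    ∃ u : T.Interior, x < T.incl u ∧ T.incl u < y := by
  obtain ⟨z, h1, h2⟩ := exists_between (α := EReal) h
  exact ⟨⟨z, (T.space_subset_Icc x.2).1.trans_lt h1, h2.trans_le (T.space_subset_Icc y.2).2⟩, h1, h2⟩

lemma tendsto_atBot_of_tendsto {u : ℕ → T.Interior}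
    (h : Tendsto (fun n => (u n : EReal)) atTop (𝓝 T.l)) : Tendsto u atTop atBot := by
  rw [tendsto_atBot]
  intro b
  filter_upwards [h.eventually (Iio_mem_nhds b.2.1)] with n hn
  exact le_of_lt (show (u n : EReal) < b from hn)

lemma tendsto_atTop_of_tendsto {u : ℕ → T.Interior}
    (h : Tendsto (fun n => (u n : EReal)) atTop (𝓝 T.r)) : Tendsto u atTop atTop := by
  rw [tendsto_atTop]
  intro b
  filter_upwards [h.eventually (Ioi_mem_nhds b.2.2)] with n hn
  exact le_of_lt (show (b : EReal) < u n from hn)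

/-- Gaps starting at points `v n ↓ l` exhaust the gap starting at `l`, and the measure is continuous
along increasing unions. -/
lemma scaleMeasure_gap_left {a : ℝ} (h : Tendsto T.s atBot (𝓝 a)) (y : T.Interior) :
    T.scaleMeasure (T.gap T.l y) = ENNReal.ofReal (T.s y - a) := by
  obtain ⟨u, hu, hu', hlim⟩ := exists_seq_strictAnti_tendsto' y.2.1
  let v : ℕ → T.Interior := fun n => ⟨u n, (hu' n).1, (hu' n).2.trans y.2.2⟩
  have hv : Tendsto v atTop atBot := T.tendsto_atBot_of_tendsto hlim
  have hmono : Monotone fun n => T.gap (v n) y := fun m n hmn =>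
    T.gap_subset_gap (hu.antitone hmn) le_rfl
  have hU : ⋃ n, T.gap (v n) y = T.gap T.l y := by
    refine subset_antisymm (iUnion_subset fun n => T.gap_subset_gap (hu' n).1.le le_rfl) ?_
    intro w hw
    refine mem_iUnion.2 ?_
    suffices h : ∃ n, w ∉ T.below (v n) from h.imp fun n hn => ⟨hw.1, hn⟩
    have key : ∀ z : T.Interior, ∃ n, (v n : EReal) < z := fun z =>
      (hlim.eventually (Iio_mem_nhds z.2.1)).exists
    rcases w with (z | z | z) <;> obtain ⟨n, hn⟩ := key z
    · exact ⟨n, not_lt.2 hn.le⟩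
    · exact ⟨n, not_lt.2 hn.le⟩
    · exact ⟨n, not_le.2 hn⟩
  have h1 := tendsto_measure_iUnion_atTop (μ := T.scaleMeasure) hmono
  rw [hU] at h1
  refine tendsto_nhds_unique h1 ?_
  have : ∀ n, (T.scaleMeasure ∘ fun n => T.gap (v n) y) n = ENNReal.ofReal (T.s y - T.s (v n)) :=
    fun n => T.scaleMeasure_gap (x := v n) (y := y) (hu' n).2.le
  rw [funext this]
  exact ENNReal.tendsto_ofReal (tendsto_const_nhds.sub (h.comp hv))

lemma scaleMeasure_gap_right {b : ℝ} (h : Tendsto T.s atTop (𝓝 b)) (y : T.Interior) :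
    T.scaleMeasure (T.gap y T.r) = ENNReal.ofReal (b - T.s y) := by
  obtain ⟨u, hu, hu', hlim⟩ := exists_seq_strictMono_tendsto' y.2.2
  let v : ℕ → T.Interior := fun n => ⟨u n, y.2.1.trans (hu' n).1, (hu' n).2⟩
  have hv : Tendsto v atTop atTop := T.tendsto_atTop_of_tendsto hlim
  have hmono : Monotone fun n => T.gap y (v n) := fun m n hmn =>
    T.gap_subset_gap le_rfl (hu.monotone hmn)
  have hU : ⋃ n, T.gap y (v n) = T.gap y T.r := by
    refine subset_antisymm (iUnion_subset fun n => T.gap_subset_gap le_rfl (hu' n).2.le) ?_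
    intro w hw
    refine mem_iUnion.2 ?_
    suffices h : ∃ n, w ∈ T.below (v n) from h.imp fun n hn => ⟨hn, hw.2⟩
    have key : ∀ z : T.Interior, ∃ n, (z : EReal) < v n := fun z =>
      (hlim.eventually (Ioi_mem_nhds z.2.2)).exists
    rcases w with (z | z | z) <;> obtain ⟨n, hn⟩ := key z
    · exact ⟨n, hn⟩
    · exact ⟨n, hn⟩
    · exact ⟨n, hn.le⟩
  have h1 := tendsto_measure_iUnion_atTop (μ := T.scaleMeasure) hmono
  rw [hU] at h1
  refine tendsto_nhds_unique h1 ?_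
  have : ∀ n, (T.scaleMeasure ∘ fun n => T.gap y (v n)) n = ENNReal.ofReal (T.s (v n) - T.s y) :=
    fun n => T.scaleMeasure_gap (x := y) (y := v n) (hu' n).1.le
  rw [funext this]
  exact ENNReal.tendsto_ofReal ((h.comp hv).sub tendsto_const_nhds)

/-- The points at a finite scale distance from `0`. -/
def scaleFinite : Set EReal :=
  {x | T.scaleMeasure (T.gap 0 x) ≠ ∞ ∧ T.scaleMeasure (T.gap x 0) ≠ ∞}

lemma interior_scaleFinite (x : T.Interior) : (x : EReal) ∈ T.scaleFinite := by
  constructor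
  · rcases le_total T.zero x with h | h
    · have := T.scaleMeasure_gap h
      rw [show ((T.zero : T.Interior) : EReal) = 0 from rfl] at this
      rw [this]; exact ENNReal.ofReal_ne_top
    · rw [T.gap_eq_empty (show (x : EReal) ≤ 0 from h)]; simp
  · rcases le_total x T.zero with h | h
    · have := T.scaleMeasure_gap h
      rw [show ((T.zero : T.Interior) : EReal) = 0 from rfl] at this
      rw [this]; exact ENNReal.ofReal_ne_top
    · rw [T.gap_eq_empty (show (0 : EReal) ≤ x from h)]; simp

lemma left_scaleFinite (h : T.ApproachableLeft) : T.l ∈ T.scaleFinite := by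
  obtain ⟨a, ha⟩ := h
  refine ⟨?_, ?_⟩
  · rw [T.gap_eq_empty T.l_neg.le]; simp
  · have := T.scaleMeasure_gap_left ha T.zero
    rw [show ((T.zero : T.Interior) : EReal) = 0 from rfl] at this
    rw [this]; exact ENNReal.ofReal_ne_top

lemma right_scaleFinite (h : T.ApproachableRight) : T.r ∈ T.scaleFinite := by
  obtain ⟨a, ha⟩ := h
  refine ⟨?_, ?_⟩
  · have := T.scaleMeasure_gap_right ha T.zero
    rw [show ((T.zero : T.Interior) : EReal) = 0 from rfl] at this
    rw [this]; exact ENNReal.ofReal_ne_top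
  · rw [T.gap_eq_empty T.r_pos.le]; simp

lemma space_scaleFinite (x : T.space) : (x : EReal) ∈ T.scaleFinite := by
  rcases x with ⟨x, h | ⟨rfl, h⟩ | ⟨rfl, h⟩⟩
  · exact T.interior_scaleFinite ⟨x, h⟩
  · exact T.left_scaleFinite h.1
  · exact T.right_scaleFinite h.1

lemma gap_ne_top {x y : EReal} (hx : x ∈ T.scaleFinite) (hy : y ∈ T.scaleFinite) :
    T.scaleMeasure (T.gap x y) ≠ ∞ := by
  refine ne_top_of_le_ne_top (ENNReal.add_ne_top.2 ⟨hx.2, hy.1⟩)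
    ((measure_mono ?_).trans (measure_union_le _ _))
  rintro w ⟨h1, h2⟩
  by_cases h : w ∈ T.below 0
  · exact Or.inl ⟨h, h2⟩
  · exact Or.inr ⟨h1, h⟩

/-- The scale function, extended to the points at a finite scale distance. -/
def scale (x : EReal) : ℝ :=
  (T.scaleMeasure (T.gap 0 x)).toReal - (T.scaleMeasure (T.gap x 0)).toReal

lemma toReal_gap_add {x y z : EReal} (hx : x ∈ T.scaleFinite) (hy : y ∈ T.scaleFinite)
    (hz : z ∈ T.scaleFinite) (hxy : x ≤ y) (hyz : y ≤ z) :
    (T.scaleMeasure (T.gap x y)).toReal + (T.scaleMeasure (T.gap y z)).toReal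
      = (T.scaleMeasure (T.gap x z)).toReal := by
  rw [← T.gap_union hxy hyz, measure_union T.disjoint_gap (T.measurableSet_gap _ _),
    ENNReal.toReal_add (T.gap_ne_top hx hy) (T.gap_ne_top hy hz)]

lemma scale_sub {x y : EReal} (hx : x ∈ T.scaleFinite) (hy : y ∈ T.scaleFinite) (h : x ≤ y) :
    T.scale y - T.scale x = (T.scaleMeasure (T.gap x y)).toReal := by
  have h0 : (0 : EReal) ∈ T.scaleFinite := T.interior_scaleFinite T.zero
  have e : ∀ {a b : EReal}, b ≤ a → (T.scaleMeasure (T.gap a b)).toReal = 0 := fun h => by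
    rw [T.gap_eq_empty h]; simp
  unfold scale
  rcases le_total 0 x with h1 | h1
  · rw [e h1, e (h1.trans h), ← T.toReal_gap_add h0 hx hy h1 h]; ring
  · rcases le_total 0 y with h2 | h2
    · rw [e h1, e h2, ← T.toReal_gap_add hx h0 hy h1 h2]; ring
    · rw [e h1, e h2, ← T.toReal_gap_add hx hy h0 h h2]; ring

lemma scale_interior (x : T.Interior) : T.scale x = T.s x := by
  have h0 : T.scale ((T.zero : T.Interior) : EReal) = T.s T.zero := by
    rw [show T.s T.zero = 0 from T.s_zero]
    unfold scale
    rw [show ((T.zero : T.Interior) : EReal) = 0 from rfl, T.gap_eq_empty le_rfl]; simp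
  rcases le_total T.zero x with h | h
  · have := T.scale_sub (T.interior_scaleFinite T.zero) (T.interior_scaleFinite x) h
    rw [T.scaleMeasure_gap h, ENNReal.toReal_ofReal (sub_nonneg.2 (T.mono h)), h0] at this
    linarith
  · have := T.scale_sub (T.interior_scaleFinite x) (T.interior_scaleFinite T.zero) h
    rw [T.scaleMeasure_gap h, ENNReal.toReal_ofReal (sub_nonneg.2 (T.mono h)), h0] at this
    linarith

lemma scale_mono {x y : EReal} (hx : x ∈ T.scaleFinite) (hy : y ∈ T.scaleFinite) (h : x ≤ y) :
    T.scale x ≤ T.scale y := by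
  have := T.scale_sub hx hy h
  have : 0 ≤ (T.scaleMeasure (T.gap x y)).toReal := ENNReal.toReal_nonneg
  linarith

lemma scale_monotone : Monotone fun x : T.space => T.scale x := fun x y h =>
  T.scale_mono (T.space_scaleFinite x) (T.space_scaleFinite y) h

lemma scale_strictMono (hs : StrictMono T.s) : StrictMono fun x : T.space => T.scale x := by
  intro x y h
  -- Since `x` and `y` may be endpoints, strict monotonicity of `s` is applied to two interior
  -- points inserted between them.
  obtain ⟨u, h1, h2⟩ := T.exists_interior_between h
  obtain ⟨v, h3, h4⟩ := T.exists_interior_between h1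
  have h5 : T.scale x ≤ T.scale v := T.scale_monotone (b := T.incl v) h3.le
  have h6 : T.scale u ≤ T.scale y := T.scale_monotone (a := T.incl u) h2.le
  have h7 : T.scale v < T.scale u := by
    rw [T.scale_interior, T.scale_interior]; exact hs h4
  exact h5.trans_lt (h7.trans_le h6)

lemma tendsto_scale_left (h : T.ApproachableLeft) : Tendsto T.s atBot (𝓝 (T.scale T.l)) := by
  obtain ⟨a, ha⟩ := h
  have hle : a ≤ T.s T.zero := T.mono.le_of_tendsto ha T.zero
  have := T.scale_sub (T.left_scaleFinite ⟨a, ha⟩) (T.interior_scaleFinite T.zero) T.l_neg.le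
  rw [T.scaleMeasure_gap_left ha, ENNReal.toReal_ofReal (by linarith), T.scale_interior] at this
  rwa [show T.scale T.l = a by linarith]

lemma tendsto_scale_right (h : T.ApproachableRight) : Tendsto T.s atTop (𝓝 (T.scale T.r)) := by
  obtain ⟨a, ha⟩ := h
  have hle : T.s T.zero ≤ a := T.mono.ge_of_tendsto ha T.zero
  have := T.scale_sub (T.interior_scaleFinite T.zero) (T.right_scaleFinite ⟨a, ha⟩) T.r_pos.le
  rw [T.scaleMeasure_gap_right ha, ENNReal.toReal_ofReal (by linarith), T.scale_interior] at this
  rwa [show T.scale T.r = a by linarith]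

lemma approachableLeft_of_mem (h : T.l ∈ T.space) : T.ApproachableLeft := by
  rcases h with h | ⟨-, h⟩ | ⟨h, -⟩
  · exact absurd h.1 (lt_irrefl _)
  · exact h.1
  · exact absurd h (T.l_neg.trans T.r_pos).ne

lemma approachableRight_of_mem (h : T.r ∈ T.space) : T.ApproachableRight := by
  rcases h with h | ⟨h, -⟩ | ⟨-, h⟩
  · exact absurd h.2 (lt_irrefl _)
  · exact absurd h (T.l_neg.trans T.r_pos).ne'
  · exact h.1

end ScaleTriple

/-! ### Primitives of square integrable densities and the class `ℱ` -/

namespace ScaleTriple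
variable (T : ScaleTriple)

/-- The primitive, vanishing at `0`, of a density on the scale space. -/
def prim (g : T.ScaleSpace → ℝ) (x : EReal) : ℝ :=
  (∫ w in T.gap 0 x, g w ∂T.scaleMeasure) - ∫ w in T.gap x 0, g w ∂T.scaleMeasure

/-- `g` is a square integrable density of `f` on the state space. -/
structure HasDens (f : T.space → ℝ) (g : T.ScaleSpace → ℝ) : Prop where
  memLp : MemLp g 2 T.scaleMeasure
  eq_prim : ∀ x : T.space, f x = f (T.incl T.zero) + T.prim g x

/-- `f` vanishes at the left endpoint if it is approachable but not in the state space. -/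
def VanishLeft (f : T.space → ℝ) : Prop :=
  T.l ∉ T.space → T.ApproachableLeft → Tendsto (T.restr f) atBot (𝓝 0)

/-- `f` vanishes at the right endpoint if it is approachable but not in the state space. -/
def VanishRight (f : T.space → ℝ) : Prop :=
  T.r ∉ T.space → T.ApproachableRight → Tendsto (T.restr f) atTop (𝓝 0)

variable {T}

lemma scaleFinite_zero : (0 : EReal) ∈ T.scaleFinite := T.interior_scaleFinite T.zero

lemma integrableOn_of_memLp {g : T.ScaleSpace → ℝ} (hg : MemLp g 2 T.scaleMeasure)
    {A : Set T.ScaleSpace} (hA : T.scaleMeasure A ≠ ∞) : IntegrableOn g A T.scaleMeasure :=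
  have : IsFiniteMeasure (T.scaleMeasure.restrict A) := ⟨by simpa using hA.lt_top⟩
  (hg.restrict A).integrable one_le_two

lemma integrableOn_gap {g : T.ScaleSpace → ℝ} (hg : MemLp g 2 T.scaleMeasure) {x y : EReal}
    (hx : x ∈ T.scaleFinite) (hy : y ∈ T.scaleFinite) :
    IntegrableOn g (T.gap x y) T.scaleMeasure :=
  integrableOn_of_memLp hg (T.gap_ne_top hx hy)

lemma integral_gap_add {g : T.ScaleSpace → ℝ} (hg : MemLp g 2 T.scaleMeasure) {x y z : EReal}
    (hx : x ∈ T.scaleFinite) (hy : y ∈ T.scaleFinite) (hz : z ∈ T.scaleFinite)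
    (hxy : x ≤ y) (hyz : y ≤ z) :
    (∫ w in T.gap x y, g w ∂T.scaleMeasure) + ∫ w in T.gap y z, g w ∂T.scaleMeasure
      = ∫ w in T.gap x z, g w ∂T.scaleMeasure := by
  rw [← T.gap_union hxy hyz, setIntegral_union T.disjoint_gap (T.measurableSet_gap _ _)
    (integrableOn_gap hg hx hy) (integrableOn_gap hg hy hz)]

lemma integral_gap_of_le (g : T.ScaleSpace → ℝ) {x y : EReal} (h : y ≤ x) :
    ∫ w in T.gap x y, g w ∂T.scaleMeasure = 0 := by
  rw [T.gap_eq_empty h]; simp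

lemma prim_sub {g : T.ScaleSpace → ℝ} (hg : MemLp g 2 T.scaleMeasure) {x y : EReal}
    (hx : x ∈ T.scaleFinite) (hy : y ∈ T.scaleFinite) (h : x ≤ y) :
    T.prim g y - T.prim g x = ∫ w in T.gap x y, g w ∂T.scaleMeasure := by
  have h0 := scaleFinite_zero (T := T)
  unfold prim
  rcases le_total 0 x with h1 | h1
  · rw [integral_gap_of_le g h1, integral_gap_of_le g (h1.trans h),
      ← integral_gap_add hg h0 hx hy h1 h]; ring
  · rcases le_total 0 y with h2 | h2
    · rw [integral_gap_of_le g h1, integral_gap_of_le g h2,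
        ← integral_gap_add hg hx h0 hy h1 h2]; ring
    · rw [integral_gap_of_le g h1, integral_gap_of_le g h2,
        ← integral_gap_add hg hx hy h0 h h2]; ring

/-- This is the basic estimate: functions of finite energy are Hölder continuous of order `1/2` in
the scale. Keeping the energy of the gap, and not the total energy, is what later feeds the Riesz
criterion. -/
lemma sq_integral_gap_le {g : T.ScaleSpace → ℝ} (hg : MemLp g 2 T.scaleMeasure) {x y : EReal}
    (hx : x ∈ T.scaleFinite) (hy : y ∈ T.scaleFinite) (h : x ≤ y) :
    (∫ w in T.gap x y, g w ∂T.scaleMeasure) ^ 2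
      ≤ (T.scale y - T.scale x) * ∫ w in T.gap x y, g w ^ 2 ∂T.scaleMeasure := by
  rw [T.scale_sub hx hy h]
  exact sq_setIntegral_le hg (T.gap_ne_top hx hy)

lemma sq_integral_gap_le' {g : T.ScaleSpace → ℝ} (hg : MemLp g 2 T.scaleMeasure) {x y : EReal}
    (hx : x ∈ T.scaleFinite) (hy : y ∈ T.scaleFinite) (h : x ≤ y) :
    (∫ w in T.gap x y, g w ∂T.scaleMeasure) ^ 2
      ≤ (T.scale y - T.scale x) * ∫ w, g w ^ 2 ∂T.scaleMeasure :=
  (sq_integral_gap_le hg hx hy h).trans (mul_le_mul_of_nonneg_left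
    (setIntegral_le_integral hg.integrable_sq (ae_of_all _ fun _ => sq_nonneg _))
    (sub_nonneg.2 (T.scale_mono hx hy h)))

/-- A family whose squares are dominated by a null family tends to zero. -/
lemma tendsto_zero_of_sq_le {ι : Type*} {F : Filter ι} {u v : ι → ℝ} (h : ∀ i, u i ^ 2 ≤ v i)
    (hv : Tendsto v F (𝓝 0)) : Tendsto u F (𝓝 0) := by
  have h1 : Tendsto (fun i => u i ^ 2) F (𝓝 0) :=
    squeeze_zero (fun i => sq_nonneg _) h hv
  have h2 := (Real.continuous_sqrt.tendsto 0).comp h1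
  rw [Real.sqrt_zero] at h2
  rw [tendsto_zero_iff_abs_tendsto_zero]
  refine h2.congr fun i => ?_
  simp [Real.sqrt_sq_eq_abs]

lemma tendsto_prim_left {g : T.ScaleSpace → ℝ} (hg : MemLp g 2 T.scaleMeasure)
    (h : T.ApproachableLeft) :
    Tendsto (fun x : T.Interior => T.prim g x) atBot (𝓝 (T.prim g T.l)) := by
  rw [← tendsto_sub_nhds_zero_iff]
  refine tendsto_zero_of_sq_le (v := fun x => (T.s x - T.scale T.l) *
    ∫ w, g w ^ 2 ∂T.scaleMeasure) (fun x => ?_) ?_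
  · rw [prim_sub hg (T.left_scaleFinite h) (T.interior_scaleFinite x) x.2.1.le,
      ← T.scale_interior]
    exact sq_integral_gap_le' hg (T.left_scaleFinite h) (T.interior_scaleFinite x) x.2.1.le
  · simpa using ((T.tendsto_scale_left h).sub_const (T.scale T.l)).mul_const
      (∫ w, g w ^ 2 ∂T.scaleMeasure)

lemma tendsto_prim_right {g : T.ScaleSpace → ℝ} (hg : MemLp g 2 T.scaleMeasure)
    (h : T.ApproachableRight) :
    Tendsto (fun x : T.Interior => T.prim g x) atTop (𝓝 (T.prim g T.r)) := by
  rw [← tendsto_sub_nhds_zero_iff]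
  refine tendsto_zero_of_sq_le (v := fun x => (T.scale T.r - T.s x) *
    ∫ w, g w ^ 2 ∂T.scaleMeasure) (fun x => ?_) ?_
  · rw [← neg_sub (T.prim g T.r), neg_sq,
      prim_sub hg (T.interior_scaleFinite x) (T.right_scaleFinite h) x.2.2.le,
      ← T.scale_interior]
    exact sq_integral_gap_le' hg (T.interior_scaleFinite x) (T.right_scaleFinite h) x.2.2.le
  · simpa using ((T.tendsto_scale_right h).const_sub (T.scale T.r)).mul_const
      (∫ w, g w ^ 2 ∂T.scaleMeasure)

namespace HasDens
variable {f f' : T.space → ℝ} {g g' : T.ScaleSpace → ℝ}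

lemma sub_eq (h : T.HasDens f g) {x y : T.space} (hxy : x ≤ y) :
    f y - f x = ∫ w in T.gap x y, g w ∂T.scaleMeasure := by
  rw [h.eq_prim x, h.eq_prim y, ← prim_sub h.memLp (T.space_scaleFinite x) (T.space_scaleFinite y)
    hxy]
  ring

/-- A form of the definition without base point, through which densities are produced: increments
pass to sums, multiples and weak limits. -/
lemma of_sub_eq (hg : MemLp g 2 T.scaleMeasure)
    (h : ∀ x y : T.space, x ≤ y → f y - f x = ∫ w in T.gap x y, g w ∂T.scaleMeasure) :
    T.HasDens f g := by
  refine ⟨hg, fun x => ?_⟩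
  rcases le_total (T.incl T.zero) x with h1 | h1
  · have := h _ _ h1
    rw [prim, integral_gap_of_le g (show (0 : EReal) ≤ x from h1)]
    change f x - f (T.incl T.zero) = ∫ w in T.gap 0 x, g w ∂T.scaleMeasure at this
    linarith
  · have := h _ _ h1
    rw [prim, integral_gap_of_le g (show (x : EReal) ≤ 0 from h1)]
    change f (T.incl T.zero) - f x = ∫ w in T.gap x 0, g w ∂T.scaleMeasure at this
    linarith

lemma sq_sub_le (h : T.HasDens f g) {x y : T.space} (hxy : x ≤ y) :
    (f y - f x) ^ 2 ≤ (T.scale y - T.scale x) * ∫ w in T.gap x y, g w ^ 2 ∂T.scaleMeasure := by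
  rw [h.sub_eq hxy]
  exact sq_integral_gap_le h.memLp (T.space_scaleFinite x) (T.space_scaleFinite y) hxy

lemma sq_sub_le' (h : T.HasDens f g) {x y : T.space} (hxy : x ≤ y) :
    (f y - f x) ^ 2 ≤ (T.scale y - T.scale x) * ∫ w, g w ^ 2 ∂T.scaleMeasure := by
  rw [h.sub_eq hxy]
  exact sq_integral_gap_le' h.memLp (T.space_scaleFinite x) (T.space_scaleFinite y) hxy

lemma add (h : T.HasDens f g) (h' : T.HasDens f' g') : T.HasDens (f + f') (g + g') := by
  refine of_sub_eq (h.memLp.add h'.memLp) fun x y hxy => ?_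
  have hx := T.space_scaleFinite x
  have hy := T.space_scaleFinite y
  simp only [Pi.add_apply]
  rw [integral_add (integrableOn_gap h.memLp hx hy) (integrableOn_gap h'.memLp hx hy),
    ← h.sub_eq hxy, ← h'.sub_eq hxy]
  ring

lemma const_smul (h : T.HasDens f g) (c : ℝ) : T.HasDens (c • f) (c • g) := by
  refine of_sub_eq (h.memLp.const_smul c) fun x y hxy => ?_
  simp only [Pi.smul_apply, smul_eq_mul]
  rw [integral_const_mul, ← h.sub_eq hxy]
  ring

lemma sub (h : T.HasDens f g) (h' : T.HasDens f' g') : T.HasDens (f - f') (g - g') := by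
  have := h.add (h'.const_smul (-1))
  convert this using 1 <;> (ext; simp [sub_eq_add_neg])

lemma congr (h : T.HasDens f g) (hg : g =ᵐ[T.scaleMeasure] g') : T.HasDens f g' :=
  of_sub_eq ((memLp_congr_ae hg).1 h.memLp) fun x y hxy => by
    rw [h.sub_eq hxy]; exact integral_congr_ae (ae_restrict_of_ae hg)

lemma tendsto_left (h : T.HasDens f g) (ha : T.ApproachableLeft) :
    Tendsto (T.restr f) atBot (𝓝 (f (T.incl T.zero) + T.prim g T.l)) := by
  have := (tendsto_prim_left h.memLp ha).const_add (f (T.incl T.zero))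
  refine this.congr fun x => ?_
  exact (h.eq_prim (T.incl x)).symm

lemma tendsto_right (h : T.HasDens f g) (ha : T.ApproachableRight) :
    Tendsto (T.restr f) atTop (𝓝 (f (T.incl T.zero) + T.prim g T.r)) := by
  have := (tendsto_prim_right h.memLp ha).const_add (f (T.incl T.zero))
  refine this.congr fun x => ?_
  exact (h.eq_prim (T.incl x)).symm

end HasDens

/-- The density on the scale space made of the three given densities. -/
def dens (gc gp gm : T.Interior → ℝ) : T.ScaleSpace → ℝ := Sum.elim gc (Sum.elim gp gm)

lemma memLp_scaleMeasure {g : T.ScaleSpace → ℝ} : MemLp g 2 T.scaleMeasure ↔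
    MemLp (fun x => g (.inl x)) 2 T.muCont ∧ MemLp (fun x => g (.inr (.inl x))) 2 T.muPlus ∧
      MemLp (fun x => g (.inr (.inr x))) 2 T.muMinus := by
  rw [scaleMeasure, memLp_sumMeasure, memLp_sumMeasure]; rfl

lemma integral_scaleMeasure {g : T.ScaleSpace → ℝ} (hg : Integrable g T.scaleMeasure) :
    ∫ w, g w ∂T.scaleMeasure = (∫ x, g (.inl x) ∂T.muCont) + (∫ x, g (.inr (.inl x)) ∂T.muPlus) +
      ∫ x, g (.inr (.inr x)) ∂T.muMinus := by
  rw [scaleMeasure, integral_sumMeasure hg, add_assoc]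
  congr 1
  exact integral_sumMeasure (integrable_sumMeasure.1 hg).2

lemma integral_gap_interior {g : T.ScaleSpace → ℝ} (hg : MemLp g 2 T.scaleMeasure)
    (x y : T.Interior) :
    ∫ w in T.gap x y, g w ∂T.scaleMeasure = (∫ z in Ico x y, g (.inl z) ∂T.muCont) +
      (∫ z in Ico x y, g (.inr (.inl z)) ∂T.muPlus) +
      ∫ z in Ioc x y, g (.inr (.inr z)) ∂T.muMinus := by
  have h := integrableOn_gap hg (T.interior_scaleFinite x) (T.interior_scaleFinite y)
  rw [IntegrableOn, scaleMeasure, restrict_sumMeasure] at h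
  rw [scaleMeasure, restrict_sumMeasure, integral_sumMeasure h, T.inl_preimage_gap, add_assoc]
  congr 1
  have h2 := (integrable_sumMeasure.1 h).2
  rw [restrict_sumMeasure] at h2 ⊢
  refine (integral_sumMeasure h2).trans ?_
  rw [T.inr_inl_preimage_gap, T.inr_inr_preimage_gap]
  rfl

lemma integrableOn_of_memLp_of_ne_top {μ : Measure T.Interior} {g : T.Interior → ℝ}
    (hg : MemLp g 2 μ) {A : Set T.Interior} (hA : μ A ≠ ∞) : IntegrableOn g A μ :=
  have : IsFiniteMeasure (μ.restrict A) := ⟨by simpa using hA.lt_top⟩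
  (hg.restrict A).integrable one_le_two

/-- The bridge between the single primitive and the three integrals, with their different
conventions at the endpoints, in the definition of `𝒮`. -/
lemma prim_interior {g : T.ScaleSpace → ℝ} (hg : MemLp g 2 T.scaleMeasure) (x : T.Interior) :
    T.prim g x = T.intIoo T.muCont (fun z => g (.inl z)) x +
      T.intIoo T.muPlus (fun z => g (.inr (.inl z))) x +
      T.intIoc T.muMinus (fun z => g (.inr (.inr z))) x := by
  obtain ⟨h1, h2, h3⟩ := memLp_scaleMeasure.1 hg
  have i1 : ∀ a b, IntegrableOn (fun z => g (.inl z)) (Ico a b) T.muCont := fun a b =>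
    integrableOn_of_memLp_of_ne_top h1 (by rw [muCont_Ico]; exact ENNReal.ofReal_ne_top)
  have i2 : ∀ a b, IntegrableOn (fun z => g (.inr (.inl z))) (Ico a b) T.muPlus := fun a b =>
    integrableOn_of_memLp_of_ne_top h2 (T.muPlus_Ico_ne_top a b)
  have i3 : ∀ a b, IntegrableOn (fun z => g (.inr (.inr z))) (Ioc a b) T.muMinus := fun a b =>
    integrableOn_of_memLp_of_ne_top h3 (T.muMinus_Ioc_ne_top a b)
  have z1 : ∀ (μ : Measure T.Interior) (u : T.Interior → ℝ), T.intIoo μ u T.zero = 0 := by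
    intro μ u; simp [intIoo]
  have z2 : ∀ (μ : Measure T.Interior) (u : T.Interior → ℝ), T.intIoc μ u T.zero = 0 := by
    intro μ u; simp [intIoc]
  have key : ∀ a b : T.Interior, a ≤ b → ∫ w in T.gap a b, g w ∂T.scaleMeasure =
      (T.intIoo T.muCont (fun z => g (.inl z)) b - T.intIoo T.muCont (fun z => g (.inl z)) a) +
      (T.intIoo T.muPlus (fun z => g (.inr (.inl z))) b -
        T.intIoo T.muPlus (fun z => g (.inr (.inl z))) a) +
      (T.intIoc T.muMinus (fun z => g (.inr (.inr z))) b -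
        T.intIoc T.muMinus (fun z => g (.inr (.inr z))) a) := fun a b hab => by
    rw [integral_gap_interior hg, T.intIoo_sub (T.muCont_singleton _) i1 hab,
      T.intIoo_sub T.muPlus_zero i2 hab, T.intIoc_sub T.muMinus_zero i3 hab]
  rcases le_total T.zero x with h | h
  · have := key _ _ h
    rw [z1, z1, z2] at this
    rw [prim, integral_gap_of_le g (show (0 : EReal) ≤ x from h)]
    change ∫ w in T.gap 0 x, g w ∂T.scaleMeasure = _ at this
    rw [this]; ring
  · have := key _ _ h
    rw [z1, z1, z2] at this
    rw [prim, integral_gap_of_le g (show (x : EReal) ≤ 0 from h)]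
    change ∫ w in T.gap x 0, g w ∂T.scaleMeasure = _ at this
    rw [this]; ring

lemma prim_zero (g : T.ScaleSpace → ℝ) : T.prim g 0 = 0 := by
  rw [prim, sub_self]

lemma HasDens.hasScaleDeriv {f : T.space → ℝ} {g : T.ScaleSpace → ℝ} (h : T.HasDens f g) :
    T.HasScaleDeriv (T.restr f) (fun z => g (.inl z)) (fun z => g (.inr (.inl z)))
      (fun z => g (.inr (.inr z))) := by
  obtain ⟨h1, h2, h3⟩ := memLp_scaleMeasure.1 h.memLp
  refine ⟨h1, h2, h3, f (T.incl T.zero), fun x => ?_⟩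
  have := h.eq_prim (T.incl x)
  rw [coe_incl, prim_interior h.memLp] at this
  rw [show T.restr f x = f (T.incl x) from rfl, this]
  ring

/-- At a reflecting endpoint the value of `f` is its limit, and the primitive has there the limit
given by the same formula, so the identity extends from `(l, r)` to the state space. -/
lemma hasDens_of_hasScaleDeriv {f : T.space → ℝ} {gc gp gm : T.Interior → ℝ}
    (h : T.HasScaleDeriv (T.restr f) gc gp gm)
    (hl : ∀ h : T.l ∈ T.space, Tendsto (T.restr f) atBot (𝓝 (f ⟨T.l, h⟩)))
    (hr : ∀ h : T.r ∈ T.space, Tendsto (T.restr f) atTop (𝓝 (f ⟨T.r, h⟩))) :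
    T.HasDens f (dens gc gp gm) := by
  have hm : MemLp (dens gc gp gm) 2 T.scaleMeasure :=
    memLp_scaleMeasure.2 ⟨h.memLp_cont, h.memLp_plus, h.memLp_minus⟩
  obtain ⟨c, hc⟩ := h.eq_integral
  have e : ∀ x : T.Interior, T.restr f x = c + T.prim (dens gc gp gm) x := fun x => by
    rw [hc x, prim_interior hm]
    simp only [dens, Sum.elim_inl, Sum.elim_inr]
    ring
  have hc0 : c = f (T.incl T.zero) := by
    have := e T.zero
    rw [show ((T.zero : T.Interior) : EReal) = 0 from rfl, prim_zero, add_zero] at this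
    exact this.symm
  refine ⟨hm, fun x => ?_⟩
  rw [← hc0]
  rcases x with ⟨x, hx⟩
  by_cases h1 : x = T.l
  · subst h1
    have ha := T.approachableLeft_of_mem hx
    have := ((tendsto_prim_left hm ha).const_add c).congr fun y => (e y).symm
    exact tendsto_nhds_unique (hl hx) this
  by_cases h2 : x = T.r
  · subst h2
    have ha := T.approachableRight_of_mem hx
    have := ((tendsto_prim_right hm ha).const_add c).congr fun y => (e y).symm
    exact tendsto_nhds_unique (hr hx) this
  exact e ⟨x, T.mem_space_of_left hx h1 h2⟩

/-- The condition at reflecting endpoints is absorbed by `HasDens`, whose primitive is also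
evaluated at those points. -/
lemma memF_iff {f : T.space → ℝ} : T.MemF f ↔
    (∃ g, T.HasDens f g) ∧ MemLp f 2 T.speed ∧ T.VanishLeft f ∧ T.VanishRight f := by
  constructor
  · intro h
    obtain ⟨gc, gp, gm, hg⟩ := h.scale
    exact ⟨⟨_, hasDens_of_hasScaleDeriv hg h.left_mem h.right_mem⟩, h.memLp, h.left_notMem,
      h.right_notMem⟩
  · rintro ⟨⟨g, hg⟩, h2, h3, h4⟩
    refine ⟨⟨_, _, _, hg.hasScaleDeriv⟩, h2, fun h => ?_, fun h => ?_, h3, h4⟩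
    · rw [hg.eq_prim]; exact hg.tendsto_left (T.approachableLeft_of_mem h)
    · rw [hg.eq_prim]; exact hg.tendsto_right (T.approachableRight_of_mem h)

end ScaleTriple

namespace ScaleTriple
variable {T : ScaleTriple}

/-! ### Uniqueness of the densities -/

lemma scaleMeasure_inl_singleton (x : T.Interior) :
    T.scaleMeasure {Sum.inl x} = 0 := by
  have e1 : (Sum.inl ⁻¹' {(Sum.inl x : T.ScaleSpace)} : Set T.Interior) = {x} := by ext; simp
  have e2 : (Sum.inl ⁻¹' (Sum.inr ⁻¹' {(Sum.inl x : T.ScaleSpace)}) : Set T.Interior) = ∅ := by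
    ext; simp
  have e3 : (Sum.inr ⁻¹' (Sum.inr ⁻¹' {(Sum.inl x : T.ScaleSpace)}) : Set T.Interior) = ∅ := by
    ext; simp
  rw [scaleMeasure, sumMeasure_apply, sumMeasure_apply, e1, e2, e3]
  simp [muCont_singleton]

lemma scaleMeasure_inr_inl_singleton (x : T.Interior) :
    T.scaleMeasure {Sum.inr (Sum.inl x)} = T.muPlus {x} := by
  have e1 : (Sum.inl ⁻¹' {(Sum.inr (Sum.inl x) : T.ScaleSpace)} : Set T.Interior) = ∅ := by ext; simp
  have e2 : (Sum.inl ⁻¹' (Sum.inr ⁻¹' {(Sum.inr (Sum.inl x) : T.ScaleSpace)}) : Set T.Interior) = {x} := by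
    ext; simp
  have e3 : (Sum.inr ⁻¹' (Sum.inr ⁻¹' {(Sum.inr (Sum.inl x) : T.ScaleSpace)}) : Set T.Interior) = ∅ := by
    ext; simp
  rw [scaleMeasure, sumMeasure_apply, sumMeasure_apply, e1, e2, e3]
  simp

lemma scaleMeasure_inr_inr_singleton (x : T.Interior) :
    T.scaleMeasure {Sum.inr (Sum.inr x)} = T.muMinus {x} := by
  have e1 : (Sum.inl ⁻¹' {(Sum.inr (Sum.inr x) : T.ScaleSpace)} : Set T.Interior) = ∅ := by ext; simp
  have e2 : (Sum.inl ⁻¹' (Sum.inr ⁻¹' {(Sum.inr (Sum.inr x) : T.ScaleSpace)}) : Set T.Interior) = ∅ := by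
    ext; simp
  have e3 : (Sum.inr ⁻¹' (Sum.inr ⁻¹' {(Sum.inr (Sum.inr x) : T.ScaleSpace)}) : Set T.Interior) = {x} := by
    ext; simp
  rw [scaleMeasure, sumMeasure_apply, sumMeasure_apply, e1, e2, e3]
  simp

variable {g : T.ScaleSpace → ℝ}

/-- As `u n ↓ x`, the gaps from `x` to `u n` shrink to the points over `x` in the first two copies.
The continuous copy has no atoms, so what remains of the integral is the right jump at `x` times the
density there. -/
lemma muPlus_mul_eq_zero (hg : MemLp g 2 T.scaleMeasure)
    (h : ∀ x y : T.Interior, x ≤ y → ∫ w in T.gap x y, g w ∂T.scaleMeasure = 0) (x : T.Interior) :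
    T.muPlus {x} = 0 ∨ g (.inr (.inl x)) = 0 := by
  obtain ⟨u, hu, hu', hlim⟩ := exists_seq_strictAnti_tendsto' (T.exists_gt_interior x).choose_spec
  have hanti : Antitone fun n => T.gap x (u n) := fun m n hmn =>
    T.gap_subset_gap le_rfl (hu.antitone hmn)
  have hI : ⋂ n, T.gap x (u n) = {Sum.inl x} ∪ {Sum.inr (Sum.inl x)} := by
    have key : ∀ z : T.Interior, x < z → ∃ n, u n < z := fun z hz =>
      (hlim.eventually (Iio_mem_nhds hz)).exists
    ext w
    simp only [mem_iInter, mem_union, mem_singleton_iff]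
    constructor
    · intro hw
      rcases w with (z | z | z)
      · left
        have h1 : x ≤ z := not_lt.1 (hw 0).2
        rcases h1.eq_or_lt with h1 | h1
        · rw [h1]
        · obtain ⟨n, hn⟩ := key z h1
          exact absurd (show z < u n from (hw n).1) (not_lt.2 hn.le)
      · right
        have h1 : x ≤ z := not_lt.1 (hw 0).2
        rcases h1.eq_or_lt with h1 | h1
        · rw [h1]
        · obtain ⟨n, hn⟩ := key z h1
          exact absurd (show z < u n from (hw n).1) (not_lt.2 hn.le)
      · have h1 : x < z := not_le.1 (hw 0).2
        obtain ⟨n, hn⟩ := key z h1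
        exact absurd (show z ≤ u n from (hw n).1) (not_le.2 hn)
    · rintro (rfl | rfl) n
      · exact ⟨(hu' n).1, lt_irrefl (x : EReal)⟩
      · exact ⟨(hu' n).1, lt_irrefl (x : EReal)⟩
  have hint : ∀ n, IntegrableOn g (T.gap x (u n)) T.scaleMeasure := fun n =>
    integrableOn_gap hg (T.interior_scaleFinite x) (T.interior_scaleFinite (u n))
  have h1 := tendsto_setIntegral_of_antitone (fun n => T.measurableSet_gap x (u n)) hanti
    ⟨0, hint 0⟩
  have h2 : ∫ w in ⋂ n, T.gap x (u n), g w ∂T.scaleMeasure = 0 :=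
    tendsto_nhds_unique h1 (tendsto_const_nhds.congr fun n => (h x (u n) (hu' n).1.le).symm)
  have hint' : IntegrableOn g (⋂ n, T.gap x (u n)) T.scaleMeasure :=
    (hint 0).mono_set (iInter_subset _ 0)
  rw [hI] at h2 hint'
  rw [setIntegral_union (by simp) (measurableSet_singleton _) (hint'.mono_set subset_union_left)
    (hint'.mono_set subset_union_right), integral_singleton, integral_singleton, Measure.real,
    Measure.real, scaleMeasure_inl_singleton, scaleMeasure_inr_inl_singleton] at h2
  rw [ENNReal.toReal_zero, zero_smul, zero_add, smul_eq_mul, mul_eq_zero] at h2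
  refine h2.imp_left fun h3 => ?_
  rw [ENNReal.toReal_eq_zero_iff] at h3
  refine h3.resolve_right ?_
  rw [muPlus_singleton]; exact ENNReal.ofReal_ne_top

/-- Gaps are closed above only in the third copy. As `u n ↑ x`, the gaps from `u n` to `x` therefore
shrink to the left jump at `x` alone. -/
lemma muMinus_mul_eq_zero (hg : MemLp g 2 T.scaleMeasure)
    (h : ∀ x y : T.Interior, x ≤ y → ∫ w in T.gap x y, g w ∂T.scaleMeasure = 0) (x : T.Interior) :
    T.muMinus {x} = 0 ∨ g (.inr (.inr x)) = 0 := by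
  obtain ⟨u, hu, hu', hlim⟩ := exists_seq_strictMono_tendsto' (T.exists_lt_interior x).choose_spec
  have hanti : Antitone fun n => T.gap (u n) x := fun m n hmn =>
    T.gap_subset_gap (hu.monotone hmn) le_rfl
  have hI : ⋂ n, T.gap (u n) x = {Sum.inr (Sum.inr x)} := by
    have key : ∀ z : T.Interior, z < x → ∃ n, z < u n := fun z hz =>
      (hlim.eventually (Ioi_mem_nhds hz)).exists
    ext w
    simp only [mem_iInter, mem_singleton_iff]
    constructor
    · intro hw
      rcases w with (z | z | z)
      · obtain ⟨n, hn⟩ := key z (hw 0).1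
        exact absurd (show z < u n from hn) (hw n).2
      · obtain ⟨n, hn⟩ := key z (hw 0).1
        exact absurd (show z < u n from hn) (hw n).2
      · have h1 : z ≤ x := (hw 0).1
        rcases h1.eq_or_lt with h1 | h1
        · rw [h1]
        · obtain ⟨n, hn⟩ := key z h1
          exact absurd (show z ≤ u n from hn.le) (hw n).2
    · rintro rfl n
      exact ⟨le_refl (x : EReal), not_le.2 (show (u n : EReal) < x from (hu' n).2)⟩
  have hint : ∀ n, IntegrableOn g (T.gap (u n) x) T.scaleMeasure := fun n =>
    integrableOn_gap hg (T.interior_scaleFinite (u n)) (T.interior_scaleFinite x)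
  have h1 := tendsto_setIntegral_of_antitone (fun n => T.measurableSet_gap (u n) x) hanti
    ⟨0, hint 0⟩
  have h2 : ∫ w in ⋂ n, T.gap (u n) x, g w ∂T.scaleMeasure = 0 :=
    tendsto_nhds_unique h1 (tendsto_const_nhds.congr fun n => (h (u n) x (hu' n).2.le).symm)
  rw [hI, integral_singleton, Measure.real, scaleMeasure_inr_inr_singleton] at h2
  simp only [smul_eq_mul, mul_eq_zero] at h2
  refine h2.imp_left fun h3 => ?_
  rw [ENNReal.toReal_eq_zero_iff] at h3
  refine h3.resolve_right ?_
  rw [muMinus_singleton]; exact ENNReal.ofReal_ne_top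

lemma exists_exhaustion (T : ScaleTriple) : ∃ a b : ℕ → T.Interior, ∀ x, ∃ n, x ∈ Ico (a n) (b n) := by
  obtain ⟨u, hu, hu', hulim⟩ := exists_seq_strictAnti_tendsto' T.l_neg
  obtain ⟨v, hv, hv', hvlim⟩ := exists_seq_strictMono_tendsto' T.r_pos
  refine ⟨fun n => ⟨u n, (hu' n).1, (hu' n).2.trans T.r_pos⟩,
    fun n => ⟨v n, T.l_neg.trans (hv' n).1, (hv' n).2⟩, fun x => ?_⟩
  obtain ⟨n, h1, h2⟩ := ((hulim.eventually (Iio_mem_nhds x.2.1)).and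
    (hvlim.eventually (Ioi_mem_nhds x.2.2))).exists
  exact ⟨n, le_of_lt h1, h2⟩

/-- `μ_c` may be infinite, so the argument runs on each interval of an exhaustion, where a square
integrable function is integrable. The absence of atoms turns `[a, c]` into `[a, c)`. -/
lemma ae_muCont_eq_zero {u : T.Interior → ℝ} (hu : MemLp u 2 T.muCont)
    (h : ∀ x y : T.Interior, x ≤ y → ∫ z in Ico x y, u z ∂T.muCont = 0) : u =ᵐ[T.muCont] 0 := by
  obtain ⟨a, b, hab⟩ := T.exists_exhaustion
  have hU : (⋃ n, Ico (a n) (b n)) = univ := eq_univ_of_forall fun x => mem_iUnion.2 (hab x)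
  suffices hn : ∀ n, ∀ᵐ x ∂T.muCont.restrict (Ico (a n) (b n)), u x = 0 by
    have := (ae_restrict_iUnion_iff _ (fun x => u x = 0)).2 hn
    rwa [hU, Measure.restrict_univ] at this
  intro n
  have h0 : ∀ x y : T.Interior, ∫ z in Ico x y, u z ∂T.muCont = 0 := fun x y => by
    rcases le_total x y with hxy | hxy
    · exact h x y hxy
    · rw [Ico_eq_empty (not_lt.2 hxy)]; simp
  refine ae_eq_zero_of_forall_integral_Iic (integrableOn_of_memLp_of_ne_top hu
    (by rw [muCont_Ico]; exact ENNReal.ofReal_ne_top)) fun c => ?_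
  rw [Measure.restrict_restrict measurableSet_Iic]
  by_cases hc : c < b n
  · rw [← h0 (a n) c]
    refine setIntegral_congr_set ?_
    have e : Iic c ∩ Ico (a n) (b n) = Icc (a n) c := by
      ext z
      simp only [mem_inter_iff, mem_Iic, mem_Ico, mem_Icc]
      exact ⟨fun h => ⟨h.2.1, h.1⟩, fun h => ⟨h.2, h.1, h.2.trans_lt hc⟩⟩
    have := sdiff_null_ae_eq_self (s := Icc (a n) c) (T.muCont_singleton c)
    rw [Icc_sdiff_right] at this
    rw [e]
    exact this.symm
  · rw [← h0 (a n) (b n)]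
    congr 2
    exact inter_eq_right.2 fun z hz => hz.2.le.trans (not_lt.1 hc)

/-- The jump densities are removed first, atom by atom; the integrals over gaps then concern only
the continuous part. -/
lemma ae_eq_zero_of_integral_gap (hg : MemLp g 2 T.scaleMeasure)
    (h : ∀ x y : T.Interior, x ≤ y → ∫ w in T.gap x y, g w ∂T.scaleMeasure = 0) :
    g =ᵐ[T.scaleMeasure] 0 := by
  -- A measurable representative is taken so that the sets where the jump densities do not vanish
  -- are measurable and their mass is the sum over atoms.
  obtain ⟨g', hg'm, hgg'⟩ := hg.1
  have hg' := (memLp_congr_ae hgg').1 hg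
  have h' : ∀ x y : T.Interior, x ≤ y → ∫ w in T.gap x y, g' w ∂T.scaleMeasure = 0 :=
    fun x y hxy => by
      rw [← h x y hxy]; exact integral_congr_ae (ae_restrict_of_ae hgg'.symm)
  refine hgg'.trans ?_
  have hP : ∀ᵐ x ∂T.muPlus, g' (.inr (.inl x)) = 0 := by
    have hm : MeasurableSet {x : T.Interior | ¬ g' (.inr (.inl x)) = 0} :=
      (((hg'm.measurable.comp measurable_inr).comp measurable_inl)
        (measurableSet_singleton (0 : ℝ))).compl
    refine (T.muPlus_apply hm).trans (ENNReal.tsum_eq_zero.2 fun x => ?_)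
    rcases muPlus_mul_eq_zero hg' h' x with hx | hx
    · rw [muPlus_singleton] at hx
      simp [indicator, hx]
    · simp [indicator, hx]
  have hM : ∀ᵐ x ∂T.muMinus, g' (.inr (.inr x)) = 0 := by
    have hm : MeasurableSet {x : T.Interior | ¬ g' (.inr (.inr x)) = 0} :=
      (((hg'm.measurable.comp measurable_inr).comp measurable_inr)
        (measurableSet_singleton (0 : ℝ))).compl
    refine (T.muMinus_apply hm).trans (ENNReal.tsum_eq_zero.2 fun x => ?_)
    rcases muMinus_mul_eq_zero hg' h' x with hx | hx
    · rw [muMinus_singleton] at hx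
      simp [indicator, hx]
    · simp [indicator, hx]
  have hC : ∀ᵐ x ∂T.muCont, g' (.inl x) = 0 := by
    refine ae_muCont_eq_zero (memLp_scaleMeasure.1 hg').1 fun x y hxy => ?_
    have h1 := h' x y hxy
    rw [integral_gap_interior hg',
      integral_eq_zero_of_ae (f := fun z => g' (.inr (.inl z))) (ae_restrict_of_ae hP),
      integral_eq_zero_of_ae (f := fun z => g' (.inr (.inr z))) (ae_restrict_of_ae hM)] at h1
    simpa using h1
  exact ae_sumMeasure.2 ⟨hC, ae_sumMeasure.2 ⟨hP, hM⟩⟩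

lemma HasDens.unique {f : T.space → ℝ} {g g' : T.ScaleSpace → ℝ} (h : T.HasDens f g)
    (h' : T.HasDens f g') : g =ᵐ[T.scaleMeasure] g' := by
  have h0 := h.sub h'
  have := ae_eq_zero_of_integral_gap h0.memLp fun x y hxy => by
    have := h0.sub_eq (x := T.incl x) (y := T.incl y) hxy
    simpa using this.symm
  filter_upwards [this] with w hw
  exact sub_eq_zero.1 hw

/-! ### The speed measure -/

lemma speed_apply (A : Set T.space) : T.speed A = T.m (Subtype.val '' A) :=
  comap_subtype_coe_apply T.measurableSet_space _ _

lemma speed_singleton (x : T.space) : T.speed {x} = T.m {(x : EReal)} := by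
  rw [speed_apply, image_singleton]

lemma speed_Ioo_pos (hsupp : (T.m.restrict (Icc T.l T.r)).support = Icc T.l T.r) {x y : T.space}
    (h : x < y) : 0 < T.speed (Ioo x y) := by
  have e : (Subtype.val '' Ioo x y : Set EReal) = Ioo (x : EReal) y := by
    ext z
    constructor
    · rintro ⟨w, hw, rfl⟩; exact hw
    · intro hz
      exact ⟨⟨z, T.ordConnected_space.out x.2 y.2 ⟨hz.1.le, hz.2.le⟩⟩, hz, rfl⟩
  rw [speed_apply, e]
  obtain ⟨u, h1, h2⟩ := T.exists_interior_between h
  have hu : (u : EReal) ∈ (T.m.restrict (Icc T.l T.r)).support := by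
    rw [hsupp]; exact ⟨u.2.1.le, u.2.2.le⟩
  have := (Measure.mem_support_iff_forall _).1 hu _
    (Ioo_mem_nhds (show (x : EReal) < u from h1) (show (u : EReal) < y from h2))
  exact this.trans_le (Measure.restrict_apply_le _ _)

/-- A compact interval of the state space reaches an endpoint of `[l, r]` only if this endpoint is
reflecting, and then the mass near it, its atom included, is finite. The Radon property covers the
middle. -/
lemma speed_Icc_lt_top (a b : T.space) : T.speed (Icc a b) < ∞ := by
  have hsub : (Subtype.val '' Icc a b : Set EReal) ⊆ Icc (a : EReal) b := by
    rintro _ ⟨w, hw, rfl⟩; exact hw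
  rw [speed_apply]
  refine (measure_mono hsub).trans_lt ?_
  have hL : ∃ a' ∈ Ioo T.l T.r, T.m (Ico (a : EReal) a') < ∞ := by
    rcases a with ⟨a, ha | ⟨rfl, -, ⟨c, hc, hc'⟩, h2⟩ | ⟨rfl, h⟩⟩
    · exact ⟨a, ha, by simp⟩
    · refine ⟨c, hc, ?_⟩
      rw [← Ioo_insert_left hc.1, insert_eq]
      exact (measure_union_le _ _).trans_lt (ENNReal.add_lt_top.2 ⟨h2, hc'⟩)
    · exact ⟨0, ⟨T.l_neg, T.r_pos⟩, by simp [Ico_eq_empty (not_lt.2 T.r_pos.le)]⟩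
  have hR : ∃ b' ∈ Ioo T.l T.r, T.m (Ioc b' (b : EReal)) < ∞ := by
    rcases b with ⟨b, hb | ⟨rfl, h⟩ | ⟨rfl, -, ⟨c, hc, hc'⟩, h2⟩⟩
    · exact ⟨b, hb, by simp⟩
    · exact ⟨0, ⟨T.l_neg, T.r_pos⟩, by simp [Ioc_eq_empty (not_lt.2 T.l_neg.le)]⟩
    · refine ⟨c, hc, ?_⟩
      rw [← Ioo_insert_right hc.2, insert_eq]
      exact (measure_union_le _ _).trans_lt (ENNReal.add_lt_top.2 ⟨h2, hc'⟩)
  obtain ⟨a', ha', h1⟩ := hL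
  obtain ⟨b', hb', h2⟩ := hR
  have : Icc (a : EReal) b ⊆ (Ico (a : EReal) a' ∪ Icc a' b') ∪ Ioc b' (b : EReal) := by
    intro z hz
    by_cases h3 : z < a'
    · exact Or.inl (Or.inl ⟨hz.1, h3⟩)
    · by_cases h4 : z ≤ b'
      · exact Or.inl (Or.inr ⟨not_lt.1 h3, h4⟩)
      · exact Or.inr ⟨not_le.1 h4, hz.2⟩
  refine (measure_mono this).trans_lt ((measure_union_le _ _).trans_lt
    (ENNReal.add_lt_top.2 ⟨(measure_union_le _ _).trans_lt
      (ENNReal.add_lt_top.2 ⟨h1, T.m_radon _ ha' _ hb'⟩), h2⟩))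

lemma exists_mem_Ioo_of_ae (hsupp : (T.m.restrict (Icc T.l T.r)).support = Icc T.l T.r)
    {p : T.space → Prop} (hp : ∀ᵐ x ∂T.speed, p x) {x y : T.space} (h : x < y) :
    ∃ z ∈ Ioo x y, p z := by
  by_contra hcon
  push Not at hcon
  have : T.speed (Ioo x y) = 0 := measure_mono_null (fun z hz => hcon z hz) hp
  exact absurd this (speed_Ioo_pos hsupp h).ne'

/-- A function of finite energy that vanishes almost everywhere vanishes everywhere. -/
lemma HasDens.eq_zero_of_ae (hsupp : (T.m.restrict (Icc T.l T.r)).support = Icc T.l T.r)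
    (hatom : ∀ x ∈ T.leftJumps ∩ T.rightJumps, 0 < T.m {(x : EReal)})
    {f : T.space → ℝ} (h : T.HasDens f g) (hf : f =ᵐ[T.speed] 0) : f = 0 := by
  have hint : ∀ x : T.Interior, f (T.incl x) = 0 := by
    intro x
    -- If `s` jumps on both sides, `x` is an atom of the speed measure. Otherwise `s` is continuous
    -- from one side, full support provides zeros of `f` arbitrarily close to `x` on that side, and
    -- the Hölder estimate carries them to `x`.
    by_cases h1 : x ∈ T.leftJumps
    · by_cases h2 : x ∈ T.rightJumps
      · have h3 : 0 < T.speed {T.incl x} := by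
          rw [speed_singleton]; exact hatom x ⟨h1, h2⟩
        by_contra h4
        refine h3.ne' (measure_mono_null ?_ hf)
        rintro _ rfl
        exact h4
      · have h3 : T.s x = Function.rightLim T.s x := not_not.1 h2
        have h4 := ((T.mono.tendsto_rightLim x).sub_const (T.s x)).mul_const
          (∫ w, g w ^ 2 ∂T.scaleMeasure)
        rw [← h3, sub_self, zero_mul] at h4
        refine pow_eq_zero_iff (two_ne_zero) |>.1 (le_antisymm (ge_of_tendsto h4 ?_) (sq_nonneg _))
        filter_upwards [self_mem_nhdsWithin] with y hy
        obtain ⟨z, hz, hz0⟩ := exists_mem_Ioo_of_ae hsupp hf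
          (show T.incl x < T.incl y from hy)
        have h5 := h.sq_sub_le' hz.1.le
        rw [show f z = 0 from hz0, zero_sub, neg_sq] at h5
        refine h5.trans (mul_le_mul_of_nonneg_right ?_ (integral_nonneg fun w => sq_nonneg _))
        rw [← T.scale_interior, ← T.scale_interior]
        exact sub_le_sub_right (T.scale_monotone (b := T.incl y) hz.2.le) _
    · have h3 : T.s x = Function.leftLim T.s x := not_not.1 h1
      have h4 := ((T.mono.tendsto_leftLim x).const_sub (T.s x)).mul_const
        (∫ w, g w ^ 2 ∂T.scaleMeasure)
      rw [← h3, sub_self, zero_mul] at h4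
      refine pow_eq_zero_iff (two_ne_zero) |>.1 (le_antisymm (ge_of_tendsto h4 ?_) (sq_nonneg _))
      filter_upwards [self_mem_nhdsWithin] with y hy
      obtain ⟨z, hz, hz0⟩ := exists_mem_Ioo_of_ae hsupp hf
        (show T.incl y < T.incl x from hy)
      have h5 := h.sq_sub_le' hz.2.le
      rw [show f z = 0 from hz0, sub_zero] at h5
      refine h5.trans (mul_le_mul_of_nonneg_right ?_ (integral_nonneg fun w => sq_nonneg _))
      rw [← T.scale_interior, ← T.scale_interior]
      exact sub_le_sub_left (T.scale_monotone (a := T.incl y) hz.1.le) _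
  have hrestr : T.restr f = fun _ => 0 := funext hint
  ext ⟨x, hx⟩
  by_cases h1 : x = T.l
  · subst h1
    have h2 := h.tendsto_left (T.approachableLeft_of_mem hx)
    rw [hrestr] at h2
    rw [h.eq_prim]
    exact tendsto_nhds_unique h2 tendsto_const_nhds
  by_cases h2 : x = T.r
  · subst h2
    have h2 := h.tendsto_right (T.approachableRight_of_mem hx)
    rw [hrestr] at h2
    rw [h.eq_prim]
    exact tendsto_nhds_unique h2 tendsto_const_nhds
  exact hint ⟨x, T.mem_space_of_left hx h1 h2⟩

end ScaleTriple


/-! ### The Riesz criterion for the existence of a density -/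

lemma norm_sq_eq_integral_sq {X : Type*} [MeasurableSpace X] {μ : Measure X} (G : Lp ℝ 2 μ) :
    ‖G‖ ^ 2 = ∫ x, G x ^ 2 ∂μ := by
  rw [← real_inner_self_eq_norm_sq, L2.inner_def]
  refine integral_congr_ae (ae_of_all _ fun x => ?_)
  simp [sq]

lemma norm_toLp_sq {X : Type*} [MeasurableSpace X] {μ : Measure X} {g : X → ℝ}
    (hg : MemLp g 2 μ) : ‖hg.toLp g‖ ^ 2 = ∫ x, g x ^ 2 ∂μ := by
  rw [norm_sq_eq_integral_sq]
  refine integral_congr_ae ?_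
  filter_upwards [hg.coeFn_toLp] with x hx
  rw [hx]

namespace ScaleTriple
variable {T : ScaleTriple}

lemma setIntegral_gap_indicator {x y x' y' : EReal} (c : ℝ) :
    ∫ w in T.gap x y, (T.gap x' y').indicator (fun _ => c) w ∂T.scaleMeasure
      = (T.scaleMeasure (T.gap x' y' ∩ T.gap x y)).toReal * c := by
  rw [integral_indicator (T.measurableSet_gap _ _),
    Measure.restrict_restrict (T.measurableSet_gap _ _), setIntegral_const, Measure.real, smul_eq_mul]

/-- Interpolation of a function on a finite set by a piecewise constant density. -/
lemma exists_step_density {v H : T.space → ℝ} (hH : Monotone H)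
    (hv : ∀ x y, x ≤ y → (v y - v x) ^ 2 ≤ (T.scale y - T.scale x) * (H y - H x))
    (P : Finset T.space) :
    ∃ g : T.ScaleSpace → ℝ, MemLp g 2 T.scaleMeasure ∧
      (∀ z : T.space, (∀ x ∈ P, x ≤ z) → ∀ w ∉ T.below z, g w = 0) ∧
      (∀ a z, (∀ x ∈ P, a ≤ x) → (∀ x ∈ P, x ≤ z) → a ≤ z → ∫ w, g w ^ 2 ∂T.scaleMeasure ≤ H z - H a) ∧
      ∀ x ∈ P, ∀ y ∈ P, x ≤ y → ∫ w in T.gap x y, g w ∂T.scaleMeasure = v y - v x := by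
  classical
  -- Adding a new largest point `a` keeps the old density and puts on the gap from the former
  -- maximum `b` to `a` the constant `c`, the slope of `v` relative to the scale.
  induction P using Finset.induction_on_max with
  | empty =>
    refine ⟨fun _ => 0, MemLp.zero', fun _ _ _ _ => rfl, fun a z _ _ h => ?_, ?_⟩
    · simpa using hH h
    · simp
  | insert a P ha ih =>
    obtain ⟨g, hg, hg0, hgn, hgi⟩ := ih
    rcases P.eq_empty_or_nonempty with rfl | hP
    · refine ⟨fun _ => 0, MemLp.zero', fun _ _ _ _ => rfl, fun a z _ _ h => ?_, ?_⟩
      · simpa using hH h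
      · simp
    set b := P.max' hP with hb
    have hbP : b ∈ P := P.max'_mem hP
    have hPb : ∀ x ∈ P, x ≤ b := fun x hx => P.le_max' x hx
    have hba : b < a := ha b hbP
    have sfa := T.space_scaleFinite a
    have sfb := T.space_scaleFinite b
    set d := T.scale a - T.scale b with hd
    have hd' : d = (T.scaleMeasure (T.gap b a)).toReal := T.scale_sub sfb sfa hba.le
    have hd0 : 0 ≤ d := hd' ▸ ENNReal.toReal_nonneg
    set c := (v a - v b) / d with hc
    -- If `d = 0`, division by zero makes `c = 0`, and the hypothesis on `v` forces `v a = v b`, so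
    -- the identity survives.
    have hcd : c * d = v a - v b := by
      rcases hd0.eq_or_lt with h | h
      · have := hv b a hba.le
        rw [← hd, ← h, zero_mul] at this
        rw [← h, mul_zero]
        exact (pow_eq_zero_iff two_ne_zero |>.1 (le_antisymm this (sq_nonneg _))).symm
      · rw [hc]; field_simp
    -- The energy of the new piece is `(v a - v b)² / d`, which the hypothesis bounds by the
    -- increment of `H`; these increments telescope over the points.
    have hcd2 : c ^ 2 * d ≤ H a - H b := by
      rcases hd0.eq_or_lt with h | h
      · rw [← h, mul_zero]; exact sub_nonneg.2 (hH hba.le)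
      · have h1 := hv b a hba.le
        rw [← hd, ← hcd] at h1
        have h2 : d * (c ^ 2 * d) ≤ d * (H a - H b) := by nlinarith
        exact le_of_mul_le_mul_left h2 h
    set k : T.ScaleSpace → ℝ := (T.gap b a).indicator (fun _ => c) with hk
    have hkm : MemLp k 2 T.scaleMeasure :=
      memLp_indicator_const 2 (T.measurableSet_gap _ _) c (Or.inr (T.gap_ne_top sfb sfa))
    -- The old density lives below `b`, the new piece above it, so the squares add without a cross
    -- term.
    have hgk : ∀ w, g w * k w = 0 := fun w => by
      by_cases hw : w ∈ T.below b
      · have : k w = 0 := indicator_of_notMem (fun h => h.2 hw) _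
        rw [this, mul_zero]
      · rw [hg0 b hPb w hw, zero_mul]
    have hkgap : ∀ x : EReal, ∀ y ≤ (b : EReal), ∫ w in T.gap x y, k w ∂T.scaleMeasure = 0 := by
      intro x y hy
      rw [hk, setIntegral_gap_indicator]
      have : T.gap b a ∩ T.gap x y = ∅ := by
        ext w
        simp only [mem_inter_iff, mem_empty_iff_false, iff_false, not_and]
        exact fun h h' => h.2 (T.below_mono hy h'.1)
      rw [this]; simp
    refine ⟨g + k, hg.add hkm, ?_, ?_, ?_⟩
    · intro z hz w hw
      have h1 := hz a (Finset.mem_insert_self _ _)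
      have : k w = 0 := indicator_of_notMem (fun h => hw (T.below_mono h1 h.1)) _
      rw [Pi.add_apply, this, hg0 z (fun x hx => hz x (Finset.mem_insert_of_mem hx)) w hw, add_zero]
    · intro α z hα hz _
      have e : ∀ w, (g + k) w ^ 2 = g w ^ 2 + (T.gap b a).indicator (fun _ => c ^ 2) w := fun w => by
        have h1 := hgk w
        have h2 : k w ^ 2 = (T.gap b a).indicator (fun _ => c ^ 2) w := by
          rw [hk]; by_cases hw : w ∈ T.gap b a <;> simp [hw]
        rw [Pi.add_apply, ← h2]
        linear_combination 2 * h1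
      have hi : Integrable ((T.gap b a).indicator fun _ => c ^ 2) T.scaleMeasure :=
        (integrable_indicator_iff (T.measurableSet_gap _ _)).2
          (integrableOn_const (T.gap_ne_top sfb sfa))
      simp_rw [e]
      rw [integral_add hg.integrable_sq hi, integral_indicator (T.measurableSet_gap _ _),
        setIntegral_const, Measure.real, ← hd', smul_eq_mul]
      have h1 := hgn α b (fun x hx => hα x (Finset.mem_insert_of_mem hx)) hPb
        (hα b (Finset.mem_insert_of_mem hbP))
      have h2 := hH (hz a (Finset.mem_insert_self _ _))
      linarith
    · have hadd : ∀ x y : T.space, ∫ w in T.gap x y, (g + k) w ∂T.scaleMeasure =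
          (∫ w in T.gap x y, g w ∂T.scaleMeasure) + ∫ w in T.gap x y, k w ∂T.scaleMeasure :=
        fun x y => integral_add (integrableOn_gap hg (T.space_scaleFinite x) (T.space_scaleFinite y))
          (integrableOn_gap hkm (T.space_scaleFinite x) (T.space_scaleFinite y))
      have hin : ∀ x ∈ P, ∀ y ∈ P, x ≤ y →
          ∫ w in T.gap x y, (g + k) w ∂T.scaleMeasure = v y - v x := fun x hx y hy hxy => by
        rw [hadd, hgi x hx y hy hxy, hkgap x y (hPb y hy), add_zero]
      intro x hx y hy hxy
      rcases Finset.mem_insert.1 hy with rfl | hy'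
      · rcases Finset.mem_insert.1 hx with rfl | hx
        · rw [integral_gap_of_le _ le_rfl, sub_self]
        · rw [← integral_gap_add (hg.add hkm) (T.space_scaleFinite x) sfb sfa (hPb x hx) hba.le,
            hin x hx b hbP (hPb x hx), hadd]
          have h1 : ∫ w in T.gap b y, g w ∂T.scaleMeasure = 0 := by
            refine setIntegral_eq_zero_of_forall_eq_zero fun w hw => hg0 b hPb w hw.2
          rw [h1, hk, setIntegral_gap_indicator, inter_self, ← hd', mul_comm, hcd]
          ring
      · rcases Finset.mem_insert.1 hx with rfl | hx
        · exact absurd (ha y hy') (not_lt.2 hxy)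
        · exact hin x hx y hy' hxy

/-- A Riesz type criterion for the existence of a square integrable density. -/
lemma exists_hasDens {v H : T.space → ℝ} {M : ℝ} (hH : Monotone H)
    (hM : ∀ x y, H y - H x ≤ M)
    (hv : ∀ x y, x ≤ y → (v y - v x) ^ 2 ≤ (T.scale y - T.scale x) * (H y - H x)) :
    ∃ g, T.HasDens v g ∧ ∫ w, g w ^ 2 ∂T.scaleMeasure ≤ M := by
  classical
  have hM0 : 0 ≤ M := by simpa using hM (T.incl T.zero) (T.incl T.zero)
  have hstep : ∀ P : Finset T.space, ∃ G : Lp ℝ 2 T.scaleMeasure, ‖G‖ ≤ √M ∧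
      ∀ x ∈ P, ∀ y ∈ P, x ≤ y → ∫ w in T.gap x y, G w ∂T.scaleMeasure = v y - v x := by
    intro P
    rcases P.eq_empty_or_nonempty with rfl | hP
    · exact ⟨0, by simp, by simp⟩
    obtain ⟨g, hg, -, hgn, hgi⟩ := exists_step_density hH hv P
    refine ⟨hg.toLp g, Real.le_sqrt_of_sq_le ?_, fun x hx y hy hxy => ?_⟩
    · rw [norm_toLp_sq]
      exact (hgn (P.min' hP) (P.max' hP) (fun x hx => P.min'_le x hx) (fun x hx => P.le_max' x hx)
        (P.min'_le_max' hP)).trans (hM _ _)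
    · rw [← hgi x hx y hy hxy]
      exact integral_congr_ae (ae_restrict_of_ae hg.coeFn_toLp)
  choose G hGn hGi using hstep
  -- The interpolating densities have norm at most `√M` whatever the finite set; a weak limit is
  -- taken along an ultrafilter finer than the directed set of finite sets.
  obtain ⟨g, hgn, hg⟩ := exists_weak_limit (Ultrafilter.of atTop) G _ hGn
  refine ⟨g, HasDens.of_sub_eq (Lp.memLp g) fun x y hxy => ?_, ?_⟩
  · have hfin := T.gap_ne_top (T.space_scaleFinite x) (T.space_scaleFinite y)
    have e : ∀ F : Lp ℝ 2 T.scaleMeasure,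
        inner ℝ F (indicatorConstLp 2 (T.measurableSet_gap x y) hfin (1 : ℝ))
          = ∫ w in T.gap x y, F w ∂T.scaleMeasure := fun F => by
      rw [real_inner_comm, L2.inner_indicatorConstLp_one]
    have h1 := hg (indicatorConstLp 2 (T.measurableSet_gap x y) hfin (1 : ℝ))
    simp_rw [e] at h1
    refine tendsto_nhds_unique (tendsto_const_nhds.congr' ?_) h1
    -- Once `P` contains `x` and `y`, the integral over their gap is exactly the increment of `v`.
    -- Testing against the indicator of the gap passes this to the weak limit.
    have h2 : ∀ᶠ P : Finset T.space in atTop, x ∈ P ∧ y ∈ P := by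
      filter_upwards [eventually_ge_atTop {x, y}] with P hP
      exact ⟨hP (by simp), hP (by simp)⟩
    exact (Filter.Eventually.filter_mono (Ultrafilter.of_le _) h2).mono fun P hP => (hGi P x hP.1 y hP.2 hxy).symm
  · rw [← norm_sq_eq_integral_sq]
    calc ‖g‖ ^ 2 ≤ √M ^ 2 := by gcongr
      _ = M := Real.sq_sqrt hM0

/-- The distribution function of the energy. -/
def energyBelow (g : T.ScaleSpace → ℝ) (x : T.space) : ℝ :=
  ∫ w in T.below x, g w ^ 2 ∂T.scaleMeasure

lemma energyBelow_sub {g : T.ScaleSpace → ℝ} (hg : MemLp g 2 T.scaleMeasure) {x y : T.space}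
    (h : x ≤ y) : energyBelow g y - energyBelow g x = ∫ w in T.gap x y, g w ^ 2 ∂T.scaleMeasure :=
  (setIntegral_sdiff (T.measurableSet_below x) hg.integrable_sq.integrableOn (T.below_mono h)).symm

lemma energyBelow_mono {g : T.ScaleSpace → ℝ} (hg : MemLp g 2 T.scaleMeasure) :
    Monotone (energyBelow g) := fun x y h => by
  rw [← sub_nonneg, energyBelow_sub hg h]
  exact integral_nonneg fun w => sq_nonneg _

lemma energyBelow_sub_le {g : T.ScaleSpace → ℝ} (hg : MemLp g 2 T.scaleMeasure) (x y : T.space) :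
    energyBelow g y - energyBelow g x ≤ ∫ w, g w ^ 2 ∂T.scaleMeasure := by
  have h1 : energyBelow g y ≤ ∫ w, g w ^ 2 ∂T.scaleMeasure :=
    setIntegral_le_integral hg.integrable_sq (ae_of_all _ fun _ => sq_nonneg _)
  have h2 : 0 ≤ energyBelow g x := integral_nonneg fun w => sq_nonneg _
  linarith

lemma HasDens.sq_sub_le_energyBelow {f : T.space → ℝ} {g : T.ScaleSpace → ℝ} (h : T.HasDens f g)
    {x y : T.space} (hxy : x ≤ y) :
    (f y - f x) ^ 2 ≤ (T.scale y - T.scale x) * (energyBelow g y - energyBelow g x) := by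
  rw [energyBelow_sub h.memLp hxy]
  exact h.sq_sub_le hxy

/-- Contractions operate on the functions of finite energy. -/
lemma HasDens.contraction {f : T.space → ℝ} {g : T.ScaleSpace → ℝ} (h : T.HasDens f g) {θ : ℝ → ℝ}
    (hθ : ∀ a b, |θ a - θ b| ≤ |a - b|) :
    ∃ g', T.HasDens (fun x => θ (f x)) g' ∧
      ∫ w, g' w ^ 2 ∂T.scaleMeasure ≤ ∫ w, g w ^ 2 ∂T.scaleMeasure :=
  -- Increments do not grow under `θ`, so the energy distribution of `f` itself serves as `H`.
  exists_hasDens (energyBelow_mono h.memLp) (energyBelow_sub_le h.memLp) fun _ _ hxy =>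
    (sq_le_sq.2 (hθ _ _)).trans (h.sq_sub_le_energyBelow hxy)

/-- A bounded range of the scale. -/
lemma exists_hasDens_of_clamp {Φ : ℝ → ℝ} {K p q : ℝ} (hpq : p ≤ q)
    (hΦ : ∀ a b, |Φ a - Φ b| ≤ K * |a - b|) (hc : ∀ t, Φ (max p (min q t)) = Φ t) :
    ∃ g, T.HasDens (fun x : T.space => Φ (T.scale x)) g ∧
      ∫ w, g w ^ 2 ∂T.scaleMeasure ≤ K ^ 2 * (q - p) := by
  have hcm : Monotone fun t : ℝ => max p (min q t) := fun a b h => by dsimp only; gcongr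
  -- `Φ` only sees the clamped scale, whose increments are at most those of the scale. Of the two
  -- factors in `K² (β - α)²`, one is compared with the scale; the other goes into `H`, whose
  -- oscillation is at most `K² (q - p)`.
  refine exists_hasDens (H := fun x => K ^ 2 * max p (min q (T.scale x))) ?_ ?_ ?_
  · exact (hcm.comp T.scale_monotone).const_mul (sq_nonneg K)
  · intro x y
    rw [← mul_sub]
    have h1 : max p (min q (T.scale y)) ≤ q := max_le hpq (min_le_left _ _)
    have h2 : p ≤ max p (min q (T.scale x)) := le_max_left _ _
    exact mul_le_mul_of_nonneg_left (by linarith) (sq_nonneg K)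
  · intro x y hxy
    have hS := T.scale_monotone hxy
    dsimp only at hS ⊢
    rw [← hc (T.scale y), ← hc (T.scale x)]
    set α := max p (min q (T.scale x)) with hα
    set β := max p (min q (T.scale y)) with hβ
    have h1 : 0 ≤ β - α := sub_nonneg.2 (hcm hS)
    have h2 : β - α ≤ T.scale y - T.scale x := by
      have := abs_max_sub_max_le_abs (min q (T.scale y)) (min q (T.scale x)) p
      have h3 := abs_min_sub_min_le_max q (T.scale y) q (T.scale x)
      rw [max_comm (min q (T.scale y)), max_comm (min q (T.scale x)), ← hα, ← hβ,
        abs_of_nonneg h1] at this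
      simp only [sub_self, abs_zero] at h3
      rw [max_eq_right (abs_nonneg _), abs_of_nonneg (sub_nonneg.2 hS)] at h3
      linarith
    have h3 : (Φ β - Φ α) ^ 2 ≤ (K * |β - α|) ^ 2 := by
      rw [← sq_abs (Φ β - Φ α)]
      exact pow_le_pow_left₀ (abs_nonneg _) (hΦ β α) 2
    rw [mul_pow, sq_abs] at h3
    refine h3.trans ?_
    rw [← mul_sub, mul_left_comm]
    refine mul_le_mul_of_nonneg_left ?_ (sq_nonneg K)
    nlinarith

end ScaleTriple

namespace ScaleTriple
variable {T : ScaleTriple}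

/-! ### Operations on the class `ℱ` -/

lemma MemF.exists_hasDens {f : T.space → ℝ} (h : T.MemF f) : ∃ g, T.HasDens f g :=
  (memF_iff.1 h).1

lemma MemF.add {f f' : T.space → ℝ} (h : T.MemF f) (h' : T.MemF f') : T.MemF (f + f') := by
  obtain ⟨⟨g, hg⟩, h1, h2, h3⟩ := memF_iff.1 h
  obtain ⟨⟨g', hg'⟩, h1', h2', h3'⟩ := memF_iff.1 h'
  refine memF_iff.2 ⟨⟨_, hg.add hg'⟩, h1.add h1', fun a b => ?_, fun a b => ?_⟩
  · have := (h2 a b).add (h2' a b)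
    rwa [add_zero] at this
  · have := (h3 a b).add (h3' a b)
    rwa [add_zero] at this

lemma MemF.const_smul {f : T.space → ℝ} (h : T.MemF f) (c : ℝ) : T.MemF (c • f) := by
  obtain ⟨⟨g, hg⟩, h1, h2, h3⟩ := memF_iff.1 h
  refine memF_iff.2 ⟨⟨_, hg.const_smul c⟩, h1.const_smul c, fun a b => ?_, fun a b => ?_⟩
  · have := (h2 a b).const_mul c
    rwa [mul_zero] at this
  · have := (h3 a b).const_mul c
    rwa [mul_zero] at this

lemma continuous_of_abs_sub_le {θ : ℝ → ℝ} {K : ℝ} (hθ : ∀ a b, |θ a - θ b| ≤ K * |a - b|) :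
    Continuous θ := (LipschitzWith.of_dist_le' (K := K) hθ).continuous

/-- Contractions operate on `ℱ`. -/
lemma MemF.contraction {f : T.space → ℝ} (h : T.MemF f) {θ : ℝ → ℝ}
    (hθ : ∀ a b, |θ a - θ b| ≤ |a - b|) (h0 : θ 0 = 0) : T.MemF fun x => θ (f x) := by
  obtain ⟨⟨g, hg⟩, h1, h2, h3⟩ := memF_iff.1 h
  have hc : Continuous θ := continuous_of_abs_sub_le (K := 1) (by simpa using hθ)
  obtain ⟨g', hg', -⟩ := hg.contraction hθ
  refine memF_iff.2 ⟨⟨g', hg'⟩, ?_, fun a b => ?_, fun a b => ?_⟩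
  · refine h1.mono (hc.comp_aestronglyMeasurable h1.1) (ae_of_all _ fun x => ?_)
    have := hθ (f x) 0
    rw [h0, sub_zero, sub_zero] at this
    exact this
  · have := (hc.tendsto 0).comp (h2 a b)
    rwa [h0] at this
  · have := (hc.tendsto 0).comp (h3 a b)
    rwa [h0] at this

lemma measurable_scale : Measurable fun x : T.space => T.scale x := T.scale_monotone.measurable

lemma exists_interior_lt {a : T.space} (h : (a : EReal) ≠ T.l) :
    ∃ u : T.Interior, T.incl u < a := by
  obtain ⟨z, h1, h2⟩ := exists_between (lt_of_le_of_ne (T.space_subset_Icc a.2).1 (Ne.symm h))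
  exact ⟨⟨z, h1, h2.trans_le (T.space_subset_Icc a.2).2⟩, h2⟩

lemma exists_interior_gt {a : T.space} (h : (a : EReal) ≠ T.r) :
    ∃ u : T.Interior, a < T.incl u := by
  obtain ⟨z, h1, h2⟩ := exists_between (lt_of_le_of_ne (T.space_subset_Icc a.2).2 h)
  exact ⟨⟨z, (T.space_subset_Icc a.2).1.trans_lt h1, h2⟩, h1⟩

/-- If `l` is not in the state space, then `a` differs from `l`, so the function is zero on a whole
neighbourhood of `l`. -/
lemma vanishLeft_of_support {f : T.space → ℝ} {a b : T.space} (h : ∀ x ∉ Icc a b, f x = 0) :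
    T.VanishLeft f := by
  intro hl _
  obtain ⟨u, hu⟩ := exists_interior_lt (a := a) fun h => hl (h ▸ a.2)
  refine tendsto_const_nhds.congr' ?_
  filter_upwards [eventually_le_atBot u] with x hx
  refine (h _ fun hx' => ?_).symm
  exact absurd (hx'.1.trans (show T.incl x ≤ T.incl u from hx)) (not_le.2 hu)

lemma vanishRight_of_support {f : T.space → ℝ} {a b : T.space} (h : ∀ x ∉ Icc a b, f x = 0) :
    T.VanishRight f := by
  intro hr _
  obtain ⟨u, hu⟩ := exists_interior_gt (a := b) fun h => hr (h ▸ b.2)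
  refine tendsto_const_nhds.congr' ?_
  filter_upwards [eventually_ge_atTop u] with x hx
  refine (h _ fun hx' => ?_).symm
  exact absurd ((show T.incl u ≤ T.incl x from hx).trans hx'.2) (not_le.2 hu)

lemma memLp_of_bound_of_support {f : T.space → ℝ} (hf : Measurable f) {C : ℝ} (hC : ∀ x, |f x| ≤ C)
    {a b : T.space} (h : ∀ x ∉ Icc a b, f x = 0) : MemLp f 2 T.speed := by
  have e : f = (Icc a b).indicator f := by
    ext x
    by_cases hx : x ∈ Icc a b
    · rw [indicator_of_mem hx]
    · rw [indicator_of_notMem hx, h x hx]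
  rw [e, memLp_indicator_iff_restrict measurableSet_Icc]
  have : IsFiniteMeasure (T.speed.restrict (Icc a b)) :=
    ⟨by simpa using speed_Icc_lt_top a b⟩
  exact MemLp.of_bound hf.aestronglyMeasurable C (ae_of_all _ hC)

lemma memF_of_support {f : T.space → ℝ} {g : T.ScaleSpace → ℝ} (hg : T.HasDens f g)
    (hf : Measurable f) {C : ℝ} (hC : ∀ x, |f x| ≤ C)
    {a b : T.space} (h : ∀ x ∉ Icc a b, f x = 0) : T.MemF f :=
  memF_iff.2 ⟨⟨g, hg⟩, memLp_of_bound_of_support hf hC h, vanishLeft_of_support h,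
    vanishRight_of_support h⟩

lemma exists_bound_of_clamp {Φ : ℝ → ℝ} {p q : ℝ} (hΦ : Continuous Φ)
    (hc : ∀ t, Φ (max p (min q t)) = Φ t) (hpq : p ≤ q) : ∃ C, ∀ t, |Φ t| ≤ C := by
  obtain ⟨C, hC⟩ := isCompact_Icc.exists_bound_of_continuousOn (hΦ.continuousOn (s := Icc p q))
  exact ⟨C, fun t => by
    rw [← hc t]; exact hC _ ⟨le_max_left _ _, max_le hpq (min_le_left _ _)⟩⟩

/-- Lipschitz functions of the scale, supported in a compact interval, belong to `ℱ`. -/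
lemma memF_of_clamp {Φ : ℝ → ℝ} {K p q : ℝ} (hpq : p ≤ q)
    (hΦ : ∀ a b, |Φ a - Φ b| ≤ K * |a - b|) (hc : ∀ t, Φ (max p (min q t)) = Φ t)
    {a b : T.space} (h : ∀ x : T.space, x ∉ Icc a b → Φ (T.scale x) = 0) :
    T.MemF fun x => Φ (T.scale x) := by
  obtain ⟨g, hg, -⟩ := exists_hasDens_of_clamp (T := T) hpq hΦ hc
  have hcont := continuous_of_abs_sub_le hΦ
  obtain ⟨C, hC⟩ := exists_bound_of_clamp hcont hc hpq
  exact memF_of_support hg (hcont.measurable.comp measurable_scale) (fun x => hC _) h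

/-! ### The form on `L²` -/

/-- `G` is the density of the class `u`. -/
def Rel (u : Lp ℝ 2 T.speed) (G : Lp ℝ 2 T.scaleMeasure) : Prop :=
  ∃ f, T.MemF f ∧ u =ᵐ[T.speed] f ∧ T.HasDens f G

lemma Rel.add {u u' : Lp ℝ 2 T.speed} {G G' : Lp ℝ 2 T.scaleMeasure} (h : Rel u G)
    (h' : Rel u' G') : Rel (u + u') (G + G') := by
  obtain ⟨f, h1, h2, h3⟩ := h
  obtain ⟨f', h1', h2', h3'⟩ := h'
  refine ⟨f + f', h1.add h1', ?_, (h3.add h3').congr (Lp.coeFn_add G G').symm⟩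
  exact (Lp.coeFn_add u u').trans (h2.add h2')

lemma Rel.smul {u : Lp ℝ 2 T.speed} {G : Lp ℝ 2 T.scaleMeasure} (h : Rel u G) (c : ℝ) :
    Rel (c • u) (c • G) := by
  obtain ⟨f, h1, h2, h3⟩ := h
  refine ⟨c • f, h1.const_smul c, ?_, (h3.const_smul c).congr (Lp.coeFn_smul c G).symm⟩
  exact (Lp.coeFn_smul c u).trans (h2.const_smul c)

lemma rel_zero : Rel (0 : Lp ℝ 2 T.speed) (0 : Lp ℝ 2 T.scaleMeasure) := by
  have h0 : T.HasDens (0 : T.space → ℝ) (0 : T.ScaleSpace → ℝ) :=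
    HasDens.of_sub_eq MemLp.zero fun x y _ => by simp
  refine ⟨0, memF_iff.2 ⟨⟨0, h0⟩, MemLp.zero, fun _ _ => tendsto_const_nhds,
    fun _ _ => tendsto_const_nhds⟩, Lp.coeFn_zero _ _ _, h0.congr (Lp.coeFn_zero _ _ _).symm⟩

lemma HasDens.rel_toLp {f : T.space → ℝ} {g : T.ScaleSpace → ℝ} (hg : T.HasDens f g)
    (hf : T.MemF f) : Rel (hf.memLp.toLp f) (hg.memLp.toLp g) :=
  ⟨f, hf, hf.memLp.coeFn_toLp, hg.congr hg.memLp.coeFn_toLp.symm⟩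

variable (T) in
/-- The standing assumptions on the speed measure: full support, and an atom wherever the scale is
neither left nor right continuous. -/
structure Admissible : Prop where
  support_eq : (T.m.restrict (Icc T.l T.r)).support = Icc T.l T.r
  atom : ∀ x ∈ T.leftJumps ∩ T.rightJumps, 0 < T.m {(x : EReal)}

lemma HasDens.eq_of_ae (hT : T.Admissible) {f f' : T.space → ℝ} {g g' : T.ScaleSpace → ℝ} (h : T.HasDens f g)
    (h' : T.HasDens f' g') (hff' : f =ᵐ[T.speed] f') : f = f' := by
  refine sub_eq_zero.1 ((h.sub h').eq_zero_of_ae hT.support_eq hT.atom ?_)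
  filter_upwards [hff'] with x hx
  simp [hx]

lemma Rel.ae_eq (hT : T.Admissible) {u : Lp ℝ 2 T.speed} {G : Lp ℝ 2 T.scaleMeasure} (h : Rel u G) {f : T.space → ℝ}
    {g : T.ScaleSpace → ℝ} (hu : u =ᵐ[T.speed] f) (hg : T.HasDens f g) :
    G =ᵐ[T.scaleMeasure] g := by
  obtain ⟨f', h1, h2, h3⟩ := h
  have := h3.eq_of_ae hT hg (h2.symm.trans hu)
  subst this
  exact h3.unique hg

/-- With this the density is a well-defined linear function of the class in `L²(I₀, m)`, whichever
representative in `ℱ` is chosen. -/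
lemma Rel.unique (hT : T.Admissible) {u : Lp ℝ 2 T.speed} {G G' : Lp ℝ 2 T.scaleMeasure} (h : Rel u G)
    (h' : Rel u G') : G = G' := by
  obtain ⟨f', h1, h2, h3⟩ := h'
  exact Lp.ext (h.ae_eq hT h2 h3)

variable (T) in
/-- The classes of the functions in `ℱ`. -/
def formDomain : Submodule ℝ (Lp ℝ 2 T.speed) where
  carrier := {u | ∃ G, Rel u G}
  add_mem' := fun ⟨G, h⟩ ⟨G', h'⟩ => ⟨G + G', h.add h'⟩
  zero_mem' := ⟨0, rel_zero⟩
  smul_mem' := fun c _ ⟨G, h⟩ => ⟨c • G, h.smul c⟩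

/-- The density of an element of the domain. -/
def density (u : T.formDomain) : Lp ℝ 2 T.scaleMeasure := u.2.choose

lemma rel_density (u : T.formDomain) : Rel (u : Lp ℝ 2 T.speed) (density u) := u.2.choose_spec

/-- The density, as a linear map. -/
def densityMap (hT : T.Admissible) : T.formDomain →ₗ[ℝ] Lp ℝ 2 T.scaleMeasure where
  toFun := density
  map_add' u v := (rel_density (u + v)).unique hT ((rel_density u).add (rel_density v))
  map_smul' c u := (rel_density (c • u)).unique hT ((rel_density u).smul c)

/-- The form `(ℰ, ℱ)`. -/
def assocForm (hT : T.Admissible) : L2Form T.speed where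
  domain := T.formDomain
  form := (1 / 2 : ℝ) • (innerₗ (Lp ℝ 2 T.scaleMeasure)).compl₁₂ (densityMap hT)
    (densityMap hT)

lemma assocForm_form (hT : T.Admissible) (u v : (assocForm hT).domain) :
    (assocForm hT).form u v = 1 / 2 * inner ℝ (density u) (density v) := rfl

lemma density_eq (hT : T.Admissible) {u : T.formDomain} {G : Lp ℝ 2 T.scaleMeasure}
    (h : Rel (u : Lp ℝ 2 T.speed) G) : density u = G := (rel_density u).unique hT h

lemma energyOne_assocForm (hT : T.Admissible) (u : (assocForm hT).domain) :
    (assocForm hT).energyOne u = 1 / 2 * ‖density u‖ ^ 2 + ‖(u : Lp ℝ 2 T.speed)‖ ^ 2 := by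
  rw [L2Form.energyOne, assocForm_form, real_inner_self_eq_norm_sq]

lemma density_sub (hT : T.Admissible) (u v : (assocForm hT).domain) :
    density (u - v) = density u - density v := map_sub (densityMap hT) u v

lemma isAssociatedForm (hT : T.Admissible) : T.IsAssociatedForm (assocForm hT) where
  mem_domain u := by
    constructor
    · rintro ⟨G, f, h1, h2, -⟩
      exact ⟨f, h1, h2⟩
    · rintro ⟨f, h1, h2⟩
      obtain ⟨g, hg⟩ := h1.exists_hasDens
      exact ⟨hg.memLp.toLp g, f, h1, h2, hg.congr hg.memLp.coeFn_toLp.symm⟩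
  form_eq := by
    intro u v f g hf hg huf hvg fc fp fm gc gp gm hF hG
    have hF' := hasDens_of_hasScaleDeriv hF hf.left_mem hf.right_mem
    have hG' := hasDens_of_hasScaleDeriv hG hg.left_mem hg.right_mem
    have e1 := (rel_density u).ae_eq hT huf hF'
    have e2 := (rel_density v).ae_eq hT hvg hG'
    rw [assocForm_form, L2.inner_def]
    congr 1
    have : ∫ w, inner ℝ (density u w) (density v w) ∂T.scaleMeasure
        = ∫ w, dens fc fp fm w * dens gc gp gm w ∂T.scaleMeasure := by
      refine integral_congr_ae ?_
      filter_upwards [e1, e2] with w h1 h2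
      rw [h1, h2]; simp [mul_comm]
    exact this.trans (integral_scaleMeasure (hF'.memLp.integrable_mul hG'.memLp))

/-- The integral over a gap of finite measure is an inner product with its indicator, hence
continuous in the density. -/
lemma tendsto_prim {G : ℕ → Lp ℝ 2 T.scaleMeasure} {G' : Lp ℝ 2 T.scaleMeasure}
    (h : Tendsto G atTop (𝓝 G')) {x : EReal} (hx : x ∈ T.scaleFinite) :
    Tendsto (fun n => T.prim (G n) x) atTop (𝓝 (T.prim G' x)) := by
  have key : ∀ {y z : EReal} (_ : T.scaleMeasure (T.gap y z) ≠ ∞),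
      Tendsto (fun n => ∫ w in T.gap y z, G n w ∂T.scaleMeasure) atTop
        (𝓝 (∫ w in T.gap y z, G' w ∂T.scaleMeasure)) := fun {y z} hfin => by
    simp_rw [← L2.inner_indicatorConstLp_one (𝕜 := ℝ) (T.measurableSet_gap y z) hfin]
    exact tendsto_const_nhds.inner h
  exact (key hx.1).sub (key hx.2)

lemma exists_subseq_ae_tendsto {X : Type*} [MeasurableSpace X] {μ : Measure X}
    {u : ℕ → Lp ℝ 2 μ} {v : Lp ℝ 2 μ} (h : Tendsto u atTop (𝓝 v)) :
    ∃ φ : ℕ → ℕ, StrictMono φ ∧ ∀ᵐ x ∂μ, Tendsto (fun n => u (φ n) x) atTop (𝓝 (v x)) :=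
  (tendstoInMeasure_of_tendsto_Lp h).exists_seq_tendsto_ae

/-- The graph of the density map is closed. Convergence of densities gives pointwise convergence of
primitives, also at approachable endpoints outside the state space, so the vanishing conditions pass
to the limit. -/
lemma Rel.of_tendsto (hT : T.Admissible)
    {u : ℕ → Lp ℝ 2 T.speed} {G : ℕ → Lp ℝ 2 T.scaleMeasure}
    {u' : Lp ℝ 2 T.speed} {G' : Lp ℝ 2 T.scaleMeasure} (h : ∀ n, Rel (u n) (G n))
    (hu : Tendsto u atTop (𝓝 u')) (hG : Tendsto G atTop (𝓝 G')) : Rel u' G' := by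
  choose f hf huf hfG using h
  obtain ⟨φ, hφ, hae⟩ := exists_subseq_ae_tendsto hu
  have hae' : ∀ᵐ x ∂T.speed, Tendsto (fun n => f (φ n) x) atTop (𝓝 (u' x)) := by
    filter_upwards [hae, ae_all_iff.2 huf] with x h1 h2
    exact h1.congr fun n => h2 _
  -- A single point of convergence of the functions fixes the constant of integration. One exists
  -- because the speed measure charges `(0, y)`.
  obtain ⟨y, hy⟩ := T.exists_gt_interior T.zero
  obtain ⟨x₀, -, hx₀⟩ := exists_mem_Ioo_of_ae hT.support_eq hae'
    (show T.incl T.zero < T.incl y from hy)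
  have hP : ∀ {x : EReal}, x ∈ T.scaleFinite →
      Tendsto (fun n => T.prim (G (φ n)) x) atTop (𝓝 (T.prim G' x)) := fun hx =>
    (tendsto_prim hG hx).comp hφ.tendsto_atTop
  set c := u' x₀ - T.prim G' x₀ with hc
  have hlim0 : Tendsto (fun n => f (φ n) (T.incl T.zero)) atTop (𝓝 c) := by
    refine (hx₀.sub (hP (T.space_scaleFinite x₀))).congr fun n => ?_
    rw [(hfG (φ n)).eq_prim x₀]; ring
  let f' : T.space → ℝ := fun x => c + T.prim G' x
  have hlim : ∀ x, Tendsto (fun n => f (φ n) x) atTop (𝓝 (f' x)) := fun x =>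
    (hlim0.add (hP (T.space_scaleFinite x))).congr fun n => ((hfG (φ n)).eq_prim x).symm
  have hf0 : f' (T.incl T.zero) = c := by
    simp only [f']
    rw [show ((T.incl T.zero : T.space) : EReal) = 0 from rfl, prim_zero, add_zero]
  have hD : T.HasDens f' G' := ⟨Lp.memLp G', fun x => by rw [hf0]⟩
  have hae2 : u' =ᵐ[T.speed] f' := by
    filter_upwards [hae'] with x hx
    exact tendsto_nhds_unique hx (hlim x)
  refine ⟨f', memF_iff.2 ⟨⟨_, hD⟩, (memLp_congr_ae hae2).1 (Lp.memLp u'), fun h1 h2 => ?_,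
    fun h1 h2 => ?_⟩, hae2, hD⟩
  · have e : ∀ n, f (φ n) (T.incl T.zero) + T.prim (G (φ n)) T.l = 0 := fun n =>
      tendsto_nhds_unique ((hfG (φ n)).tendsto_left h2) ((hf (φ n)).left_notMem h1 h2)
    have e' := tendsto_nhds_unique ((hlim0.add (hP (T.left_scaleFinite h2))).congr e)
      tendsto_const_nhds
    have := hD.tendsto_left h2
    rwa [hf0, e'] at this
  · have e : ∀ n, f (φ n) (T.incl T.zero) + T.prim (G (φ n)) T.r = 0 := fun n =>
      tendsto_nhds_unique ((hfG (φ n)).tendsto_right h2) ((hf (φ n)).right_notMem h1 h2)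
    have e' := tendsto_nhds_unique ((hlim0.add (hP (T.right_scaleFinite h2))).congr e)
      tendsto_const_nhds
    have := hD.tendsto_right h2
    rwa [hf0, e'] at this

lemma cauchySeq_of_sq_le {E : Type*} [NormedAddCommGroup E] {u : ℕ → E} {e : ℕ → ℕ → ℝ} {C : ℝ}
    (hC : 0 < C) (h : ∀ m n, ‖u m - u n‖ ^ 2 ≤ C * e m n)
    (he : ∀ ε > 0, ∃ N, ∀ m ≥ N, ∀ n ≥ N, e m n < ε) : CauchySeq u := by
  refine Metric.cauchySeq_iff.2 fun ε hε => ?_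
  obtain ⟨N, hN⟩ := he (ε ^ 2 / C) (by positivity)
  refine ⟨N, fun m hm n hn => ?_⟩
  rw [dist_eq_norm]
  have h1 := hN m hm n hn
  rw [lt_div_iff₀ hC] at h1
  have h2 := h m n
  exact lt_of_pow_lt_pow_left₀ 2 hε.le (by linarith)

/-- An `E₁`-Cauchy sequence is Cauchy for the classes and for their densities separately, so
closedness reduces to the closed graph. The unit contraction is a contraction fixing `0`. -/
lemma isWideDirichletForm (hT : T.Admissible) : (assocForm hT).IsWideDirichletForm where
  symm u v := by rw [assocForm_form, assocForm_form, real_inner_comm]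
  nonneg u := by
    rw [assocForm_form]
    have := real_inner_self_nonneg (x := density u)
    positivity
  closed u hu := by
    simp only [energyOne_assocForm, density_sub] at hu ⊢
    have c1 : CauchySeq fun n => (u n : Lp ℝ 2 T.speed) :=
      cauchySeq_of_sq_le (C := 1) one_pos (fun m n => by
        have := sq_nonneg ‖density (u m) - density (u n)‖
        have e : ((u m - u n : (assocForm hT).domain) : Lp ℝ 2 T.speed)
          = (u m : Lp ℝ 2 T.speed) - u n := rfl
        rw [← e]; linarith) hu
    have c2 : CauchySeq fun n => density (u n) :=
      cauchySeq_of_sq_le (C := 2) two_pos (fun m n => by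
        have := sq_nonneg ‖((u m - u n : (assocForm hT).domain) : Lp ℝ 2 T.speed)‖
        linarith) hu
    obtain ⟨u', hu'⟩ := cauchySeq_tendsto_of_complete c1
    obtain ⟨G', hG'⟩ := cauchySeq_tendsto_of_complete c2
    have hrel : Rel u' G' := Rel.of_tendsto hT (fun n => rel_density (u n)) hu' hG'
    let v : (assocForm hT).domain := ⟨u', G', hrel⟩
    refine ⟨v, ?_⟩
    have hv : density v = G' := density_eq hT hrel
    have t1 : Tendsto (fun n => ‖density (u n) - G'‖ ^ 2) atTop (𝓝 0) := by
      simpa using ((tendsto_iff_norm_sub_tendsto_zero.1 hG').pow 2)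
    have t2 : Tendsto (fun n => ‖(u n : Lp ℝ 2 T.speed) - u'‖ ^ 2) atTop (𝓝 0) := by
      simpa using ((tendsto_iff_norm_sub_tendsto_zero.1 hu').pow 2)
    have := (t1.const_mul (1 / 2)).add t2
    rw [mul_zero, add_zero] at this
    refine this.congr fun n => ?_
    rw [hv]
    rfl
  markov u := by
    obtain ⟨f, hf, huf, hfG⟩ := rel_density u
    have hθ : ∀ a b : ℝ, |min (max 0 a) 1 - min (max 0 b) 1| ≤ |a - b| := fun a b => by
      have h1 := abs_min_sub_min_le_max (max 0 a) 1 (max 0 b) 1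
      have h2 := abs_max_sub_max_le_max 0 a 0 b
      rw [sub_self, abs_zero, max_eq_left (abs_nonneg (max 0 a - max 0 b))] at h1
      rw [sub_self, abs_zero, max_eq_right (abs_nonneg (a - b))] at h2
      exact h1.trans h2
    obtain ⟨g', hg', hle⟩ := hfG.contraction (θ := fun t => min (max 0 t) 1) hθ
    have hF := hf.contraction (θ := fun t => min (max 0 t) 1) hθ (by simp)
    have hrel := hg'.rel_toLp hF
    let v : (assocForm hT).domain := ⟨_, _, hrel⟩
    have hv : density v = hg'.memLp.toLp g' := density_eq hT (u := v) hrel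
    refine ⟨v, ?_, ?_⟩
    · filter_upwards [hF.memLp.coeFn_toLp, huf] with x h1 h2
      rw [h1, h2]
    · rw [assocForm_form, assocForm_form, hv, real_inner_self_eq_norm_sq,
        real_inner_self_eq_norm_sq, norm_toLp_sq, norm_sq_eq_integral_sq]
      linarith

end ScaleTriple


/-! ### Trapezoidal functions of the scale and the density of the domain -/

/-- The trapezoidal function equal to `1` on `[p, q]`, with slopes `± c`. -/
def trapezoid (p q c t : ℝ) : ℝ := max 0 (1 - c * max 0 (max (p - t) (t - q)))

section Trapezoid
variable {p q c : ℝ}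

lemma abs_max_sub_max_le (a b x y : ℝ) : |max a b - max x y| ≤ max |a - x| |b - y| :=
  abs_max_sub_max_le_max a b x y

lemma trapezoid_lipschitz (hc : 0 ≤ c) (a b : ℝ) :
    |trapezoid p q c a - trapezoid p q c b| ≤ c * |a - b| := by
  have h1 : |max (p - a) (a - q) - max (p - b) (b - q)| ≤ |a - b| := by
    refine (abs_max_sub_max_le _ _ _ _).trans (max_le ?_ ?_)
    · rw [sub_sub_sub_cancel_left, abs_sub_comm]
    · rw [sub_sub_sub_cancel_right]
  have h2 : |max 0 (max (p - a) (a - q)) - max 0 (max (p - b) (b - q))| ≤ |a - b| := by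
    refine (abs_max_sub_max_le _ _ _ _).trans (max_le ?_ h1)
    simp
  refine (abs_max_sub_max_le _ _ _ _).trans (max_le ?_ ?_)
  · simp only [sub_self, abs_zero]; positivity
  · rw [sub_sub_sub_cancel_left, ← mul_sub, abs_mul, abs_of_nonneg hc, abs_sub_comm]
    exact mul_le_mul_of_nonneg_left h2 hc

lemma trapezoid_nonneg (t : ℝ) : 0 ≤ trapezoid p q c t := le_max_left _ _

lemma trapezoid_le_one (hc : 0 ≤ c) (t : ℝ) : trapezoid p q c t ≤ 1 := by
  refine max_le zero_le_one ?_
  have := mul_nonneg hc (le_max_left 0 (max (p - t) (t - q)))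
  linarith

lemma trapezoid_of_mem {t : ℝ} (h1 : p ≤ t) (h2 : t ≤ q) : trapezoid p q c t = 1 := by
  rw [trapezoid, max_eq_left (max_le (by linarith) (by linarith))]; simp

lemma trapezoid_of_le (hc : 0 < c) {t : ℝ} (h : t ≤ p - 1 / c) : trapezoid p q c t = 0 := by
  refine max_eq_left ?_
  have h1 : 1 / c ≤ max 0 (max (p - t) (t - q)) :=
    (by linarith : 1 / c ≤ p - t).trans ((le_max_left _ _).trans (le_max_right _ _))
  have := mul_le_mul_of_nonneg_left h1 hc.le
  rw [mul_one_div_cancel hc.ne'] at this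
  linarith

lemma trapezoid_of_ge (hc : 0 < c) {t : ℝ} (h : q + 1 / c ≤ t) : trapezoid p q c t = 0 := by
  refine max_eq_left ?_
  have h1 : 1 / c ≤ max 0 (max (p - t) (t - q)) :=
    (by linarith : 1 / c ≤ t - q).trans ((le_max_right _ _).trans (le_max_right _ _))
  have := mul_le_mul_of_nonneg_left h1 hc.le
  rw [mul_one_div_cancel hc.ne'] at this
  linarith

/-- The trapezoid vanishes from the ends of its base outwards, so it depends only on its argument
clamped to that base. This bounds its energy as a function of the scale. -/
lemma trapezoid_clamp (hc : 0 < c) (hpq : p ≤ q) (t : ℝ) :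
    trapezoid p q c (max (p - 1 / c) (min (q + 1 / c) t)) = trapezoid p q c t := by
  have hc' : 0 < 1 / c := by positivity
  rcases le_total t (p - 1 / c) with h | h
  · rw [min_eq_right (by linarith), max_eq_left h, trapezoid_of_le hc le_rfl, trapezoid_of_le hc h]
  · rcases le_total t (q + 1 / c) with h' | h'
    · rw [min_eq_right h', max_eq_right h]
    · rw [min_eq_left h', max_eq_right (by linarith), trapezoid_of_ge hc le_rfl,
        trapezoid_of_ge hc h']

lemma tendsto_trapezoid (t : ℝ) : Tendsto (fun n : ℕ => trapezoid p q (n + 1) t) atTop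
    (𝓝 ((Icc p q).indicator (fun _ => 1) t)) := by
  by_cases h : t ∈ Icc p q
  · rw [indicator_of_mem h]
    simp_rw [trapezoid_of_mem h.1 h.2]
    exact tendsto_const_nhds
  · rw [indicator_of_notMem h]
    have hlim := tendsto_one_div_add_atTop_nhds_zero_nat (𝕜 := ℝ)
    refine tendsto_const_nhds.congr' ?_
    have hpos : ∀ n : ℕ, (0 : ℝ) < n + 1 := fun n => by positivity
    by_cases h1 : t < p
    · filter_upwards [hlim.eventually (Iio_mem_nhds (show (0 : ℝ) < p - t by linarith))] with n hn
      rw [trapezoid_of_le (hpos n)]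
      have : 1 / ((n : ℝ) + 1) < p - t := hn
      linarith
    · have h2 : q < t := by
        by_contra h3
        exact h ⟨not_lt.1 h1, not_lt.1 h3⟩
      filter_upwards [hlim.eventually (Iio_mem_nhds (show (0 : ℝ) < t - q by linarith))] with n hn
      rw [trapezoid_of_ge (hpos n)]
      have : 1 / ((n : ℝ) + 1) < t - q := hn
      linarith

end Trapezoid

namespace ScaleTriple
variable {T : ScaleTriple}

lemma memF_trapezoid {p q c : ℝ} (hpq : p ≤ q) (hc : 0 < c) {a b : T.space}
    (ha : ∀ x : T.space, x < a → T.scale x ≤ p - 1 / c)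
    (hb : ∀ x : T.space, b < x → q + 1 / c ≤ T.scale x) :
    T.MemF fun x => trapezoid p q c (T.scale x) := by
  have hc' : 0 < 1 / c := by positivity
  refine memF_of_clamp (by linarith) (trapezoid_lipschitz hc.le) (trapezoid_clamp hc hpq)
    (a := a) (b := b) fun x hx => ?_
  by_cases h : x < a
  · exact trapezoid_of_le hc (ha x h)
  · refine trapezoid_of_ge hc (hb x ?_)
    by_contra h'
    exact hx ⟨not_lt.1 h, not_lt.1 h'⟩

/-- Room for the sloping side of a trapezoid: strict monotonicity makes the scale drop by a positive
amount before an interior point below `a`. If `a = l` there is nothing below, and the margin `1` is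
arbitrary. -/
lemma exists_margin_left (hs : StrictMono T.s) (a : T.space) : ∃ a₁ ≤ a, ∃ δ > 0,
    ∀ x : T.space, x < a₁ → T.scale x ≤ T.scale a - δ := by
  by_cases h : (a : EReal) = T.l
  · refine ⟨a, le_rfl, 1, one_pos, fun x hx => ?_⟩
    have hx' : (x : EReal) < a := hx
    rw [h] at hx'
    exact absurd (T.space_subset_Icc x.2).1 (not_le.2 hx')
  · obtain ⟨u, hu⟩ := exists_interior_lt h
    have hlt : T.scale (T.incl u) < T.scale a := T.scale_strictMono hs hu
    refine ⟨T.incl u, hu.le, T.scale a - T.scale u, sub_pos.2 hlt,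
      fun x hx => ?_⟩
    have : T.scale x ≤ T.scale (T.incl u) := T.scale_monotone hx.le
    rw [coe_incl] at this
    linarith

lemma exists_margin_right (hs : StrictMono T.s) (b : T.space) : ∃ b₁ ≥ b, ∃ δ > 0,
    ∀ x : T.space, b₁ < x → T.scale b + δ ≤ T.scale x := by
  by_cases h : (b : EReal) = T.r
  · refine ⟨b, le_rfl, 1, one_pos, fun x hx => ?_⟩
    have hx' : (b : EReal) < x := hx
    rw [h] at hx'
    exact absurd (T.space_subset_Icc x.2).2 (not_le.2 hx')
  · obtain ⟨u, hu⟩ := exists_interior_gt h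
    have hlt : T.scale b < T.scale (T.incl u) := T.scale_strictMono hs hu
    refine ⟨T.incl u, hu.le, T.scale u - T.scale b, sub_pos.2 hlt,
      fun x hx => ?_⟩
    have : T.scale (T.incl u) ≤ T.scale x := T.scale_monotone hx.le
    rw [coe_incl] at this
    linarith

lemma exists_exhaustion_space (T : ScaleTriple) :
    ∃ a b : ℕ → T.space, ∀ x, ∃ n, x ∈ Icc (a n) (b n) := by
  classical
  obtain ⟨a, b, hab⟩ := T.exists_exhaustion
  refine ⟨fun n => if h : T.l ∈ T.space then ⟨T.l, h⟩ else T.incl (a n),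
    fun n => if h : T.r ∈ T.space then ⟨T.r, h⟩ else T.incl (b n), fun x => ?_⟩
  have key : ∃ n, ((x : EReal) ≠ T.l → a n ≤ (x : EReal)) ∧ ((x : EReal) ≠ T.r → (x : EReal) ≤ b n) := by
    by_cases h1 : (x : EReal) = T.l
    · obtain ⟨n, -, hn⟩ := hab T.zero
      exact ⟨n, fun h => absurd h1 h, fun _ => h1.le.trans (b n).2.1.le⟩
    by_cases h2 : (x : EReal) = T.r
    · obtain ⟨n, hn, -⟩ := hab T.zero
      exact ⟨n, fun _ => (a n).2.2.le.trans h2.ge, fun h => absurd h2 h⟩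
    obtain ⟨n, h3, h4⟩ := hab ⟨x, T.mem_space_of_left x.2 h1 h2⟩
    exact ⟨n, fun _ => h3, fun _ => h4.le⟩
  obtain ⟨n, h1, h2⟩ := key
  refine ⟨n, ?_, ?_⟩
  · dsimp only
    split_ifs with h
    · exact (T.space_subset_Icc x.2).1
    · exact h1 fun h' => h (h' ▸ x.2)
  · dsimp only
    split_ifs with h
    · exact (T.space_subset_Icc x.2).2
    · exact h2 fun h' => h (h' ▸ x.2)

/-- The speed measure may be infinite, so one works on an exhaustion by compact intervals, where `w`
is integrable. -/
lemma ae_speed_eq_zero {w : T.space → ℝ} (hw : MemLp w 2 T.speed)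
    (h : ∀ a b : T.space, a ≤ b → ∫ x in Icc a b, w x ∂T.speed = 0) : w =ᵐ[T.speed] 0 := by
  obtain ⟨a, b, hab⟩ := T.exists_exhaustion_space
  have hU : (⋃ n, Icc (a n) (b n)) = univ := eq_univ_of_forall fun x => mem_iUnion.2 (hab x)
  suffices hn : ∀ n, ∀ᵐ x ∂T.speed.restrict (Icc (a n) (b n)), w x = 0 by
    have := (ae_restrict_iUnion_iff _ (fun x => w x = 0)).2 hn
    rwa [hU, Measure.restrict_univ] at this
  intro n
  have h0 : ∀ a b : T.space, ∫ x in Icc a b, w x ∂T.speed = 0 := fun x y => by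
    rcases le_or_gt x y with hxy | hxy
    · exact h x y hxy
    · rw [Icc_eq_empty (not_le.2 hxy)]; simp
  have : IsFiniteMeasure (T.speed.restrict (Icc (a n) (b n))) :=
    ⟨by simpa using speed_Icc_lt_top (a n) (b n)⟩
  refine ae_eq_zero_of_forall_integral_Iic ((hw.restrict _).integrable one_le_two) fun c => ?_
  rw [Measure.restrict_restrict measurableSet_Iic]
  have e : Iic c ∩ Icc (a n) (b n) = Icc (a n) (min c (b n)) := by
    ext z
    simp only [mem_inter_iff, mem_Iic, mem_Icc, le_min_iff]
    tauto
  rw [e, h0]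

/-- A class `w` orthogonal to the domain is orthogonal to the trapezoids of the scale over `[s(a),
s(b)]`. As the slopes tend to infinity they converge to the indicator of `[a, b]`, the scale being
strictly increasing, so `w` has zero integral over each such interval. -/
lemma dense_formDomain (hs : StrictMono T.s) :
    Dense (T.formDomain : Set (Lp ℝ 2 T.speed)) := by
  rw [Submodule.dense_iff_topologicalClosure_eq_top, Submodule.topologicalClosure_eq_top_iff,
    Submodule.eq_bot_iff]
  intro w hw
  rw [Submodule.mem_orthogonal] at hw
  refine (Lp.eq_zero_iff_ae_eq_zero).2 (ae_speed_eq_zero (Lp.memLp w) fun a b hab => ?_)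
  obtain ⟨a₁, ha₁, δ, hδ, hleft⟩ := exists_margin_left hs a
  obtain ⟨b₁, hb₁, δ', hδ', hright⟩ := exists_margin_right hs b
  have hlim := tendsto_one_div_add_atTop_nhds_zero_nat (𝕜 := ℝ)
  -- From `N` on the sloping sides fit in the margins, so all these trapezoids are carried by one
  -- compact interval; this gives membership in `ℱ` and the dominating function.
  obtain ⟨N, hN⟩ := eventually_atTop.1 ((hlim.eventually (Iio_mem_nhds hδ)).and
    (hlim.eventually (Iio_mem_nhds hδ')))
  let f : ℕ → T.space → ℝ := fun n x => trapezoid (T.scale a) (T.scale b) (n + 1) (T.scale x)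
  have hpos : ∀ n : ℕ, (0 : ℝ) < n + 1 := fun n => by positivity
  have hsab : T.scale a ≤ T.scale b := T.scale_monotone hab
  have hl : ∀ n ≥ N, ∀ x : T.space, x < a₁ → T.scale x ≤ T.scale a - 1 / ((n : ℝ) + 1) :=
    fun n hn x hx => by
      have h1 := hleft x hx
      have h2 : 1 / ((n : ℝ) + 1) < δ := (hN n hn).1
      linarith
  have hr : ∀ n ≥ N, ∀ x : T.space, b₁ < x → T.scale b + 1 / ((n : ℝ) + 1) ≤ T.scale x :=
    fun n hn x hx => by
      have h1 := hright x hx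
      have h2 : 1 / ((n : ℝ) + 1) < δ' := (hN n hn).2
      linarith
  have hf : ∀ n ≥ N, T.MemF (f n) := fun n hn =>
    memF_trapezoid hsab (hpos n) (hl n hn) (hr n hn)
  have hzero : ∀ n ≥ N, ∀ x ∉ Icc a₁ b₁, f n x = 0 := fun n hn x hx => by
    by_cases h : x < a₁
    · exact trapezoid_of_le (hpos n) (hl n hn x h)
    · refine trapezoid_of_ge (hpos n) (hr n hn x ?_)
      by_contra h'
      exact hx ⟨not_lt.1 h, not_lt.1 h'⟩
  have horth : ∀ n ≥ N, ∫ x, f n x * w x ∂T.speed = 0 := fun n hn => by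
    obtain ⟨g, hg⟩ := (hf n hn).exists_hasDens
    have h1 := hw _ ⟨_, hg.rel_toLp (hf n hn)⟩
    rw [L2.inner_def] at h1
    rw [← h1]
    refine integral_congr_ae ?_
    filter_upwards [(hf n hn).memLp.coeFn_toLp] with x hx
    rw [hx]; simp [mul_comm]
  have hfin : IsFiniteMeasure (T.speed.restrict (Icc a₁ b₁)) :=
    ⟨by simpa using speed_Icc_lt_top a₁ b₁⟩
  have hwi : IntegrableOn w (Icc a₁ b₁) T.speed := ((Lp.memLp w).restrict _).integrable one_le_two
  have hconv : Tendsto (fun n => ∫ x, f (n + N) x * w x ∂T.speed) atTop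
      (𝓝 (∫ x, (Icc a b).indicator w x ∂T.speed)) := by
    refine tendsto_integral_of_dominated_convergence
      ((Icc a₁ b₁).indicator fun x => |w x|) (fun n => ?_) ?_ (fun n => ?_) ?_
    · exact (hf (n + N) (Nat.le_add_left _ _)).memLp.1.mul (Lp.memLp w).1
    · exact (integrable_indicator_iff measurableSet_Icc).2 hwi.abs
    · refine ae_of_all _ fun x => ?_
      by_cases hx : x ∈ Icc a₁ b₁
      · rw [indicator_of_mem hx, Real.norm_eq_abs, abs_mul]
        refine mul_le_of_le_one_left (abs_nonneg _) ?_
        rw [abs_of_nonneg (trapezoid_nonneg _)]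
        exact trapezoid_le_one (hpos _).le _
      · rw [hzero (n + N) (Nat.le_add_left _ _) x hx, zero_mul, norm_zero]
        exact indicator_nonneg (fun x _ => abs_nonneg _) x
    · refine ae_of_all _ fun x => ?_
      have h1 := ((tendsto_trapezoid (p := T.scale a) (q := T.scale b) (T.scale x)).comp
        (tendsto_add_atTop_nat N)).mul_const (w x)
      have e : (Icc (T.scale a) (T.scale b)).indicator (fun _ => (1 : ℝ)) (T.scale x) * w x
          = (Icc a b).indicator w x := by
        have hiff : T.scale x ∈ Icc (T.scale a) (T.scale b) ↔ x ∈ Icc a b := by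
          rw [mem_Icc, mem_Icc]
          exact and_congr (T.scale_strictMono hs).le_iff_le (T.scale_strictMono hs).le_iff_le
        by_cases hx : x ∈ Icc a b
        · rw [indicator_of_mem hx, indicator_of_mem (hiff.2 hx), one_mul]
        · rw [indicator_of_notMem hx, indicator_of_notMem (fun h => hx (hiff.1 h)), zero_mul]
      rw [e] at h1
      exact h1
  rw [integral_indicator measurableSet_Icc] at hconv
  exact tendsto_nhds_unique hconv
    (tendsto_const_nhds.congr fun n => (horth (n + N) (Nat.le_add_left _ _)).symm)

lemma isDirichletForm (hT : T.Admissible) (hs : StrictMono T.s) :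
    (assocForm hT).IsDirichletForm :=
  { isWideDirichletForm hT with dense := dense_formDomain hs }

end ScaleTriple

/-! ### Regularity forces a continuous scale -/

namespace ScaleTriple
variable {T : ScaleTriple}

lemma scale_incl_lt_of_jump {x₀ : T.Interior} {x : T.space} (h : x < T.incl x₀) :
    T.scale x ≤ Function.leftLim T.s x₀ := by
  obtain ⟨u, h1, h2⟩ := T.exists_interior_between h
  have h3 : T.scale x ≤ T.scale (T.incl u) := T.scale_monotone h1.le
  rw [coe_incl, T.scale_interior] at h3
  exact h3.trans (T.mono.le_leftLim h2)

lemma rightLim_le_scale {x₀ : T.Interior} {x : T.space} (h : T.incl x₀ < x) :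
    Function.rightLim T.s x₀ ≤ T.scale x := by
  obtain ⟨u, h1, h2⟩ := T.exists_interior_between h
  have h3 : T.scale (T.incl u) ≤ T.scale x := T.scale_monotone h2.le
  rw [coe_incl, T.scale_interior] at h3
  exact (T.mono.rightLim_le h1).trans h3

/-- A regular form has a continuous scale. -/
lemma continuous_of_isRegular (hT : T.Admissible) (hs : StrictMono T.s)
    (hreg : (assocForm hT).IsRegular) : Continuous T.s := by
  rw [continuous_iff_continuousAt]
  intro x₀
  rw [T.mono.continuousAt_iff_leftLim_eq_rightLim]
  by_contra hne
  set p := Function.leftLim T.s x₀ with hp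
  set q := Function.rightLim T.s x₀ with hq
  have hpq : p < q := lt_of_le_of_ne (T.mono.leftLim_le_rightLim le_rfl) hne
  obtain ⟨a, ha⟩ := T.exists_lt_interior x₀
  obtain ⟨b', hb'⟩ := T.exists_gt_interior x₀
  obtain ⟨b, hb⟩ := T.exists_gt_interior b'
  have hqb : q < T.s b := (T.mono.rightLim_le hb').trans_lt (hs hb)
  -- The tent has its peak at `s(x₀+) = q` and half-width `δ`. The bound `δ ≤ q - p` makes it vanish
  -- on the left of `x₀`, the bound `δ ≤ s(b) - q` on the right of `b`.
  set δ := min (q - p) (T.s b - q) with hδ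
  have hδ0 : 0 < δ := lt_min (by linarith) (by linarith)
  have hδ1 : δ ≤ q - p := min_le_left _ _
  have hδ2 : δ ≤ T.s b - q := min_le_right _ _
  let f : T.space → ℝ := fun x => trapezoid q q (1 / δ) (T.scale x)
  have hleft : ∀ x : T.space, x < T.incl x₀ → T.scale x ≤ q - 1 / (1 / δ) := fun x hx => by
    have := scale_incl_lt_of_jump hx
    rw [one_div_one_div]; linarith
  have hf : T.MemF f := memF_trapezoid le_rfl (by positivity) (a := T.incl x₀) (b := T.incl b)
    hleft (fun x hx => by
      have h1 : T.scale (T.incl b) ≤ T.scale x := T.scale_monotone hx.le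
      rw [coe_incl, T.scale_interior] at h1
      rw [one_div_one_div]; linarith)
  obtain ⟨g, hg⟩ := hf.exists_hasDens
  let u : (assocForm hT).domain := ⟨_, _, hg.rel_toLp hf⟩
  set R := T.s b - T.s a with hR
  have hR0 : 0 < R := sub_pos.2 (hs (ha.trans (hb'.trans hb)))
  -- With this accuracy the density of the difference has squared norm at most `2 / (64 R)`, so
  -- squared increments over scale length at most `R` are at most `1/32`.
  obtain ⟨v, φ, hφ, -, hvφ, hE⟩ := hreg.dense_domain u (1 / (64 * R)) (by positivity)
  obtain ⟨fv, hfv, hvfv, hD⟩ := rel_density v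
  have hDu : T.HasDens f (density u) := by
    have : density u = hg.memLp.toLp g := density_eq hT (u := u) (hg.rel_toLp hf)
    rw [this]
    exact hg.congr hg.memLp.coeFn_toLp.symm
  have hDsub := (hDu.sub hD).congr (Lp.coeFn_sub (density u) (density v)).symm
  have hnorm : ∫ w, (density u - density v : Lp ℝ 2 T.scaleMeasure) w ^ 2 ∂T.scaleMeasure
      ≤ 2 * (1 / (64 * R)) := by
    rw [energyOne_assocForm, density_sub, norm_sq_eq_integral_sq] at hE
    have := sq_nonneg ‖((u - v : (assocForm hT).domain) : Lp ℝ 2 T.speed)‖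
    linarith
  have hgood : ∀ᵐ x ∂T.speed, fv x = φ x := hvfv.symm.trans hvφ
  obtain ⟨c₁, c₂, hc, hcs⟩ := (mem_nhds_iff_exists_Ioo_subset' (a := T.incl x₀)
    ⟨T.incl a, ha⟩ ⟨T.incl b, hb'.trans hb⟩).1
    (hφ.continuousAt.eventually (Metric.ball_mem_nhds (φ (T.incl x₀)) (show (0 : ℝ) < 1 / 8 by norm_num)))
  -- Up to `b₂` the scale exceeds the peak by less than `δ / 2`, so immediately to the right of `x₀`
  -- the tent is at least `1/2`.
  obtain ⟨b₂, hb₂, hb₂'⟩ : ∃ b₂, x₀ < b₂ ∧ T.s b₂ < q + δ / 2 := by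
    have h1 := (T.mono.tendsto_rightLim x₀).eventually
      (Iio_mem_nhds (show Function.rightLim T.s x₀ < q + δ / 2 by rw [← hq]; linarith))
    obtain ⟨y, hy1, hy2⟩ := (h1.and self_mem_nhdsWithin).exists
    exact ⟨y, hy2, hy1⟩
  -- The points `x < x₀ < y` are chosen, by full support, where the representative `fv` agrees with
  -- the continuous `φ`. Between them `f` rises by at least `1/2` and `φ` by less than `1/4`; the
  -- difference exceeds `1/4`, whose square is more than `1/32`.
  obtain ⟨x, hx, hxφ⟩ := exists_mem_Ioo_of_ae hT.support_eq hgood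
    (show max c₁ (T.incl a) < T.incl x₀ from max_lt hc.1 ha)
  obtain ⟨y, hy, hyφ⟩ := exists_mem_Ioo_of_ae hT.support_eq hgood
    (show T.incl x₀ < min c₂ (T.incl (min b₂ b)) from
      lt_min hc.2 (show x₀ < min b₂ b from lt_min hb₂ (hb'.trans hb)))
  have hxa : T.incl a < x := (le_max_right _ _).trans_lt hx.1
  have hyb : y < T.incl (min b₂ b) := hy.2.trans_le (min_le_right _ _)
  have hyb1 : y < T.incl b := hyb.trans_le (show min b₂ b ≤ b from min_le_right _ _)
  have hyb2 : y < T.incl b₂ := hyb.trans_le (show min b₂ b ≤ b₂ from min_le_left _ _)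
  have hφx : |φ x - φ (T.incl x₀)| < 1 / 8 :=
    hcs ⟨(le_max_left _ _).trans_lt hx.1, hx.2.trans hc.2⟩
  have hφy : |φ y - φ (T.incl x₀)| < 1 / 8 :=
    hcs ⟨hc.1.trans hy.1, hy.2.trans_le (min_le_left _ _)⟩
  have hfx : f x = 0 := trapezoid_of_le (by positivity) (hleft x hx.2)
  have hfy : 1 / 2 ≤ f y := by
    have h1 := rightLim_le_scale hy.1
    have h2 : T.scale y ≤ T.scale (T.incl b₂) := T.scale_monotone hyb2.le
    rw [coe_incl, T.scale_interior] at h2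
    rw [← hq] at h1
    refine le_trans ?_ (le_max_right _ _)
    rw [max_eq_right (a := q - T.scale y) (by linarith), max_eq_right (by linarith)]
    have h3 : 1 / δ * (T.scale y - q) ≤ 1 / δ * (δ / 2) :=
      mul_le_mul_of_nonneg_left (by linarith) (by positivity)
    have h4 : 1 / δ * (δ / 2) = 1 / 2 := by field_simp
    linarith
  have hsq := hDsub.sq_sub_le' (hx.2.trans hy.1).le
  simp only [Pi.sub_apply] at hsq
  have hle : T.scale y - T.scale x ≤ R := by
    have h1 : T.scale y ≤ T.scale (T.incl b) := T.scale_monotone hyb1.le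
    have h2 : T.scale (T.incl a) ≤ T.scale x := T.scale_monotone hxa.le
    rw [coe_incl, T.scale_interior] at h1 h2
    linarith
  have hfin : (f y - fv y - (f x - fv x)) ^ 2 ≤ 1 / 32 := by
    refine hsq.trans ((mul_le_mul hle hnorm (integral_nonneg fun w => sq_nonneg _) hR0.le).trans ?_)
    apply le_of_eq
    field_simp
    norm_num
  rw [hxφ, hyφ, hfx] at hfin
  rw [abs_lt] at hφx hφy
  nlinarith

/-! ### Continuity of the scale on the state space -/

/-- Monotonicity reduces the claim to finding a nearby interior point on each side: by continuity of
`s` at interior points, by its limit at reflecting endpoints. -/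
lemma continuous_scale (hc : Continuous T.s) : Continuous fun x : T.space => T.scale x := by
  rw [continuous_iff_continuousAt]
  intro x
  refine tendsto_order.2 ⟨fun c hcx => ?_, fun c hcx => ?_⟩ <;> dsimp only at hcx
  · by_cases h : (x : EReal) = T.l
    · refine Eventually.of_forall fun y => hcx.trans_le (T.scale_monotone ?_)
      exact h.le.trans (T.space_subset_Icc y.2).1
    · have : ∃ u : T.Interior, T.incl u < x ∧ c < T.s u := by
        by_cases h' : (x : EReal) = T.r
        · have ht := T.tendsto_scale_right (T.approachableRight_of_mem (h' ▸ x.2))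
          rw [h'] at hcx
          obtain ⟨u, hu⟩ := (ht.eventually (Ioi_mem_nhds hcx)).exists
          refine ⟨u, ?_, hu⟩
          have : (u : EReal) < x := by rw [h']; exact u.2.2
          exact this
        · obtain ⟨x', rfl⟩ : ∃ x' : T.Interior, T.incl x' = x :=
            ⟨⟨x, T.mem_space_of_left x.2 h h'⟩, rfl⟩
          rw [coe_incl, T.scale_interior] at hcx
          obtain ⟨u, hu1, hu2⟩ := (((hc.continuousAt (x := x')).continuousWithinAt
            (s := Iio x')).eventually (Ioi_mem_nhds hcx)).and self_mem_nhdsWithin |>.exists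
          exact ⟨u, hu2, hu1⟩
      obtain ⟨u, hu, hcu⟩ := this
      filter_upwards [Ioi_mem_nhds hu] with y hy
      have h3 : T.scale (T.incl u) ≤ T.scale y := T.scale_monotone (le_of_lt hy)
      rw [coe_incl, T.scale_interior] at h3
      exact hcu.trans_le h3
  · by_cases h : (x : EReal) = T.r
    · refine Eventually.of_forall fun y => lt_of_le_of_lt (T.scale_monotone ?_) hcx
      exact (T.space_subset_Icc y.2).2.trans h.ge
    · have : ∃ u : T.Interior, x < T.incl u ∧ T.s u < c := by
        by_cases h' : (x : EReal) = T.l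
        · have ht := T.tendsto_scale_left (T.approachableLeft_of_mem (h' ▸ x.2))
          rw [h'] at hcx
          obtain ⟨u, hu⟩ := (ht.eventually (Iio_mem_nhds hcx)).exists
          refine ⟨u, ?_, hu⟩
          have : (x : EReal) < u := by rw [h']; exact u.2.1
          exact this
        · obtain ⟨x', rfl⟩ : ∃ x' : T.Interior, T.incl x' = x :=
            ⟨⟨x, T.mem_space_of_left x.2 h' h⟩, rfl⟩
          rw [coe_incl, T.scale_interior] at hcx
          obtain ⟨u, hu1, hu2⟩ := (((hc.continuousAt (x := x')).continuousWithinAt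
            (s := Ioi x')).eventually (Iio_mem_nhds hcx)).and self_mem_nhdsWithin |>.exists
          exact ⟨u, hu2, hu1⟩
      obtain ⟨u, hu, hcu⟩ := this
      filter_upwards [Iio_mem_nhds hu] with y hy
      have h3 : T.scale y ≤ T.scale (T.incl u) := T.scale_monotone (le_of_lt hy)
      rw [coe_incl, T.scale_interior] at h3
      exact lt_of_le_of_lt h3 hcu

lemma HasDens.continuous (hc : Continuous T.s) {f : T.space → ℝ} {g : T.ScaleSpace → ℝ}
    (h : T.HasDens f g) : Continuous f := by
  rw [continuous_iff_continuousAt]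
  intro x
  have h1 : Tendsto (fun y : T.space => |T.scale y - T.scale x| * ∫ w, g w ^ 2 ∂T.scaleMeasure)
      (𝓝 x) (𝓝 0) := by
    have := (((continuous_scale hc).tendsto x).sub_const (T.scale x)).abs.mul_const
      (∫ w, g w ^ 2 ∂T.scaleMeasure)
    simpa using this
  rw [ContinuousAt, ← tendsto_sub_nhds_zero_iff]
  refine tendsto_zero_of_sq_le (fun y => ?_) h1
  rcases le_total x y with hxy | hxy
  · exact (h.sq_sub_le' hxy).trans (mul_le_mul_of_nonneg_right (le_abs_self _)
      (integral_nonneg fun w => sq_nonneg _))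
  · rw [← neg_sub, neg_sq, abs_sub_comm]
    exact (h.sq_sub_le' hxy).trans (mul_le_mul_of_nonneg_right (le_abs_self _)
      (integral_nonneg fun w => sq_nonneg _))

end ScaleTriple


/-! ### Truncations of the real line -/

/-- Truncation at the levels `± e`. -/
def truncate (e t : ℝ) : ℝ := max (-e) (min e t)

/-- The part of `t` beyond the levels `± e`. -/
def shrink (e t : ℝ) : ℝ := t - truncate e t

section Truncate
variable {e t : ℝ}

lemma truncate_mono (e : ℝ) : Monotone (truncate e) := fun a b h => by
  unfold truncate; gcongr

lemma truncate_sub_le {a b : ℝ} (h : a ≤ b) : truncate e b - truncate e a ≤ b - a := by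
  have h1 := abs_max_sub_max_le_max (-e) (min e b) (-e) (min e a)
  have h2 := abs_min_sub_min_le_max e b e a
  rw [sub_self, abs_zero, max_eq_right (abs_nonneg (min e b - min e a))] at h1
  rw [sub_self, abs_zero, max_eq_right (abs_nonneg (b - a)), abs_of_nonneg (sub_nonneg.2 h)] at h2
  exact (le_abs_self _).trans (h1.trans h2)

lemma abs_truncate_sub_le (a b : ℝ) : |truncate e a - truncate e b| ≤ |a - b| := by
  wlog h : b ≤ a generalizing a b
  · rw [abs_sub_comm, abs_sub_comm a]; exact this b a (le_of_not_ge h)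
  rw [abs_of_nonneg (sub_nonneg.2 (truncate_mono e h)), abs_of_nonneg (sub_nonneg.2 h)]
  exact truncate_sub_le h

lemma abs_shrink_sub_le (a b : ℝ) : |shrink e a - shrink e b| ≤ |a - b| := by
  wlog h : b ≤ a generalizing a b
  · rw [abs_sub_comm, abs_sub_comm a]; exact this b a (le_of_not_ge h)
  have h1 := truncate_sub_le (e := e) h
  have h2 := truncate_mono e h
  rw [abs_of_nonneg (sub_nonneg.2 h), abs_of_nonneg (by unfold shrink; linarith)]
  unfold shrink; linarith

lemma truncate_of_abs_le (h : |t| ≤ e) : truncate e t = t := by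
  rw [abs_le] at h
  rw [truncate, min_eq_right h.2, max_eq_right h.1]

lemma abs_truncate_le (he : 0 ≤ e) : |truncate e t| ≤ e :=
  abs_le.2 ⟨le_max_left _ _, max_le (by linarith) (min_le_left _ _)⟩

lemma truncate_zero (he : 0 ≤ e) : truncate e 0 = 0 := truncate_of_abs_le (by simpa using he)

lemma shrink_of_abs_le (h : |t| ≤ e) : shrink e t = 0 := by
  rw [shrink, truncate_of_abs_le h, sub_self]

lemma abs_shrink_sub_self_le (he : 0 ≤ e) : |shrink e t - t| ≤ e := by
  rw [shrink, sub_sub_cancel_left, abs_neg]; exact abs_truncate_le he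

end Truncate

/-- The truncations used to approximate functions of finite energy by bounded functions that vanish
where the given function is small. -/
def cutoff (n : ℕ) (t : ℝ) : ℝ := truncate √(n + 1) (shrink (1 / (n + 1)) t)

lemma abs_cutoff_sub_le (n : ℕ) (a b : ℝ) : |cutoff n a - cutoff n b| ≤ |a - b| :=
  (abs_truncate_sub_le _ _).trans (abs_shrink_sub_le _ _)

lemma cutoff_of_abs_le {n : ℕ} {t : ℝ} (h : |t| ≤ 1 / (n + 1)) : cutoff n t = 0 := by
  rw [cutoff, shrink_of_abs_le h, truncate_zero (Real.sqrt_nonneg _)]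

lemma abs_cutoff_le (n : ℕ) (t : ℝ) : |cutoff n t| ≤ √(n + 1) :=
  abs_truncate_le (Real.sqrt_nonneg _)

lemma abs_cutoff_le_abs (n : ℕ) (t : ℝ) : |cutoff n t| ≤ |t| := by
  have h0 : cutoff n 0 = 0 := cutoff_of_abs_le (by rw [abs_zero]; positivity)
  simpa [h0] using abs_cutoff_sub_le n t 0

lemma tendsto_cutoff (t : ℝ) : Tendsto (fun n => cutoff n t) atTop (𝓝 t) := by
  have hlim := tendsto_one_div_add_atTop_nhds_zero_nat (𝕜 := ℝ)
  have hsq : Tendsto (fun n : ℕ => √((n : ℝ) + 1)) atTop atTop :=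
    Real.tendsto_sqrt_atTop.comp (tendsto_atTop_add_const_right _ _ tendsto_natCast_atTop_atTop)
  have h1 : Tendsto (fun n : ℕ => shrink (1 / ((n : ℝ) + 1)) t) atTop (𝓝 t) := by
    rw [← tendsto_sub_nhds_zero_iff, tendsto_zero_iff_abs_tendsto_zero]
    exact squeeze_zero (fun n => abs_nonneg _)
      (fun n => abs_shrink_sub_self_le (by positivity)) hlim
  refine h1.congr' ?_
  have h2 : ∀ᶠ n : ℕ in atTop, |shrink (1 / ((n : ℝ) + 1)) t| < |t| + 1 :=
    h1.abs.eventually (Iio_mem_nhds (lt_add_one _))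
  filter_upwards [h2, hsq.eventually_ge_atTop (|t| + 1)] with n h3 h4
  rw [cutoff, truncate_of_abs_le (h3.le.trans h4)]

/-- Approximation by a Lipschitz function of `S`. -/
lemma exists_lipschitz_approx {X : Type*} [Nonempty X] {S ψ : X → ℝ} {η N C : ℝ} (hN : 0 ≤ N)
    (hC : ∀ x, |ψ x| ≤ C) (h : ∀ x z, ψ x - ψ z ≤ η + N * |S x - S z|) :
    ∃ Φ : ℝ → ℝ, (∀ a b, |Φ a - Φ b| ≤ N * |a - b|) ∧ ∀ x, |Φ (S x) - ψ x| ≤ η := by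
  have hbdd : ∀ t, BddBelow (range fun x => ψ x + N * |t - S x|) := fun t => by
    refine ⟨-C, ?_⟩
    rintro _ ⟨x, rfl⟩
    have := (abs_le.1 (hC x)).1
    have := mul_nonneg hN (abs_nonneg (t - S x))
    linarith
  have hle : ∀ a b, (⨅ x, (ψ x + N * |a - S x|)) ≤ (⨅ x, (ψ x + N * |b - S x|)) + N * |a - b| := by
    intro a b
    rw [← sub_le_iff_le_add]
    refine le_ciInf fun x => ?_
    have h1 := ciInf_le (hbdd a) x
    have h2 := mul_le_mul_of_nonneg_left (abs_sub_le a b (S x)) hN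
    linarith
  -- McShane's formula: an infimum of functions with Lipschitz constant `N`. The term `x = z` bounds
  -- it above by `ψ z` at `S z`, and the hypothesis bounds it below by `ψ z - η`.
  refine ⟨fun t => ⨅ x, (ψ x + N * |t - S x|), fun a b => ?_, fun z => ?_⟩
  · rw [abs_le]
    have h1 := hle a b
    have h2 := hle b a
    rw [abs_sub_comm b a] at h2
    constructor <;> linarith
  · have h1 := ciInf_le (hbdd (S z)) z
    have h2 : ψ z - η ≤ ⨅ x, (ψ x + N * |S z - S x|) := le_ciInf fun x => by
      have := h z x
      linarith
    simp only [sub_self, abs_zero, mul_zero, add_zero] at h1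
    have hη : 0 ≤ η := by simpa using h z z
    rw [abs_le]
    constructor <;> linarith

namespace ScaleTriple
variable {T : ScaleTriple}

/-! ### Regularity for a continuous scale -/

/-- A Leibniz rule at the level of increments: `Δ(f₁ f₂) = f₂(y) Δf₁ + f₁(x) Δf₂`, and `(a + b)² ≤
2a² + 2b²`. The Riesz criterion applies with the corresponding combination of the two energy
distributions. -/
lemma HasDens.mul {f₁ f₂ : T.space → ℝ} {g₁ g₂ : T.ScaleSpace → ℝ} {M₁ M₂ : ℝ}
    (h₁ : T.HasDens f₁ g₁) (h₂ : T.HasDens f₂ g₂) (hM₁ : ∀ x, |f₁ x| ≤ M₁)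
    (hM₂ : ∀ x, |f₂ x| ≤ M₂) :
    ∃ g, T.HasDens (fun x => f₁ x * f₂ x) g ∧ ∫ w, g w ^ 2 ∂T.scaleMeasure ≤
      2 * M₂ ^ 2 * (∫ w, g₁ w ^ 2 ∂T.scaleMeasure) +
        2 * M₁ ^ 2 * ∫ w, g₂ w ^ 2 ∂T.scaleMeasure := by
  refine exists_hasDens (H := fun x => 2 * M₂ ^ 2 * energyBelow g₁ x +
    2 * M₁ ^ 2 * energyBelow g₂ x) ?_ ?_ ?_
  · exact ((energyBelow_mono h₁.memLp).const_mul (by positivity)).add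
      ((energyBelow_mono h₂.memLp).const_mul (by positivity))
  · intro x y
    have e1 := mul_le_mul_of_nonneg_left (energyBelow_sub_le h₁.memLp x y)
      (show 0 ≤ 2 * M₂ ^ 2 by positivity)
    have e2 := mul_le_mul_of_nonneg_left (energyBelow_sub_le h₂.memLp x y)
      (show 0 ≤ 2 * M₁ ^ 2 by positivity)
    linarith
  · intro x y hxy
    have e1 := mul_le_mul_of_nonneg_left (h₁.sq_sub_le_energyBelow hxy)
      (show 0 ≤ 2 * M₂ ^ 2 by positivity)
    have e2 := mul_le_mul_of_nonneg_left (h₂.sq_sub_le_energyBelow hxy)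
      (show 0 ≤ 2 * M₁ ^ 2 by positivity)
    have b1 : f₁ x ^ 2 ≤ M₁ ^ 2 := sq_le_sq' (abs_le.1 (hM₁ x)).1 (abs_le.1 (hM₁ x)).2
    have b2 : f₂ y ^ 2 ≤ M₂ ^ 2 := sq_le_sq' (abs_le.1 (hM₂ y)).1 (abs_le.1 (hM₂ y)).2
    have c1 := mul_le_mul_of_nonneg_right b1 (sq_nonneg (f₂ y - f₂ x))
    have c2 := mul_le_mul_of_nonneg_right b2 (sq_nonneg (f₁ y - f₁ x))
    have key : (f₁ y * f₂ y - f₁ x * f₂ x) ^ 2 ≤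
        2 * (f₂ y ^ 2 * (f₁ y - f₁ x) ^ 2) + 2 * (f₁ x ^ 2 * (f₂ y - f₂ x) ^ 2) := by
      have := sq_nonneg (f₂ y * (f₁ y - f₁ x) - f₁ x * (f₂ y - f₂ x))
      linarith
    linarith

/-- Three cases: if `l` is in the space nothing lies below it; if `l` is not approachable the scale
tends to `-∞`; otherwise `f` tends to `0`. The two alternatives match the two cutoffs, in scale and
in value. -/
lemma exists_left_cut {f : T.space → ℝ} (hf : T.VanishLeft f) {e : ℝ} (he : 0 < e) (R : ℝ) :
    ∃ a : T.space, ∀ x < a, |f x| ≤ e ∨ T.scale x ≤ R := by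
  by_cases hl : T.l ∈ T.space
  · exact ⟨⟨T.l, hl⟩, fun x hx => absurd (T.space_subset_Icc x.2).1 (not_le.2 hx)⟩
  have key : ∀ᶠ x : T.Interior in atBot, |f (T.incl x)| ≤ e ∨ T.scale x ≤ R := by
    rcases tendsto_atBot_of_monotone T.mono with h | h
    · filter_upwards [h.eventually_le_atBot R] with x hx
      rw [T.scale_interior]; exact Or.inr hx
    · have := (hf hl h).abs
      rw [abs_zero] at this
      filter_upwards [this.eventually (Iio_mem_nhds he)] with x hx
      exact Or.inl (le_of_lt hx)
  obtain ⟨a, ha⟩ := eventually_atBot.1 key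
  refine ⟨T.incl a, fun x hx => ?_⟩
  have hx' : (x : EReal) < a := hx
  exact ha ⟨x, T.mem_space_of_left x.2 (fun h => hl (h ▸ x.2)) (hx'.trans a.2.2).ne⟩ hx'.le

lemma exists_right_cut {f : T.space → ℝ} (hf : T.VanishRight f) {e : ℝ} (he : 0 < e) (R : ℝ) :
    ∃ b : T.space, ∀ x > b, |f x| ≤ e ∨ R ≤ T.scale x := by
  by_cases hr : T.r ∈ T.space
  · exact ⟨⟨T.r, hr⟩, fun x hx => absurd (T.space_subset_Icc x.2).2 (not_le.2 hx)⟩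
  have key : ∀ᶠ x : T.Interior in atTop, |f (T.incl x)| ≤ e ∨ R ≤ T.scale x := by
    rcases tendsto_atTop_of_monotone T.mono with h | h
    · filter_upwards [h.eventually_ge_atTop R] with x hx
      rw [T.scale_interior]; exact Or.inr hx
    · have := (hf hr h).abs
      rw [abs_zero] at this
      filter_upwards [this.eventually (Iio_mem_nhds he)] with x hx
      exact Or.inl (le_of_lt hx)
  obtain ⟨a, ha⟩ := eventually_atTop.1 key
  refine ⟨T.incl a, fun x hx => ?_⟩
  have hx' : (a : EReal) < x := hx
  exact ha ⟨x, T.mem_space_of_left x.2 (a.2.1.trans hx').ne' (fun h => hr (h ▸ x.2))⟩ hx'.le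

/-- Approximation by compactly supported functions with bounded energies. -/
lemma exists_compact_approx (hc : Continuous T.s) {f : T.space → ℝ} {g : T.ScaleSpace → ℝ}
    (hf : T.MemF f) (hg : T.HasDens f g) (n : ℕ) :
    ∃ gn, T.HasDens (fun x => trapezoid 0 0 (1 / (n + 1)) (T.scale x) * cutoff n (f x)) gn ∧
      ∫ w, gn w ^ 2 ∂T.scaleMeasure ≤ 2 * (∫ w, g w ^ 2 ∂T.scaleMeasure) + 4 ∧
      T.MemF (fun x => trapezoid 0 0 (1 / (n + 1)) (T.scale x) * cutoff n (f x)) ∧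
      Continuous (fun x : T.space => trapezoid 0 0 (1 / (n + 1)) (T.scale x) * cutoff n (f x)) ∧
      HasCompactSupport
        (fun x : T.space => trapezoid 0 0 (1 / (n + 1)) (T.scale x) * cutoff n (f x)) := by
  have hn : (0 : ℝ) < n + 1 := by positivity
  have hcn : (0 : ℝ) < 1 / (n + 1) := by positivity
  obtain ⟨k, hk, hke⟩ := exists_hasDens_of_clamp (T := T) (Φ := trapezoid 0 0 (1 / (n + 1)))
    (p := 0 - 1 / (1 / ((n : ℝ) + 1))) (q := 0 + 1 / (1 / ((n : ℝ) + 1)))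
    (by rw [one_div_one_div]; linarith) (trapezoid_lipschitz hcn.le) (trapezoid_clamp hcn le_rfl)
  obtain ⟨j, hj, hje⟩ := hg.contraction (abs_cutoff_sub_le n)
  obtain ⟨gn, hgn, hgne⟩ := hk.mul hj (M₁ := 1) (M₂ := √(n + 1))
    (fun x => by rw [abs_of_nonneg (trapezoid_nonneg _)]; exact trapezoid_le_one hcn.le _)
    (fun x => abs_cutoff_le n _)
  rw [Real.sq_sqrt hn.le] at hgne
  -- The tent of slope `1 / (n + 1)` has energy at most `2 / (n + 1)`. Truncating `f` at height `√(n
  -- + 1)` multiplies it by at most `2 (n + 1)`, so the contribution stays bounded by `4`.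
  have hke' : 2 * ((n : ℝ) + 1) * ∫ w, k w ^ 2 ∂T.scaleMeasure ≤ 4 := by
    have := mul_le_mul_of_nonneg_left hke (show 0 ≤ 2 * ((n : ℝ) + 1) by positivity)
    refine this.trans (le_of_eq ?_)
    rw [one_div_one_div]
    field_simp
    ring
  have hcont := hgn.continuous hc
  obtain ⟨-, -, hl, hr⟩ := memF_iff.1 hf
  -- Outside `[a, b]` either `|f| ≤ 1 / (n + 1)`, and the cutoff vanishes, or the scale is at least
  -- `n + 1` in absolute value, and the tent vanishes.
  obtain ⟨a, ha⟩ := exists_left_cut hl hcn (-(n + 1))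
  obtain ⟨b, hb⟩ := exists_right_cut hr hcn (n + 1)
  have hsupp : ∀ x ∉ Icc a b, trapezoid 0 0 (1 / (n + 1)) (T.scale x) * cutoff n (f x) = 0 := by
    intro x hx
    by_cases h : x < a
    · rcases ha x h with h1 | h1
      · rw [cutoff_of_abs_le h1, mul_zero]
      · rw [trapezoid_of_le hcn (by rw [one_div_one_div]; linarith), zero_mul]
    · have h' : b < x := by
        by_contra h'
        exact hx ⟨not_lt.1 h, not_lt.1 h'⟩
      rcases hb x h' with h1 | h1
      · rw [cutoff_of_abs_le h1, mul_zero]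
      · rw [trapezoid_of_ge hcn (by rw [one_div_one_div]; linarith), zero_mul]
  refine ⟨gn, hgn, by linarith, memF_of_support hgn hcont.measurable (C := √(n + 1))
    (fun x => ?_) hsupp, hcont, HasCompactSupport.intro isCompact_Icc hsupp⟩
  rw [abs_mul, abs_of_nonneg (trapezoid_nonneg _)]
  exact (mul_le_of_le_one_left (abs_nonneg _) (trapezoid_le_one hcn.le _)).trans (abs_cutoff_le n _)

lemma tendsto_trapezoid_zero (t : ℝ) :
    Tendsto (fun n : ℕ => trapezoid 0 0 (1 / (n + 1)) t) atTop (𝓝 1) := by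
  have h : Tendsto (fun n : ℕ => max 0 (1 - 1 / ((n : ℝ) + 1) * max 0 (max (0 - t) (t - 0)))) atTop
      (𝓝 (max 0 (1 - 0 * max 0 (max (0 - t) (t - 0))))) :=
    tendsto_const_nhds.max (tendsto_const_nhds.sub
      (tendsto_one_div_add_atTop_nhds_zero_nat.mul_const _))
  simpa [trapezoid] using h

variable (T) in
/-- The graph of the density over the compactly supported continuous functions in `ℱ`. -/
def compactGraph : Submodule ℝ (WithLp 2 (Lp ℝ 2 T.speed × Lp ℝ 2 T.scaleMeasure)) where
  carrier := {z | (∃ φ : T.space → ℝ, Continuous φ ∧ HasCompactSupport φ ∧ z.fst =ᵐ[T.speed] φ) ∧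
    Rel z.fst z.snd}
  add_mem' := by
    rintro z z' ⟨⟨φ, h1, h2, h3⟩, h4⟩ ⟨⟨φ', h1', h2', h3'⟩, h4'⟩
    exact ⟨⟨φ + φ', h1.add h1', h2.add h2', (Lp.coeFn_add _ _).trans (h3.add h3')⟩, h4.add h4'⟩
  zero_mem' := ⟨⟨0, continuous_const, HasCompactSupport.zero, Lp.coeFn_zero _ _ _⟩, rel_zero⟩
  smul_mem' := by
    rintro c z ⟨⟨φ, h1, h2, h3⟩, h4⟩
    exact ⟨⟨c • φ, h1.const_smul c, h2.smul_left (f := fun _ => c),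
      (Lp.coeFn_smul _ _).trans (h3.const_smul c)⟩, h4.smul c⟩

/-- The approximants have bounded energies, hence their densities converge only weakly. For a linear
subspace this suffices: the closure is the double orthogonal complement, and orthogonality to the
subspace passes to weak limits. -/
lemma mem_closure_compactGraph (hc : Continuous T.s) {u : Lp ℝ 2 T.speed}
    {G : Lp ℝ 2 T.scaleMeasure} (h : Rel u G) :
    WithLp.toLp 2 (u, G) ∈ T.compactGraph.topologicalClosure := by
  rw [← Submodule.orthogonal_orthogonal_eq_closure, Submodule.mem_orthogonal']
  intro z hz
  rw [Submodule.mem_orthogonal] at hz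
  obtain ⟨f, hf, huf, hfG⟩ := h
  choose g hg hge hF hcont hcs using exists_compact_approx hc hf hfG
  set v : ℕ → T.space → ℝ := fun n x => trapezoid 0 0 (1 / (n + 1)) (T.scale x) * cutoff n (f x)
    with hv
  have horth : ∀ n, inner ℝ ((hF n).memLp.toLp (v n)) z.fst
      + inner ℝ ((hg n).memLp.toLp (g n)) z.snd = 0 := fun n =>
    hz (WithLp.toLp 2 ((hF n).memLp.toLp (v n), (hg n).memLp.toLp (g n)))
      ⟨⟨v n, hcont n, hcs n, (hF n).memLp.coeFn_toLp⟩, (hg n).rel_toLp (hF n)⟩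
  have hvf : ∀ x, Tendsto (fun n => v n x) atTop (𝓝 (f x)) := fun x => by
    have := (tendsto_trapezoid_zero (T.scale x)).mul (tendsto_cutoff (f x))
    rwa [one_mul] at this
  have hvle : ∀ n x, |v n x| ≤ |f x| := fun n x => by
    have hcn : (0 : ℝ) ≤ 1 / (n + 1) := by positivity
    rw [hv]
    dsimp only
    rw [abs_mul, abs_of_nonneg (trapezoid_nonneg _)]
    exact (mul_le_of_le_one_left (abs_nonneg _) (trapezoid_le_one hcn _)).trans
      (abs_cutoff_le_abs n _)
  have hlim1 : Tendsto (fun n => inner ℝ ((hF n).memLp.toLp (v n)) z.fst) atTop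
      (𝓝 (inner ℝ u z.fst)) := by
    have e1 : ∀ n, inner ℝ ((hF n).memLp.toLp (v n)) z.fst = ∫ x, v n x * z.fst x ∂T.speed :=
      fun n => by
        rw [L2.inner_def]
        refine integral_congr_ae ?_
        filter_upwards [(hF n).memLp.coeFn_toLp] with x hx
        rw [hx, real_inner_comm]; rfl
    have e2 : inner ℝ u z.fst = ∫ x, f x * z.fst x ∂T.speed := by
      rw [L2.inner_def]
      refine integral_congr_ae ?_
      filter_upwards [huf] with x hx
      rw [hx]; simp [mul_comm]
    simp_rw [e1, e2]
    refine tendsto_integral_of_dominated_convergence (fun x => |f x * z.fst x|)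
      (fun n => (hF n).memLp.1.mul (Lp.memLp z.fst).1)
      (hf.memLp.integrable_mul (Lp.memLp z.fst)).abs (fun n => ae_of_all _ fun x => ?_)
      (ae_of_all _ fun x => (hvf x).mul_const _)
    rw [Real.norm_eq_abs, abs_mul, abs_mul (f x)]
    exact mul_le_mul_of_nonneg_right (hvle n x) (abs_nonneg _)
  set M := √(2 * (∫ w, G w ^ 2 ∂T.scaleMeasure) + 4) with hM
  obtain ⟨G', -, hG'⟩ := exists_weak_limit (Ultrafilter.of (atTop : Filter ℕ))
    (fun n => (hg n).memLp.toLp (g n)) M fun n => Real.le_sqrt_of_sq_le (by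
      rw [norm_toLp_sq]; exact hge n)
  have hU : (Ultrafilter.of (atTop : Filter ℕ) : Filter ℕ) ≤ atTop := Ultrafilter.of_le _
  have hD : T.HasDens f G' := HasDens.of_sub_eq (Lp.memLp G') fun x y hxy => by
    have hfin := T.gap_ne_top (T.space_scaleFinite x) (T.space_scaleFinite y)
    have e : ∀ F : Lp ℝ 2 T.scaleMeasure,
        inner ℝ F (indicatorConstLp 2 (T.measurableSet_gap x y) hfin (1 : ℝ))
          = ∫ w in T.gap x y, F w ∂T.scaleMeasure := fun F => by
      rw [real_inner_comm, L2.inner_indicatorConstLp_one]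
    have h1 := hG' (indicatorConstLp 2 (T.measurableSet_gap x y) hfin (1 : ℝ))
    simp_rw [e] at h1
    refine tendsto_nhds_unique ((((hvf y).sub (hvf x)).mono_left hU).congr fun n => ?_) h1
    rw [(hg n).sub_eq hxy]
    exact integral_congr_ae (ae_restrict_of_ae (hg n).memLp.coeFn_toLp.symm)
  -- The weak limit is a density of the pointwise limit `f`, so uniqueness of densities identifies
  -- it.
  have hGG' : G' = G := Lp.ext (hD.unique hfG)
  have hlim2 := hG' z.snd
  rw [hGG'] at hlim2
  have := ((hlim1.mono_left hU).add hlim2).congr horth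
  exact tendsto_nhds_unique this tendsto_const_nhds

lemma exists_compact_energyOne_lt (hT : T.Admissible) (hc : Continuous T.s)
    (u : (assocForm hT).domain) {ε : ℝ} (hε : 0 < ε) :
    ∃ v : (assocForm hT).domain, ∃ φ : T.space → ℝ, Continuous φ ∧ HasCompactSupport φ ∧
      ((v : Lp ℝ 2 T.speed) : T.space → ℝ) =ᵐ[T.speed] φ ∧
        (assocForm hT).energyOne (u - v) < ε := by
  have h := mem_closure_compactGraph hc (rel_density u)
  obtain ⟨z, ⟨⟨φ, h1, h2, h3⟩, hz⟩, hdist⟩ := Metric.mem_closure_iff.1 h (√ε) (Real.sqrt_pos.2 hε)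
  let v : (assocForm hT).domain := ⟨z.fst, z.snd, hz⟩
  refine ⟨v, φ, h1, h2, h3, ?_⟩
  have hv : density v = z.snd := density_eq hT (u := v) hz
  rw [dist_eq_norm] at hdist
  have h4 := pow_lt_pow_left₀ hdist (norm_nonneg _) two_ne_zero
  rw [Real.sq_sqrt hε.le, WithLp.prod_norm_sq_eq_of_L2] at h4
  rw [energyOne_assocForm, density_sub, hv]
  have h5 : 0 ≤ ‖density u - z.snd‖ ^ 2 := sq_nonneg _
  have h6 : ‖((u : Lp ℝ 2 T.speed) - z.fst)‖ ^ 2 + ‖density u - z.snd‖ ^ 2 < ε := h4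
  change 1 / 2 * ‖density u - z.snd‖ ^ 2 + ‖((u : Lp ℝ 2 T.speed) - z.fst)‖ ^ 2 < ε
  linarith

end ScaleTriple

/-! ### Uniform approximation of compactly supported continuous functions -/

namespace ScaleTriple
variable {T : ScaleTriple}

/-- A compactly supported function is carried by a compact interval outside of which it keeps
its value at the nearest endpoint, which is zero. -/
lemma exists_Icc_of_hasCompactSupport {ψ : T.space → ℝ} (hψ : HasCompactSupport ψ) :
    ∃ a b : T.space, a ≤ b ∧ (∀ x ∉ Icc a b, ψ x = 0) ∧ ∀ x, ψ (max a (min b x)) = ψ x := by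
  -- The point `0` is added so that the compact set is nonempty even if `ψ = 0`.
  have hK : IsCompact (insert (T.incl T.zero) (tsupport ψ)) := hψ.isCompact.insert _
  obtain ⟨a₀, ha₀, hamin⟩ := hK.exists_isLeast (insert_nonempty _ _)
  obtain ⟨b₀, hb₀, hbmax⟩ := hK.exists_isGreatest (insert_nonempty _ _)
  have hL : ∀ x < a₀, ψ x = 0 := fun x hx => image_eq_zero_of_notMem_tsupport fun h =>
    absurd (hamin (mem_insert_of_mem _ h)) (not_le.2 hx)
  have hR : ∀ x > b₀, ψ x = 0 := fun x hx => image_eq_zero_of_notMem_tsupport fun h =>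
    absurd (hbmax (mem_insert_of_mem _ h)) (not_le.2 hx)
  -- A point strictly below the support is taken when there is one, which gives `ψ a = 0`. Otherwise
  -- `a₀` is the least point of the space, and the claim about smaller points is empty.
  obtain ⟨a, ha, ha'⟩ : ∃ a ≤ a₀, ∀ x < a, ψ x = 0 ∧ ψ a = 0 := by
    by_cases h : ∃ z, z < a₀
    · obtain ⟨z, hz⟩ := h
      exact ⟨z, hz.le, fun x hx => ⟨hL x (hx.trans hz), hL z hz⟩⟩
    · exact ⟨a₀, le_rfl, fun x hx => absurd ⟨x, hx⟩ h⟩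
  obtain ⟨b, hb, hb'⟩ : ∃ b ≥ b₀, ∀ x > b, ψ x = 0 ∧ ψ b = 0 := by
    by_cases h : ∃ z, z > b₀
    · obtain ⟨z, hz⟩ := h
      exact ⟨z, hz.le, fun x hx => ⟨hR x (lt_trans hz hx), hR z hz⟩⟩
    · exact ⟨b₀, le_rfl, fun x hx => absurd ⟨x, hx⟩ h⟩
  have hab : a ≤ b := ha.trans ((hamin hb₀).trans hb)
  refine ⟨a, b, hab, fun x hx => ?_, fun x => ?_⟩
  · by_cases h : x < a
    · exact (ha' x h).1
    · refine (hb' x ?_).1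
      by_contra h'
      exact hx ⟨not_lt.1 h, not_lt.1 h'⟩
  · by_cases h : x < a
    · rw [min_eq_right (h.le.trans hab), max_eq_left h.le, (ha' x h).1, (ha' x h).2]
    · by_cases h' : b < x
      · rw [min_eq_left h'.le, max_eq_right hab, (hb' x h').1, (hb' x h').2]
      · rw [min_eq_right (not_lt.1 h'), max_eq_right (not_lt.1 h)]

/-- Pairs in `[a, b]²` with `ψ x - ψ z ≥ η` form a compact set off the diagonal. The scale is
continuous and injective, so `|S x - S z|` has there a positive minimum `δ`, and `N = 2C / δ`
absorbs the oscillation `2C` of `ψ`. -/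
lemma exists_modulus (hs : StrictMono T.s) (hc : Continuous T.s) {ψ : T.space → ℝ}
    (hψ : Continuous ψ) {C : ℝ} (hC : ∀ x, |ψ x| ≤ C) (a b : T.space) {η : ℝ} (hη : 0 < η) :
    ∃ N ≥ 0, ∀ x ∈ Icc a b, ∀ z ∈ Icc a b, ψ x - ψ z ≤ η + N * |T.scale x - T.scale z| := by
  have hS := continuous_scale hc
  have hC0 : 0 ≤ C := (abs_nonneg _).trans (hC a)
  have hd : Continuous fun y : T.space × T.space => ψ y.1 - ψ y.2 :=
    (hψ.comp continuous_fst).sub (hψ.comp continuous_snd)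
  let D : Set (T.space × T.space) := (Icc a b ×ˢ Icc a b) ∩ {y | η ≤ ψ y.1 - ψ y.2}
  have hD : IsCompact D := (isCompact_Icc.prod isCompact_Icc).inter_right
    (isClosed_le continuous_const hd)
  have hdist : Continuous fun y : T.space × T.space => |T.scale y.1 - T.scale y.2| :=
    ((hS.comp continuous_fst).sub (hS.comp continuous_snd)).abs
  rcases D.eq_empty_or_nonempty with h | h
  · refine ⟨0, le_rfl, fun x hx z hz => ?_⟩
    rw [zero_mul, add_zero]
    by_contra hcon
    have : (x, z) ∈ D := ⟨⟨hx, hz⟩, (not_le.1 hcon).le⟩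
    rw [h] at this
    exact this
  · obtain ⟨y, hyD, hy⟩ := hD.exists_isMinOn h hdist.continuousOn
    have hmin : ∀ w ∈ D, |T.scale y.1 - T.scale y.2| ≤ |T.scale w.1 - T.scale w.2| :=
      fun w hw => isMinOn_iff.1 hy w hw
    clear hy
    obtain ⟨δ, hδ⟩ : ∃ δ, δ = |T.scale y.1 - T.scale y.2| := ⟨_, rfl⟩
    rw [← hδ] at hmin
    have hδ0 : 0 < δ := by
      rw [hδ, abs_pos, sub_ne_zero]
      intro heq
      have h1 : y.1 = y.2 := by
        by_contra hne
        rcases lt_or_gt_of_ne hne with h' | h'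
        · have h2 : T.scale y.1 < T.scale y.2 := T.scale_strictMono hs h'
          exact h2.ne heq
        · have h2 : T.scale y.2 < T.scale y.1 := T.scale_strictMono hs h'
          exact h2.ne heq.symm
      have h2 : η ≤ ψ y.1 - ψ y.2 := hyD.2
      rw [h1, sub_self] at h2
      linarith
    refine ⟨2 * C / δ, by positivity, fun x hx z hz => ?_⟩
    by_cases hxz : η ≤ ψ x - ψ z
    · have h1 : δ ≤ |T.scale x - T.scale z| :=
        hmin (x, z) ⟨⟨hx, hz⟩, hxz⟩
      have h2 : 2 * C / δ * δ ≤ 2 * C / δ * |T.scale x - T.scale z| :=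
        mul_le_mul_of_nonneg_left h1 (by positivity)
      rw [div_mul_cancel₀ _ hδ0.ne'] at h2
      have h3 := abs_le.1 (hC x)
      have h4 := abs_le.1 (hC z)
      linarith
    · have : 0 ≤ 2 * C / δ * |T.scale x - T.scale z| := by positivity
      linarith

/-- Uniform approximation of compactly supported continuous functions. -/
lemma exists_memF_near (hs : StrictMono T.s) (hc : Continuous T.s) {ψ : T.space → ℝ}
    (hψ : Continuous ψ) (hψc : HasCompactSupport ψ) {ε : ℝ} (hε : 0 < ε) :
    ∃ φ : T.space → ℝ, T.MemF φ ∧ Continuous φ ∧ HasCompactSupport φ ∧ ∀ x, |ψ x - φ x| < ε := by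
  obtain ⟨a, b, hab, hzero, hclamp⟩ := exists_Icc_of_hasCompactSupport hψc
  obtain ⟨C, hC⟩ := hψ.bounded_above_of_compact_support hψc
  -- One `η` is lost in the Lipschitz approximation and one in the shrinking below; the total `2η`
  -- is less than `ε`.
  set η := ε / 3 with hη
  have hη0 : 0 < η := by positivity
  obtain ⟨N, hN, hmod⟩ := exists_modulus hs hc hψ hC a b hη0
  have : Nonempty (Icc a b) := ⟨⟨a, le_rfl, hab⟩⟩
  obtain ⟨Φ, hΦ, hΦψ⟩ := exists_lipschitz_approx (X := Icc a b) (S := fun x => T.scale x)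
    (ψ := fun x => ψ x) hN (fun x => hC x) fun x z => hmod x x.2 z z.2
  have hSab : T.scale a ≤ T.scale b := T.scale_monotone hab
  have hclampS : ∀ x : T.space, max (T.scale a) (min (T.scale b) (T.scale x))
      = T.scale (max a (min b x) : T.space) := fun x =>
    ((T.scale_monotone.map_max (a := a) (b := min b x)).trans
      (congrArg _ (T.scale_monotone.map_min (a := b) (b := x)))).symm
  -- Clamping extends the approximation beyond `[a, b]`. There `ψ = 0`, so the approximation is at
  -- most `η` in absolute value, and shrinking by `η` makes it vanish exactly, which gives compact
  -- support.
  let Ψ : ℝ → ℝ := fun t => shrink η (Φ (max (T.scale a) (min (T.scale b) t)))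
  have hΨ : ∀ s t, |Ψ s - Ψ t| ≤ N * |s - t| := fun s t => by
    refine (abs_shrink_sub_le _ _).trans ((hΦ _ _).trans (mul_le_mul_of_nonneg_left ?_ hN))
    have h1 := abs_max_sub_max_le_max (T.scale a) (min (T.scale b) s) (T.scale a)
      (min (T.scale b) t)
    have h2 := abs_min_sub_min_le_max (T.scale b) s (T.scale b) t
    rw [sub_self, abs_zero, max_eq_right (abs_nonneg (min (T.scale b) s - min (T.scale b) t))] at h1
    rw [sub_self, abs_zero, max_eq_right (abs_nonneg (s - t))] at h2
    exact h1.trans h2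
  have hΨc : ∀ t, Ψ (max (T.scale a) (min (T.scale b) t)) = Ψ t := fun t => by
    have h1 : T.scale a ≤ max (T.scale a) (min (T.scale b) t) := le_max_left _ _
    have h2 : max (T.scale a) (min (T.scale b) t) ≤ T.scale b := max_le hSab (min_le_left _ _)
    simp only [Ψ]
    rw [min_eq_right h2, max_eq_right h1]
  have hnear : ∀ x : T.space, |Φ (max (T.scale a) (min (T.scale b) (T.scale x))) - ψ x| ≤ η := by
    intro x
    rw [hclampS, ← hclamp x]
    exact hΦψ ⟨max a (min b x), le_max_left _ _, max_le hab (min_le_left _ _)⟩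
  have hsupp : ∀ x : T.space, x ∉ Icc a b → Ψ (T.scale x) = 0 := fun x hx => by
    have := hnear x
    rw [hzero x hx, sub_zero] at this
    exact shrink_of_abs_le this
  refine ⟨fun x => Ψ (T.scale x), memF_of_clamp hSab hΨ hΨc hsupp,
    (continuous_of_abs_sub_le hΨ).comp (continuous_scale hc),
    HasCompactSupport.intro isCompact_Icc hsupp, fun x => ?_⟩
  have h1 := abs_le.1 (hnear x)
  have h2 := abs_le.1 (abs_shrink_sub_self_le (e := η)
    (t := Φ (max (T.scale a) (min (T.scale b) (T.scale x)))) hη0.le)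
  change |ψ x - shrink η (Φ (max (T.scale a) (min (T.scale b) (T.scale x))))| < ε
  rw [abs_lt]
  constructor <;> linarith

lemma isRegular_of_continuous (hT : T.Admissible) (hs : StrictMono T.s) (hc : Continuous T.s) :
    (assocForm hT).IsRegular where
  dense_domain u _ hε := exists_compact_energyOne_lt hT hc u hε
  dense_cc ψ hψ hψc ε hε := by
    obtain ⟨φ, hφ, h1, h2, h3⟩ := exists_memF_near hs hc hψ hψc hε
    obtain ⟨g, hg⟩ := hφ.exists_hasDens
    exact ⟨⟨_, _, hg.rel_toLp hφ⟩, φ, h1, h2, hφ.memLp.coeFn_toLp, h3⟩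

end ScaleTriple
end

theorem lemma6p1 (T : ScaleTriple) (hs : StrictMono T.s)
    (hsupp : (T.m.restrict (Icc T.l T.r)).support = Icc T.l T.r)
    (hatom : ∀ x ∈ T.leftJumps ∩ T.rightJumps, 0 < T.m {(x : EReal)}) :
    ∃ A : L2Form T.speed, T.IsAssociatedForm A ∧ A.IsDirichletForm ∧
      (A.IsRegular ↔ Continuous T.s) := by
  have hT : T.Admissible := ⟨hsupp, hatom⟩
  exact ⟨ScaleTriple.assocForm hT, ScaleTriple.isAssociatedForm hT,
    ScaleTriple.isDirichletForm hT hs, ScaleTriple.continuous_of_isRegular hT hs,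
    ScaleTriple.isRegular_of_continuous hT hs⟩
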